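/- **Setting.** Let $d\ge 1$ and let $\varphi_0=1$, $\varphi_{2j-1}(x)=\sqrt2\sin(2\pi jx)$, $\varphi_{2j}(x)=\sqrt2\cos(2\pi jx)$ ($j\ge1$), $\varphi_{\mathbf l}(\mathbf x)=\prod_{j=1}^d\varphi_{l_j}(x_j)$ for $\mathbf l\in\mathbb N_0^d$. For $s,r>0$ let $\mathcal F_{s,r,d}$ be the set of probability densities $f\in L^2([0,1]^d)$ of the form $f=1+\sum_{\mathbf l}\theta_{\mathbf l}\varphi_{\mathbf l}$ with $\sum_{\mathbf l}\|\mathbf l\|_2^{2s}\theta_{\mathbf l}^2\le r^2$. Let $n_1\le n_2$, and let $X_1,\dots,X_{n_1}\sim f_X$ and $Y_1,\dots,Y_{n_2}\sim f_Y$ be independent, with $f_X,f_Y\in\mathcal F_{s,r,d}$. A (sequentially interactive) mechanism $Q$ with output spaces $\mathcal Z,\mathcal W$ produces private views $Z_1,\dots,Z_{n_1}\in\mathcal Z$ and $W_1,\dots,W_{n_2}\in\mathcal W$: for $i\le n_1$, $Z_i$ is drawn from a conditional distribution given $X_i$ and $(Z_j,W_j)_{j<i}$, and $W_i$, conditionally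 independently of $Z_i$, from one given $Y_i$ and $(Z_j,W_j)_{j<i}$; for $n_1<j\le n_2$, $W_j$ is drawn from a conditional distribution given $Y_j$, $Z_1,\dots,Z_{n_1}$ and $W_1,\dots,W_{j-1}$. It is $\varepsilon$-LDP if for each of these conditional distributions, each measurable set $S$ and each value of the past views, the probability of $S$ given one value of the datum is at most $e^{\varepsilon}$ times that given any other value of the datum. It is non-interactive if each view depends on its own datum only. A test is a measurable $\{0,1\}$-valued function $\phi$ of all the private views; it has level $\alpha$ for $Q$ if $\mathbb P(\phi=1)\le\alpha$ whenever $f_X=f_Y\in\mathcal F_{s,r,d}$. For $p\in[1,2]$ define $$\mathcal R(\rho)=\alpha+\inf_Q\ \inf_{\phi\text{ of level }\alpha\text{ for }Q}\ \sup\{\mathbb P_{f_X,f_Y,Q}(\phi=0): f_X,f_Y\in\mathcal F_{s,r,d},\ \|f_X-f_Y\|_p\ge\rho\},\qquad \rho^*=\inf\{\rho>0:\mathcal R(\rho)\le\alpha+\beta\},$$ (a supremum over the empty set being $0$), and write $\rho^*_{\mathrm{NI}}$, $\rho^*_{\mathrm I}$ for $\rho^*$ when $Q$ ranges over all non-interactive,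 respectively all interactive, $\varepsilon$-LDP mechanisms. **Theorem.** There is an absolute constant $C>0$ such that for all $d\ge1$, $s,r>0$ there are constants $c,C_1,c',C_1'>0$ depending only on $r,s,d$ such that the following holds for all $p\in[1,2]$, all $1\le n_1\le n_2$, $\varepsilon\in(0,1]$ and $\alpha,\beta>0$ with $\alpha+\beta\le1/2$ and $n_1\varepsilon^2\ge C\log\{1/(\alpha\beta)\}$. (i) $$c\,\{\log(n_1\varepsilon^2)\}^{-1}\Big(\frac1{n_1\varepsilon^2}\Big)^{\frac{2s}{4s+3d}}\le\rho^*_{\mathrm{NI}}\le C_1\Big(\frac{[\log\{1/(\alpha\beta)\}]^2}{n_1\varepsilon^2}\Big)^{\frac{2s}{4s+3d}}.$$ (ii) $$c'\,\{\log(n_1\varepsilon^2)\}^{-1}\Big(\frac1{n_1\varepsilon^2}\Big)^{\frac{2s}{4s+2d}}\le\rho^*_{\mathrm I}\le C_1'\Big(\frac{[\log(n_2/\beta)\log\{1/(\alpha\beta)\}]^2}{n_1\varepsilon^2}\Big)^{\frac{2s}{4s+2d}}.$$ -/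

import Mathlib

open MeasureTheory ProbabilityTheory

noncomputable section

namespace LDPTwoSample

/-! ### Local differential privacy with two samples -/

/-- A two-sample sequentially interactive mechanism for samples of sizes `n₁` and `n₁ + m` from
the space `𝒳`, with output spaces `Z` (views of the first sample) and `W` (views of the second).
In round `i < n₁` the new views of `X i` and `Y i` are drawn from `QX i` and `QY i`, which see the
datum and the views of all earlier rounds. Once the first sample is exhausted, the view of
`Y (n₁ + k)` is drawn from `QY' k`, which sees the datum, all the views of the first sample, and
the earlier views of the second. -/
structure Mechanism (𝒳 : Type) [MeasurableSpace 𝒳] (n₁ m : ℕ) : Type 1 where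
  Z : Type
  W : Type
  [measurableSpaceZ : MeasurableSpace Z]
  [measurableSpaceW : MeasurableSpace W]
  QX : (i : Fin n₁) → Kernel (𝒳 × ((Fin i → Z) × (Fin i → W))) Z
  QY : (i : Fin n₁) → Kernel (𝒳 × ((Fin i → Z) × (Fin i → W))) W
  QY' : (k : Fin m) → Kernel (𝒳 × ((Fin n₁ → Z) × (Fin (n₁ + k) → W))) W
  markovX : ∀ i, IsMarkovKernel (QX i)
  markovY : ∀ i, IsMarkovKernel (QY i)
  markovY' : ∀ k, IsMarkovKernel (QY' k)

attribute [instance] Mechanism.measurableSpaceZ Mechanism.measurableSpaceW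

/-- The likelihood-ratio bound of `ε`-local differential privacy for one conditional distribution
`κ` of a view given the datum `x` and the history `h`. -/
def IsPrivateKernel {𝒳 H V : Type} [MeasurableSpace 𝒳] [MeasurableSpace H] [MeasurableSpace V]
    (ε : ℝ) (κ : Kernel (𝒳 × H) V) : Prop :=
  ∀ (x x' : 𝒳) (h : H) (S : Set V), MeasurableSet S →
    κ (x, h) S ≤ ENNReal.ofReal (Real.exp ε) * κ (x', h) S

/-- The conditional distribution does not depend on the history. -/
def IgnoresHistory {𝒳 H V : Type} [MeasurableSpace 𝒳] [MeasurableSpace H] [MeasurableSpace V]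
    (κ : Kernel (𝒳 × H) V) : Prop :=
  ∀ (x : 𝒳) (h h' : H), κ (x, h) = κ (x, h')

/-- The conditional distribution of the view given the history `h`, when the datum is drawn from
`P` independently of the history: `S ↦ ∫ κ (x, h) S dP(x)`. -/
def privatized {𝒳 H V : Type} [MeasurableSpace 𝒳] [MeasurableSpace H] [MeasurableSpace V]
    (P : Measure 𝒳) (κ : Kernel (𝒳 × H) V) : Kernel H V :=
  κ ∘ₖ (Kernel.const H P ×ₖ Kernel.id)

namespace Mechanism

variable {𝒳 : Type} [MeasurableSpace 𝒳] {n₁ m : ℕ}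

/-- The mechanism is `ε`-locally differentially private. -/
def IsLDP (M : Mechanism 𝒳 n₁ m) (ε : ℝ) : Prop :=
  (∀ i, IsPrivateKernel ε (M.QX i)) ∧ (∀ i, IsPrivateKernel ε (M.QY i)) ∧
    (∀ k, IsPrivateKernel ε (M.QY' k))

/-- The mechanism is non-interactive: every view depends on its own datum only. -/
def IsNonInteractive (M : Mechanism 𝒳 n₁ m) : Prop :=
  (∀ i, IgnoresHistory (M.QX i)) ∧ (∀ i, IgnoresHistory (M.QY i)) ∧
    (∀ k, IgnoresHistory (M.QY' k))

/-- The space of all private views. -/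
abbrev Views (M : Mechanism 𝒳 n₁ m) : Type := (Fin n₁ → M.Z) × (Fin (n₁ + m) → M.W)

/-- The joint law of the views of the first `t ≤ n₁` rounds, for `X i ∼ PX` and `Y i ∼ PY`, all
independent. Within a round the two new views are conditionally independent given the past. -/
def pairedLaw (M : Mechanism 𝒳 n₁ m) (PX PY : Measure 𝒳) :
    (t : ℕ) → t ≤ n₁ → Measure ((Fin t → M.Z) × (Fin t → M.W))
  | 0, _ => Measure.dirac (Fin.elim0, Fin.elim0)
  | t + 1, ht =>
      ((M.pairedLaw PX PY t (Nat.le_of_succ_le ht)) ⊗ₘ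
        (privatized PX (M.QX ⟨t, ht⟩) ×ₖ privatized PY (M.QY ⟨t, ht⟩))).map
        fun q => (Fin.snoc (α := fun _ => M.Z) q.1.1 q.2.1,
          Fin.snoc (α := fun _ => M.W) q.1.2 q.2.2)

/-- The joint law of all views of the first sample and the first `n₁ + k` of the second. -/
def extendedLaw (M : Mechanism 𝒳 n₁ m) (PX PY : Measure 𝒳) :
    (k : ℕ) → k ≤ m → Measure ((Fin n₁ → M.Z) × (Fin (n₁ + k) → M.W))
  | 0, _ => M.pairedLaw PX PY n₁ le_rfl
  | k + 1, hk =>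
      ((M.extendedLaw PX PY k (Nat.le_of_succ_le hk)) ⊗ₘ privatized PY (M.QY' ⟨k, hk⟩)).map
        fun q => (q.1.1, Fin.snoc (α := fun _ => M.W) q.1.2 q.2)

/-- The joint law of all the private views. -/
def law (M : Mechanism 𝒳 n₁ m) (PX PY : Measure 𝒳) : Measure M.Views :=
  M.extendedLaw PX PY m le_rfl

end Mechanism

/-! ### Sobolev densities on the unit cube -/

/-- The unit cube `[0,1]^d`, with Lebesgue measure as its `volume`. -/
abbrev Cube (d : ℕ) : Type := Fin d → unitInterval

/-- The trigonometric basis: `φ₀ = 1`, `φ_{2j-1}(x) = √2 sin(2πjx)`, `φ_{2j}(x) = √2 cos(2πjx)`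
for `j ≥ 1`. -/
def trig (k : ℕ) (x : ℝ) : ℝ :=
  if k = 0 then 1
  else if Odd k then √2 * Real.sin (2 * Real.pi * ((k + 1) / 2 : ℕ) * x)
  else √2 * Real.cos (2 * Real.pi * (k / 2 : ℕ) * x)

/-- The tensor product basis on the cube. -/
def trigProd {d : ℕ} (l : Fin d → ℕ) (x : Cube d) : ℝ := ∏ j, trig (l j) (x j)

/-- The Euclidean norm of a multi-index. -/
def indexNorm {d : ℕ} (l : Fin d → ℕ) : ℝ := √(∑ j, (l j : ℝ) ^ 2)

/-- The Sobolev ellipsoid: functions `f = 1 + ∑ θ_l φ_l` (convergence in `L²`) such that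
`∑ ‖l‖^{2s} θ_l² ≤ r²`. -/
def sobolevClass (s r : ℝ) (d : ℕ) : Set (Cube d → ℝ) :=
  {f | MemLp f 2 volume ∧ ∃ θ : (Fin d → ℕ) → ℝ,
    Filter.Tendsto
      (fun F : Finset (Fin d → ℕ) =>
        eLpNorm (fun x => f x - (1 + ∑ l ∈ F, θ l * trigProd l x)) 2 volume)
      Filter.atTop (nhds 0) ∧
    ∑' l, ENNReal.ofReal (indexNorm l ^ (2 * s) * θ l ^ 2) ≤ ENNReal.ofReal (r ^ 2)}

/-- The probability densities in the Sobolev ellipsoid. -/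
def sobolevDensities (s r : ℝ) (d : ℕ) : Set (Cube d → ℝ) :=
  {f | f ∈ sobolevClass s r d ∧ (∀ᵐ x, 0 ≤ f x) ∧ ∫ x, f x = 1}

/-- The distribution with density `f`. -/
def densityMeasure {d : ℕ} (f : Cube d → ℝ) : Measure (Cube d) :=
  volume.withDensity fun x => ENNReal.ofReal (f x)

/-! ### Minimax testing -/

/-- The pairs of densities satisfying the null hypothesis. -/
def nullPairs (s r : ℝ) (d : ℕ) : Set ((Cube d → ℝ) × (Cube d → ℝ)) :=
  {f | f.1 ∈ sobolevDensities s r d ∧ f.2 ∈ sobolevDensities s r d ∧ f.1 =ᵐ[volume] f.2}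

/-- The pairs of densities at `L_p` distance at least `ρ`. -/
def altPairs (s r : ℝ) (d : ℕ) (p ρ : ℝ) : Set ((Cube d → ℝ) × (Cube d → ℝ)) :=
  {f | f.1 ∈ sobolevDensities s r d ∧ f.2 ∈ sobolevDensities s r d ∧
    ENNReal.ofReal ρ ≤ eLpNorm (f.1 - f.2) (ENNReal.ofReal p) volume}

/-- The tests based on the private views whose type-I error is at most `α`; the value `true` means
that the null hypothesis is rejected. -/
def levelTests (s r : ℝ) {d n₁ m : ℕ} (M : Mechanism (Cube d) n₁ m) (α : ℝ) :
    Set (M.Views → Bool) :=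
  {φ | Measurable φ ∧
    (⨆ f ∈ nullPairs s r d,
      M.law (densityMeasure f.1) (densityMeasure f.2) {v | φ v = true}) ≤ ENNReal.ofReal α}

/-- The class of `ε`-LDP mechanisms for samples of sizes `n₁ ≤ n₂`: all (sequentially interactive)
ones if `interactive` is `true`, the non-interactive ones if it is `false`. -/
def mechanisms (interactive : Bool) (d n₁ n₂ : ℕ) (ε : ℝ) :
    Set (Mechanism (Cube d) n₁ (n₂ - n₁)) :=
  {M | M.IsLDP ε ∧ (interactive = false → M.IsNonInteractive)}

/-- The private minimax testing risk at separation `ρ`, for sample sizes `n₁ ≤ n₂`. -/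
def minimaxRisk (interactive : Bool) (s r : ℝ) (d n₁ n₂ : ℕ) (ε α p ρ : ℝ) : ENNReal :=
  ENNReal.ofReal α +
    ⨅ M ∈ mechanisms interactive d n₁ n₂ ε, ⨅ φ ∈ levelTests s r M α,
      ⨆ f ∈ altPairs s r d p ρ,
        M.law (densityMeasure f.1) (densityMeasure f.2) {v | φ v = false}

/-- The private minimax separation radius in the `L_p` norm, for sample sizes `n₁ ≤ n₂`. -/
def separationRadius (interactive : Bool) (s r : ℝ) (d n₁ n₂ : ℕ) (ε α β p : ℝ) : ℝ :=
  sInf {ρ : ℝ | 0 < ρ ∧ minimaxRisk interactive s r d n₁ n₂ ε α p ρ ≤ ENNReal.ofReal (α + β)}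

/-- The non-interactive separation radius. -/
def radiusNI (s r : ℝ) (d n₁ n₂ : ℕ) (ε α β p : ℝ) : ℝ :=
  separationRadius false s r d n₁ n₂ ε α β p

/-- The interactive separation radius. -/
def radiusI (s r : ℝ) (d n₁ n₂ : ℕ) (ε α β p : ℝ) : ℝ :=
  separationRadius true s r d n₁ n₂ ε α β p

end LDPTwoSample

end

noncomputable section

namespace LDPTwoSample

/-! ### The trigonometric basis -/

/-! Upper bounds. In each of the first n₁ rounds both data are turned into one randomized bit whose
sign has mean (ε/4)·u(x), with |u| ≤ 1; the surplus data of the second sample are ignored. The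
difference U_i of the two signs has conditional mean (ε/4)(∫u f_X − ∫u f_Y), which vanishes under
the null hypothesis. If the weights a_i are fixed by a first stage, then ∑ a_i U_i divided by (∑
a_i²)^{1/2} is sub-Gaussian around its drift, by the exponential supermartingale of
`Policy.lintegral_exp_exponent_le`. The level therefore holds whatever the first stage produced, and
only the power has to be analysed (`exists_test`).

The first stage estimates the N = L^d lowest coefficients of f_X − f_Y, with q ≈ n₁/(2N) rounds for
each. Let Δ be the sum of the squares of these coefficients. A non-interactive second stage can only
repeat the same measurements; correlating the two stages detects qε²Δ ≳ √N, up to logarithms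
(`exists_noninteractive_test`). An interactive second stage releases the estimated difference of the
densities at the datum, normalized by its sup norm; the noise part of that sup norm is of order
√(qN) up to logarithms, and qε²Δ ≳ logarithms suffices (`exists_interactive_test`). The neglected
frequencies contribute L^{-2s} (`eLpNorm_sub_le_of_coeff`), so the balance is at L^{2s+3d/2} ≍ n₁ε²
and at L^{2s+d} ≍ n₁ε² respectively (`exists_resolution`).

Lower bounds. Take f_Y = 1 and f_X = 1 + γ ∑ ±ψ_k with random signs and ψ_k orthonormal combinations
of N trigonometric functions, γ√N ≍ L^{-s}. The likelihood ratio of the views is a product over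
rounds of posterior means of f_X(X) given the view and its past (`pairedLaw_eq_withDensity`).
Privacy bounds the information of one view on the whole orthonormal system: ∑_k E[E(ψ_k(X) | view)²]
≤ sinh²ε ≍ ε² (`IsPosterior.sum_integral_sq_le`).

For interactive mechanisms, averaging over the signs shows that some sign vector has
Kullback–Leibler information of order n₁γ²ε² (`exists_law_ge_of_information`), which is small when
L^{2s+d} ≍ n₁ε². For non-interactive mechanisms the rounds are independent, so the χ² divergence of
the mixture over the signs can be computed. With ψ_k the eigenvectors of the total information
matrix, its logarithm is of order γ⁴ ∑ λ_k². Since ∑ λ_k ≲ n₁ε², at least half of the directions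
have λ_k ≲ n₁ε²/N, and keeping only those gives γ⁴(n₁ε²)²/N, which is small when L^{2s+3d/2} ≍ n₁ε²
(`exists_law_ge_of_correlation`).

Most sign vectors give a perturbation with sup norm at most a constant times γ√N(1 + log L)
(`exists_signs`). This makes 1 + perturbation a density, and through ‖h‖₁ ≥ ‖h‖₂²/‖h‖_∞ it separates
the alternatives in L₁, hence in every L_p with p ≥ 1; the logarithm in the lower bounds is lost
here. -/

lemma integral_unitInterval_eq (g : ℝ → ℝ) :
    ∫ x : unitInterval, g x = ∫ x in (0 : ℝ)..1, g x := by
  have := integral_subtype_comap (μ := (volume : Measure ℝ)) (s := Set.Icc (0 : ℝ) 1)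
    measurableSet_Icc g
  rw [intervalIntegral.integral_of_le zero_le_one, ← integral_Icc_eq_integral_Ioc, ← this]
  rfl

lemma integral_cos_two_pi (a : ℤ) :
    ∫ x : unitInterval, Real.cos (2 * Real.pi * a * x) = if a = 0 then 1 else 0 := by
  rw [integral_unitInterval_eq (fun x => Real.cos (2 * Real.pi * a * x))]
  split_ifs with h
  · simp [h]
  · have h' : (2 * Real.pi * a : ℝ) ≠ 0 := by
      have : (a : ℝ) ≠ 0 := by exact_mod_cast h
      positivity
    rw [intervalIntegral.integral_comp_mul_left (fun x => Real.cos x) h', integral_cos]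
    have : Real.sin (2 * Real.pi * a) = 0 := by
      have := Real.sin_int_mul_pi (2 * a)
      push_cast at this
      rw [← this]; ring_nf
    simp [this]

lemma integral_sin_two_pi (a : ℤ) :
    ∫ x : unitInterval, Real.sin (2 * Real.pi * a * x) = 0 := by
  rw [integral_unitInterval_eq (fun x => Real.sin (2 * Real.pi * a * x))]
  by_cases h : a = 0
  · simp [h]
  · have h' : (2 * Real.pi * a : ℝ) ≠ 0 := by
      have : (a : ℝ) ≠ 0 := by exact_mod_cast h
      positivity
    rw [intervalIntegral.integral_comp_mul_left (fun x => Real.sin x) h', integral_sin]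
    have : Real.cos (2 * Real.pi * a) = 1 := by
      rw [mul_comm]; exact Real.cos_int_mul_two_pi a
    simp [this]

lemma integrable_unitInterval {g : ℝ → ℝ} (hg : Continuous g) :
    Integrable (fun x : unitInterval => g x) :=
  (hg.comp continuous_subtype_val).integrable_of_hasCompactSupport
    (HasCompactSupport.of_compactSpace _)

lemma integral_cos_mul_cos (a b : ℕ) :
    ∫ x : unitInterval, Real.cos (2 * Real.pi * a * x) * Real.cos (2 * Real.pi * b * x) =
      ((if a = b then 1 else 0) + (if a + b = 0 then 1 else 0)) / 2 := by
  have h (x : unitInterval) : Real.cos (2 * Real.pi * a * x) * Real.cos (2 * Real.pi * b * x) =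
      2⁻¹ * Real.cos (2 * Real.pi * ((a - b : ℤ) : ℝ) * x) +
        2⁻¹ * Real.cos (2 * Real.pi * ((a + b : ℤ) : ℝ) * x) := by
    push_cast
    rw [mul_sub, mul_add, sub_mul, add_mul, Real.cos_sub, Real.cos_add]
    ring
  simp_rw [h]
  rw [integral_add, integral_const_mul, integral_const_mul, integral_cos_two_pi,
    integral_cos_two_pi]
  · have e1 : ((a : ℤ) - b = 0) ↔ a = b := by omega
    have e2 : ((a : ℤ) + b = 0) ↔ a + b = 0 := by omega
    simp only [e1, e2]; ring
  · exact integrable_unitInterval (g := fun x => 2⁻¹ * Real.cos (2 * Real.pi * ((a - b : ℤ) : ℝ) * x))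
      (by fun_prop)
  · exact integrable_unitInterval (g := fun x => 2⁻¹ * Real.cos (2 * Real.pi * ((a + b : ℤ) : ℝ) * x))
      (by fun_prop)

lemma integral_sin_mul_sin (a b : ℕ) :
    ∫ x : unitInterval, Real.sin (2 * Real.pi * a * x) * Real.sin (2 * Real.pi * b * x) =
      ((if a = b then 1 else 0) - (if a + b = 0 then 1 else 0)) / 2 := by
  have h (x : unitInterval) : Real.sin (2 * Real.pi * a * x) * Real.sin (2 * Real.pi * b * x) =
      2⁻¹ * Real.cos (2 * Real.pi * ((a - b : ℤ) : ℝ) * x) -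
        2⁻¹ * Real.cos (2 * Real.pi * ((a + b : ℤ) : ℝ) * x) := by
    push_cast
    rw [mul_sub, mul_add, sub_mul, add_mul, Real.cos_sub, Real.cos_add]
    ring
  simp_rw [h]
  rw [integral_sub, integral_const_mul, integral_const_mul, integral_cos_two_pi,
    integral_cos_two_pi]
  · have e1 : ((a : ℤ) - b = 0) ↔ a = b := by omega
    have e2 : ((a : ℤ) + b = 0) ↔ a + b = 0 := by omega
    simp only [e1, e2]; ring
  · exact integrable_unitInterval (g := fun x => 2⁻¹ * Real.cos (2 * Real.pi * ((a - b : ℤ) : ℝ) * x))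
      (by fun_prop)
  · exact integrable_unitInterval (g := fun x => 2⁻¹ * Real.cos (2 * Real.pi * ((a + b : ℤ) : ℝ) * x))
      (by fun_prop)

lemma integral_sin_mul_cos (a b : ℕ) :
    ∫ x : unitInterval, Real.sin (2 * Real.pi * a * x) * Real.cos (2 * Real.pi * b * x) = 0 := by
  have h (x : unitInterval) : Real.sin (2 * Real.pi * a * x) * Real.cos (2 * Real.pi * b * x) =
      2⁻¹ * Real.sin (2 * Real.pi * ((a - b : ℤ) : ℝ) * x) +
        2⁻¹ * Real.sin (2 * Real.pi * ((a + b : ℤ) : ℝ) * x) := by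
    push_cast
    rw [mul_sub, mul_add, sub_mul, add_mul, Real.sin_sub, Real.sin_add]
    ring
  simp_rw [h]
  rw [integral_add, integral_const_mul, integral_const_mul, integral_sin_two_pi,
    integral_sin_two_pi]
  · simp
  · exact integrable_unitInterval (g := fun x => 2⁻¹ * Real.sin (2 * Real.pi * ((a - b : ℤ) : ℝ) * x))
      (by fun_prop)
  · exact integrable_unitInterval (g := fun x => 2⁻¹ * Real.sin (2 * Real.pi * ((a + b : ℤ) : ℝ) * x))
      (by fun_prop)

lemma trig_zero (x : ℝ) : trig 0 x = 1 := by simp [trig]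

lemma trig_sin (j : ℕ) (x : ℝ) :
    trig (2 * j + 1) x = √2 * Real.sin (2 * Real.pi * (j + 1 : ℕ) * x) := by
  have : (2 * j + 1 + 1) / 2 = j + 1 := by omega
  simp [trig, this]

lemma trig_cos (j : ℕ) (x : ℝ) :
    trig (2 * j + 2) x = √2 * Real.cos (2 * Real.pi * (j + 1 : ℕ) * x) := by
  have h1 : (2 * j + 2) / 2 = j + 1 := by omega
  have h2 : ¬ Odd (2 * j + 2) := by simp [parity_simps]
  simp [trig, h1, h2]

lemma trig_cases (k : ℕ) : k = 0 ∨ (∃ j, k = 2 * j + 1) ∨ ∃ j, k = 2 * j + 2 := by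
  rcases Nat.eq_zero_or_pos k with h | h
  · exact Or.inl h
  · rcases Nat.even_or_odd k with ⟨j, hj⟩ | ⟨j, hj⟩
    · exact Or.inr (Or.inr ⟨j - 1, by omega⟩)
    · exact Or.inr (Or.inl ⟨j, hj⟩)

lemma continuous_trig (k : ℕ) : Continuous (trig k) := by
  rcases trig_cases k with rfl | ⟨j, rfl⟩ | ⟨j, rfl⟩
  · simp_rw [funext trig_zero]; fun_prop
  · simp_rw [funext (trig_sin j)]; fun_prop
  · simp_rw [funext (trig_cos j)]; fun_prop

lemma abs_trig_le (k : ℕ) (x : ℝ) : |trig k x| ≤ √2 := by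
  rcases trig_cases k with rfl | ⟨j, rfl⟩ | ⟨j, rfl⟩
  · rw [trig_zero, abs_one]; exact Real.one_le_sqrt.2 (by norm_num)
  · rw [trig_sin, abs_mul, abs_of_nonneg (Real.sqrt_nonneg _)]
    exact mul_le_of_le_one_right (Real.sqrt_nonneg _) (Real.abs_sin_le_one _)
  · rw [trig_cos, abs_mul, abs_of_nonneg (Real.sqrt_nonneg _)]
    exact mul_le_of_le_one_right (Real.sqrt_nonneg _) (Real.abs_cos_le_one _)

/-- The frequency of the `k`-th function is at most `k` and 2π ≤ 7. These crude Lipschitz constants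
serve only to pass from a fine grid to the whole cube. -/
lemma abs_trig_sub_le (k : ℕ) (x y : ℝ) :
    |trig k x - trig k y| ≤ √2 * (7 * k) * |x - y| := by
  have hpi : 2 * Real.pi ≤ 7 := by linarith [Real.pi_lt_d2]
  have key (j : ℕ) : |2 * Real.pi * (j + 1 : ℕ) * x - 2 * Real.pi * (j + 1 : ℕ) * y| ≤
      7 * (2 * j + 1 : ℕ) * |x - y| := by
    rw [← mul_sub, abs_mul, abs_of_nonneg (by positivity)]
    gcongr
    have : (0 : ℝ) ≤ j := by positivity
    nlinarith [Real.pi_pos]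
  rcases trig_cases k with rfl | ⟨j, rfl⟩ | ⟨j, rfl⟩
  · simp [trig_zero]
  · rw [trig_sin, trig_sin, ← mul_sub, abs_mul, abs_of_nonneg (Real.sqrt_nonneg _), mul_assoc √2]
    refine mul_le_mul_of_nonneg_left ?_ (Real.sqrt_nonneg _)
    refine le_trans ?_ (key j)
    have := Real.lipschitzWith_sin.dist_le_mul (2 * Real.pi * (j + 1 : ℕ) * x)
      (2 * Real.pi * (j + 1 : ℕ) * y)
    simpa [Real.dist_eq] using this
  · rw [trig_cos, trig_cos, ← mul_sub, abs_mul, abs_of_nonneg (Real.sqrt_nonneg _), mul_assoc √2]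
    refine mul_le_mul_of_nonneg_left ?_ (Real.sqrt_nonneg _)
    refine le_trans ?_ ((key j).trans ?_)
    · have := Real.lipschitzWith_cos.dist_le_mul (2 * Real.pi * (j + 1 : ℕ) * x)
        (2 * Real.pi * (j + 1 : ℕ) * y)
      simpa [Real.dist_eq] using this
    · gcongr; omega

lemma integral_trig_mul_trig (k l : ℕ) :
    ∫ x : unitInterval, trig k x * trig l x = if k = l then 1 else 0 := by
  have s2 : √2 * √2 = 2 := Real.mul_self_sqrt (by norm_num)
  have hmul (a b : ℝ) : √2 * a * (√2 * b) = 2 * (a * b) := by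
    linear_combination (a * b) * s2
  rcases trig_cases k with rfl | ⟨j, rfl⟩ | ⟨j, rfl⟩ <;>
    rcases trig_cases l with rfl | ⟨i, rfl⟩ | ⟨i, rfl⟩
  · simp [trig_zero]
  · have := integral_sin_two_pi (i + 1 : ℕ)
    push_cast at this
    simp [trig_zero, trig_sin, integral_const_mul, this]
  · have := integral_cos_two_pi (i + 1 : ℕ)
    push_cast at this
    have h : (i : ℤ) + 1 ≠ 0 := by omega
    simp [trig_zero, trig_cos, integral_const_mul, this, h]
  · have := integral_sin_two_pi (j + 1 : ℕ)
    push_cast at this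
    simp [trig_zero, trig_sin, integral_const_mul, this]
  · simp_rw [trig_sin, hmul, integral_const_mul, integral_sin_mul_sin]
    by_cases h : j = i <;> simp [h]
  · simp_rw [trig_sin, trig_cos, hmul, integral_const_mul, integral_sin_mul_cos]
    have : ¬ (2 * j + 1 = 2 * i + 2) := by omega
    rw [if_neg this, mul_zero]
  · have := integral_cos_two_pi (j + 1 : ℕ)
    push_cast at this
    have h : (j : ℤ) + 1 ≠ 0 := by omega
    simp [trig_zero, trig_cos, integral_const_mul, this, h]
  · simp_rw [trig_sin, trig_cos, hmul, integral_const_mul]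
    have := integral_sin_mul_cos (i + 1) (j + 1)
    simp_rw [mul_comm (Real.cos _), this]
    have : ¬ (2 * j + 2 = 2 * i + 1) := by omega
    simp [this]
  · simp_rw [trig_cos, hmul, integral_const_mul, integral_cos_mul_cos]
    by_cases h : j = i <;> simp [h]

variable {d : ℕ}

lemma continuous_trigProd (l : Fin d → ℕ) : Continuous (trigProd l) := by
  unfold trigProd
  refine continuous_finsetProd _ fun j _ => ?_
  exact (continuous_trig _).comp (continuous_subtype_val.comp (continuous_apply j))

lemma measurable_trigProd (l : Fin d → ℕ) : Measurable (trigProd l) :=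
  (continuous_trigProd l).measurable

lemma abs_trigProd_le (l : Fin d → ℕ) (x : Cube d) : |trigProd l x| ≤ √2 ^ d := by
  unfold trigProd
  rw [Finset.abs_prod]
  calc ∏ j, |trig (l j) (x j)| ≤ ∏ _j : Fin d, √2 :=
        Finset.prod_le_prod (fun _ _ => abs_nonneg _) fun _ _ => abs_trig_le _ _
    _ = √2 ^ d := by simp

lemma trigProd_sq_le (l : Fin d → ℕ) (x : Cube d) : trigProd l x ^ 2 ≤ 2 ^ d := by
  have h := abs_trigProd_le l x
  calc trigProd l x ^ 2 = |trigProd l x| ^ 2 := (sq_abs _).symm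
    _ ≤ (√2 ^ d) ^ 2 := by gcongr
    _ = 2 ^ d := by rw [← pow_mul, mul_comm, pow_mul, Real.sq_sqrt (by norm_num)]

lemma trigProd_zero (x : Cube d) : trigProd 0 x = 1 := by simp [trigProd, trig_zero]

lemma integrable_of_continuous {g : Cube d → ℝ} (hg : Continuous g) : Integrable g :=
  hg.integrable_of_hasCompactSupport (HasCompactSupport.of_compactSpace _)

lemma integral_trigProd_mul (k l : Fin d → ℕ) :
    ∫ x : Cube d, trigProd k x * trigProd l x = if k = l then 1 else 0 := by
  unfold trigProd
  simp_rw [← Finset.prod_mul_distrib]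
  rw [integral_fintype_prod_volume_eq_prod
    (f := fun j (x : unitInterval) => trig (k j) x * trig (l j) x)]
  simp_rw [integral_trig_mul_trig]
  rw [Finset.prod_ite_zero]
  simp [funext_iff]

lemma integral_trigProd (l : Fin d → ℕ) (hl : l ≠ 0) : ∫ x : Cube d, trigProd l x = 0 := by
  have := integral_trigProd_mul l 0
  simpa [trigProd_zero, hl] using this

/-- Telescoping, one factor exchanged at a time. The factor `B` in the hypothesis on `a i - b i`
makes every term cost the same power of `B`. -/
lemma abs_prod_sub_prod_le {ι : Type*} (s : Finset ι) (a b : ι → ℝ) (B : ℝ) (e : ι → ℝ)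
    (hB : 1 ≤ B) (ha : ∀ i, |a i| ≤ B) (hb : ∀ i, |b i| ≤ B) (he : ∀ i, |a i - b i| ≤ B * e i) :
    |∏ i ∈ s, a i - ∏ i ∈ s, b i| ≤ B ^ s.card * ∑ i ∈ s, e i := by
  classical
  induction s using Finset.induction_on with
  | empty => simp
  | insert i s hi ih =>
    rw [Finset.prod_insert hi, Finset.prod_insert hi, Finset.sum_insert hi,
      Finset.card_insert_of_notMem hi]
    have e1 : a i * ∏ j ∈ s, a j - b i * ∏ j ∈ s, b j =
        (a i - b i) * ∏ j ∈ s, a j + b i * (∏ j ∈ s, a j - ∏ j ∈ s, b j) := by ring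
    have hp : |∏ j ∈ s, a j| ≤ B ^ s.card := by
      rw [Finset.abs_prod]
      calc ∏ j ∈ s, |a j| ≤ ∏ _j ∈ s, B :=
            Finset.prod_le_prod (fun _ _ => abs_nonneg _) fun j _ => ha j
        _ = B ^ s.card := by simp
    have hei : 0 ≤ B * e i := (abs_nonneg _).trans (he i)
    calc _ ≤ |a i - b i| * |∏ j ∈ s, a j| + |b i| * |∏ j ∈ s, a j - ∏ j ∈ s, b j| := by
          rw [e1, ← abs_mul, ← abs_mul]; exact abs_add_le _ _
      _ ≤ (B * e i) * B ^ s.card + B * (B ^ s.card * ∑ i ∈ s, e i) := by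
          gcongr
          · exact he i
          · exact hb i
      _ = _ := by ring

lemma abs_trigProd_sub_le (l : Fin d → ℕ) (L : ℕ) (hl : ∀ j, l j ≤ L) (x y : Cube d) :
    |trigProd l x - trigProd l y| ≤ √2 ^ d * (7 * L * ∑ j, |(x j : ℝ) - y j|) := by
  have := abs_prod_sub_prod_le Finset.univ (fun j => trig (l j) (x j)) (fun j => trig (l j) (y j))
    √2 (fun j => 7 * L * |(x j : ℝ) - y j|) (Real.one_le_sqrt.2 (by norm_num))
    (fun j => abs_trig_le _ _) (fun j => abs_trig_le _ _) (fun j => by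
      refine (abs_trig_sub_le _ _ _).trans ?_
      have : (l j : ℝ) ≤ L := by exact_mod_cast hl j
      rw [mul_assoc]
      gcongr)
  rw [Finset.card_univ, Fintype.card_fin, ← Finset.mul_sum] at this
  exact this

/-! ### A grid on the cube -/

/-- The point `k / m` of the unit interval. -/
def gridPoint (m : ℕ) (k : Fin (m + 1)) : unitInterval :=
  ⟨(k : ℝ) / m, by positivity, by
    rcases Nat.eq_zero_or_pos m with rfl | hm
    · simp
    · rw [div_le_one (by positivity)]; exact_mod_cast Nat.lt_succ_iff.1 k.2⟩

/-- The grid with `m + 1` points on every axis. -/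
def gridCube (d m : ℕ) (k : Fin d → Fin (m + 1)) : Cube d := fun j => gridPoint m (k j)

lemma exists_gridPoint_near (m : ℕ) (hm : 0 < m) (x : unitInterval) :
    ∃ k, |(x : ℝ) - gridPoint m k| ≤ 1 / m := by
  have hm' : (0 : ℝ) < m := by exact_mod_cast hm
  have h0 : (0 : ℝ) ≤ x * m := mul_nonneg x.2.1 hm'.le
  have h1 := Nat.floor_le h0
  have h2 := Nat.lt_floor_add_one ((x : ℝ) * m)
  refine ⟨⟨⌊(x : ℝ) * m⌋₊, ?_⟩, ?_⟩
  · rw [Nat.lt_succ_iff]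
    refine Nat.floor_le_of_le ?_
    exact mul_le_of_le_one_left hm'.le x.2.2
  · simp only [gridPoint]
    rw [abs_le]
    have : (x : ℝ) - ⌊(x : ℝ) * m⌋₊ / m = (x * m - ⌊(x : ℝ) * m⌋₊) / m := by
      field_simp
    rw [this]
    constructor
    · have : 0 ≤ ((x : ℝ) * m - ⌊(x : ℝ) * m⌋₊) / m := div_nonneg (by linarith) hm'.le
      have : 0 ≤ 1 / (m : ℝ) := by positivity
      linarith
    · gcongr; linarith

/-- A trigonometric polynomial is controlled by its values on a grid. -/
lemma abs_sum_trigProd_le_of_grid {ι : Type*} [Fintype ι] (l : ι → Fin d → ℕ) (L m : ℕ)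
    (hm : 0 < m) (hl : ∀ i j, l i j ≤ L) (a : ι → ℝ) (v : ℝ)
    (hv : ∀ k, |∑ i, a i * trigProd (l i) (gridCube d m k)| ≤ v) (x : Cube d) :
    |∑ i, a i * trigProd (l i) x| ≤ v + √2 ^ d * (7 * L * d / m) * ∑ i, |a i| := by
  choose k hk using fun j => exists_gridPoint_near m hm (x j)
  have e : ∑ i, a i * trigProd (l i) x = ∑ i, a i * trigProd (l i) (gridCube d m k) +
      ∑ i, a i * (trigProd (l i) x - trigProd (l i) (gridCube d m k)) := by
    rw [← Finset.sum_add_distrib]; exact Finset.sum_congr rfl fun i _ => by ring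
  rw [e]
  refine (abs_add_le _ _).trans (add_le_add (hv k) ?_)
  refine (Finset.abs_sum_le_sum_abs _ _).trans ?_
  rw [Finset.mul_sum]
  refine Finset.sum_le_sum fun i _ => ?_
  rw [abs_mul, mul_comm]
  gcongr
  refine (abs_trigProd_sub_le (l i) L (hl i) _ _).trans ?_
  gcongr
  calc 7 * L * ∑ j, |(x j : ℝ) - gridCube d m k j| ≤ 7 * L * ∑ _j : Fin d, (1 / (m : ℝ)) := by
        gcongr with j; exact hk j
    _ = 7 * L * d / m := by simp; ring

end LDPTwoSample

end

noncomputable section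

namespace LDPTwoSample

/-! ### Coefficients of Sobolev densities -/

variable {d : ℕ}

lemma eLpNorm_two_eq_sqrt {g : Cube d → ℝ} (hg : MemLp g 2 volume) :
    eLpNorm g 2 volume = ENNReal.ofReal (√(∫ x, g x ^ 2)) := by
  rw [hg.eLpNorm_eq_integral_rpow_norm (by norm_num) (by norm_num), Real.sqrt_eq_rpow]
  simp

lemma memLp_of_continuous {g : Cube d → ℝ} (hg : Continuous g) (p : ENNReal) :
    MemLp g p volume := hg.memLp_of_hasCompactSupport (HasCompactSupport.of_compactSpace _)

lemma integral_sum_trigProd_sq {ι : Type*} (F : Finset ι) (l : ι → Fin d → ℕ)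
    (hl : Set.InjOn l F) (a b : ι → ℝ) :
    ∫ x : Cube d, (∑ i ∈ F, a i * trigProd (l i) x) * (∑ i ∈ F, b i * trigProd (l i) x) =
      ∑ i ∈ F, a i * b i := by
  classical
  simp_rw [Finset.sum_mul_sum]
  have hc (i j : ι) : Continuous fun x : Cube d => a i * trigProd (l i) x * (b j * trigProd (l j) x) :=
    ((continuous_const.mul (continuous_trigProd _)).mul
      (continuous_const.mul (continuous_trigProd _)))
  rw [integral_finsetSum _ fun i _ => integrable_of_continuous
    (continuous_finsetSum _ fun j _ => hc i j)]
  refine Finset.sum_congr rfl fun i hi => ?_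
  rw [integral_finsetSum _ fun j _ => integrable_of_continuous (hc i j)]
  have (j : ι) : ∫ x : Cube d, a i * trigProd (l i) x * (b j * trigProd (l j) x) =
      a i * b j * if l i = l j then 1 else 0 := by
    rw [← integral_trigProd_mul, ← integral_const_mul]
    congr 1; ext x; ring
  simp_rw [this]
  rw [Finset.sum_eq_single i]
  · simp
  · intro j hj hji
    rw [if_neg fun h => hji (hl hj hi h.symm), mul_zero]
  · exact fun h => absurd hi h

/-- The integral of a density against a basis function. -/
def coeff (f : Cube d → ℝ) (l : Fin d → ℕ) : ℝ := ∫ x, f x * trigProd l x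

lemma integrable_mul_trigProd {f : Cube d → ℝ} (hf : Integrable f) (l : Fin d → ℕ) :
    Integrable fun x => f x * trigProd l x :=
  hf.mul_bdd (c := √2 ^ d) (measurable_trigProd l).aestronglyMeasurable
    (Filter.Eventually.of_forall fun x => abs_trigProd_le l x)

lemma integrable_of_mem_sobolevClass {s r : ℝ} {f : Cube d → ℝ} (hf : f ∈ sobolevClass s r d) :
    Integrable f :=
  hf.1.integrable (by norm_num)

lemma indexNorm_nonneg (l : Fin d → ℕ) : 0 ≤ indexNorm l := Real.sqrt_nonneg _

/-- Pairing the L² expansion with a basis function identifies the coefficients. The index 0 is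
special: for s > 0 the Sobolev weight vanishes there, and the coefficient is 0 because a density has
mass 1. -/
lemma exists_expansion {s r : ℝ} {f : Cube d → ℝ} (hf : f ∈ sobolevDensities s r d) :
    ∃ θ : (Fin d → ℕ) → ℝ,
      Filter.Tendsto
        (fun F : Finset (Fin d → ℕ) =>
          eLpNorm (fun x => f x - (1 + ∑ l ∈ F, θ l * trigProd l x)) 2 volume)
        Filter.atTop (nhds 0) ∧
      (∀ l, l ≠ 0 → θ l = coeff f l) ∧ θ 0 = 0 ∧
      ∀ F : Finset (Fin d → ℕ), ∑ l ∈ F, indexNorm l ^ (2 * s) * θ l ^ 2 ≤ r ^ 2 := by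
  classical
  obtain ⟨⟨hfL, θ, hθ, hsum⟩, -, hone⟩ := hf
  have hfi : Integrable f := hfL.integrable (by norm_num)
  -- The left-hand side is the pairing of the residual f − (1 + ∑_F θφ) with φ_l as soon as `F`
  -- contains `l`. It does not depend on `F`, while the residual tends to 0 in L², so it is 0.
  have key (l : Fin d → ℕ) : coeff f l - (∫ x : Cube d, trigProd l x) - θ l = 0 := by
    have hb (F : Finset (Fin d → ℕ)) (hF : l ∈ F) :
        ENNReal.ofReal |coeff f l - (∫ x : Cube d, trigProd l x) - θ l| ≤
        ENNReal.ofReal (√2 ^ d) *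
          eLpNorm (fun x => f x - (1 + ∑ l ∈ F, θ l * trigProd l x)) 2 volume := by
      have hSc : Continuous fun x : Cube d => 1 + ∑ l ∈ F, θ l * trigProd l x :=
        continuous_const.add (continuous_finsetSum _ fun j _ =>
          continuous_const.mul (continuous_trigProd _))
      have e : coeff f l - (∫ x : Cube d, trigProd l x) - θ l =
          ∫ x, (f x - (1 + ∑ l ∈ F, θ l * trigProd l x)) * trigProd l x := by
        have h1 : ∫ x : Cube d, (∑ l ∈ F, θ l * trigProd l x) * trigProd l x = θ l := by
          have := integral_sum_trigProd_sq F id Function.injective_id.injOn θ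
            (fun j => if j = l then 1 else 0)
          simpa [hF] using this
        have h2 : ∀ x, (f x - (1 + ∑ l ∈ F, θ l * trigProd l x)) * trigProd l x =
          f x * trigProd l x - trigProd l x - (∑ l ∈ F, θ l * trigProd l x) * trigProd l x :=
          fun x => by ring
        have hT := integrable_of_continuous (continuous_trigProd l)
        simp_rw [h2]
        rw [integral_sub, integral_sub (integrable_mul_trigProd hfi l) hT, h1]
        · rfl
        · exact (integrable_mul_trigProd hfi l).sub hT
        · exact integrable_of_continuous ((continuous_finsetSum _ fun j _ =>
            continuous_const.mul (continuous_trigProd _)).mul (continuous_trigProd l))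
      have hm : AEStronglyMeasurable (fun x => f x - (1 + ∑ l ∈ F, θ l * trigProd l x)) volume :=
        hfL.1.sub hSc.aestronglyMeasurable
      rw [e]
      calc ENNReal.ofReal |∫ x, (f x - (1 + ∑ l ∈ F, θ l * trigProd l x)) * trigProd l x|
          = ‖∫ x, (f x - (1 + ∑ l ∈ F, θ l * trigProd l x)) * trigProd l x‖ₑ := by
            rw [← Real.norm_eq_abs, ofReal_norm]
        _ ≤ ∫⁻ x, ‖(f x - (1 + ∑ l ∈ F, θ l * trigProd l x)) * trigProd l x‖ₑ :=
            enorm_integral_le_lintegral_enorm _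
        _ ≤ ∫⁻ x, ENNReal.ofReal (√2 ^ d) * ‖f x - (1 + ∑ l ∈ F, θ l * trigProd l x)‖ₑ := by
            refine lintegral_mono fun x => ?_
            rw [enorm_mul, mul_comm]
            gcongr
            rw [← ofReal_norm]
            exact ENNReal.ofReal_le_ofReal (abs_trigProd_le l x)
        _ = ENNReal.ofReal (√2 ^ d) *
              eLpNorm (fun x => f x - (1 + ∑ l ∈ F, θ l * trigProd l x)) 1 volume := by
            rw [lintegral_const_mul' _ _ ENNReal.ofReal_ne_top, eLpNorm_one_eq_lintegral_enorm]
        _ ≤ _ := by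
            gcongr
            exact eLpNorm_le_eLpNorm_of_exponent_le (by norm_num) hm
    have hlim : Filter.Tendsto (fun F : Finset (Fin d → ℕ) => ENNReal.ofReal (√2 ^ d) *
          eLpNorm (fun x => f x - (1 + ∑ l ∈ F, θ l * trigProd l x)) 2 volume)
        Filter.atTop (nhds 0) := by
      have := ENNReal.Tendsto.const_mul hθ (a := ENNReal.ofReal (√2 ^ d))
        (Or.inr ENNReal.ofReal_ne_top)
      simpa using this
    have h0 : ENNReal.ofReal |coeff f l - (∫ x : Cube d, trigProd l x) - θ l| ≤ 0 := by
      refine ge_of_tendsto hlim ?_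
      filter_upwards [Filter.eventually_ge_atTop {l}] with F hF
      exact hb F (by simpa using hF)
    have := ENNReal.ofReal_eq_zero.1 (le_antisymm h0 bot_le)
    exact abs_eq_zero.1 (le_antisymm this (abs_nonneg _))
  refine ⟨θ, hθ, fun l hl => ?_, ?_, fun F => ?_⟩
  · have := key l
    rw [integral_trigProd l hl] at this
    linarith
  · have h := key 0
    simp only [coeff, trigProd_zero, mul_one, hone, integral_const, probReal_univ, smul_eq_mul] at h
    linarith
  · have h : ∑ l ∈ F, ENNReal.ofReal (indexNorm l ^ (2 * s) * θ l ^ 2) ≤ ENNReal.ofReal (r ^ 2) :=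
      (ENNReal.sum_le_tsum F).trans hsum
    rw [← ENNReal.ofReal_sum_of_nonneg (fun l _ =>
      mul_nonneg (Real.rpow_nonneg (indexNorm_nonneg _) _) (sq_nonneg _))] at h
    exact (ENNReal.ofReal_le_ofReal_iff (sq_nonneg _)).1 h

lemma le_indexNorm (l : Fin d → ℕ) (j : Fin d) : (l j : ℝ) ≤ indexNorm l :=
  Real.le_sqrt_of_sq_le (Finset.single_le_sum (f := fun j => (l j : ℝ) ^ 2)
    (fun _ _ => sq_nonneg _) (Finset.mem_univ j))

/-- The multi-indices with all entries below `L`. -/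
def box (d L : ℕ) : Finset (Fin d → ℕ) := Fintype.piFinset fun _ => Finset.range L

/-- Parseval for truncated expansions. An index outside the box has an entry at least `L`, hence
norm at least `L`, and the Sobolev weights bound its share by L^{-2s}; the constant 4 comes from (a
− b)² ≤ 2a² + 2b². The residuals of the truncation disappear in the limit. -/
lemma eLpNorm_sub_le_of_coeff {s r : ℝ} (hs : 0 < s) {f g : Cube d → ℝ}
    (hf : f ∈ sobolevDensities s r d) (hg : g ∈ sobolevDensities s r d) (L : ℕ) (hL : 1 ≤ L) :
    eLpNorm (f - g) 2 volume ≤ ENNReal.ofReal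
      (√(∑ l ∈ box d L, (coeff f l - coeff g l) ^ 2 + 4 * r ^ 2 * (L : ℝ) ^ (-(2 * s)))) := by
  classical
  obtain ⟨θ, hθ, hθc, hθ0, hθr⟩ := exists_expansion hf
  obtain ⟨η, hη, hηc, hη0, hηr⟩ := exists_expansion hg
  have hL0 : (0 : ℝ) < L := by exact_mod_cast hL
  set R := ENNReal.ofReal
      (√(∑ l ∈ box d L, (coeff f l - coeff g l) ^ 2 + 4 * r ^ 2 * (L : ℝ) ^ (-(2 * s)))) with hR
  have hδ (l) : (θ l - η l) ^ 2 ≤ (coeff f l - coeff g l) ^ 2 := by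
    by_cases h : l = 0
    · subst h; rw [hθ0, hη0]; simp [sq_nonneg]
    · rw [hθc l h, hηc l h]
  have htail (F : Finset (Fin d → ℕ)) : ∑ l ∈ F \ box d L, (θ l - η l) ^ 2 ≤
      4 * r ^ 2 * (L : ℝ) ^ (-(2 * s)) := by
    have h1 (l) (hl : l ∈ F \ box d L) : (θ l - η l) ^ 2 ≤ (L : ℝ) ^ (-(2 * s)) *
        (2 * (indexNorm l ^ (2 * s) * θ l ^ 2) + 2 * (indexNorm l ^ (2 * s) * η l ^ 2)) := by
      have hl' : l ∉ box d L := (Finset.mem_sdiff.1 hl).2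
      simp only [box, Fintype.mem_piFinset, Finset.mem_range, not_forall, not_lt] at hl'
      obtain ⟨j, hj⟩ := hl'
      have hLn : (L : ℝ) ≤ indexNorm l := le_trans (by exact_mod_cast hj) (le_indexNorm l j)
      have h2 : (L : ℝ) ^ (2 * s) ≤ indexNorm l ^ (2 * s) :=
        Real.rpow_le_rpow hL0.le hLn (by positivity)
      have h3 : 1 ≤ (L : ℝ) ^ (-(2 * s)) * indexNorm l ^ (2 * s) := by
        rw [Real.rpow_neg hL0.le, ← div_eq_inv_mul, le_div_iff₀ (by positivity), one_mul]
        exact h2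
      calc (θ l - η l) ^ 2 ≤ 1 * (2 * θ l ^ 2 + 2 * η l ^ 2) := by
            nlinarith [sq_nonneg (θ l + η l)]
        _ ≤ (L : ℝ) ^ (-(2 * s)) * indexNorm l ^ (2 * s) * (2 * θ l ^ 2 + 2 * η l ^ 2) := by
            gcongr
        _ = _ := by ring
    calc _ ≤ _ := Finset.sum_le_sum h1
      _ = (L : ℝ) ^ (-(2 * s)) * (2 * ∑ l ∈ F \ box d L, indexNorm l ^ (2 * s) * θ l ^ 2 +
            2 * ∑ l ∈ F \ box d L, indexNorm l ^ (2 * s) * η l ^ 2) := by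
          rw [← Finset.mul_sum, Finset.sum_add_distrib, ← Finset.mul_sum, ← Finset.mul_sum]
      _ ≤ (L : ℝ) ^ (-(2 * s)) * (2 * r ^ 2 + 2 * r ^ 2) := by
          gcongr
          · exact hθr _
          · exact hηr _
      _ = _ := by ring
  have hbound (F : Finset (Fin d → ℕ)) : eLpNorm (f - g) 2 volume ≤
      eLpNorm (fun x => f x - (1 + ∑ l ∈ F, θ l * trigProd l x)) 2 volume +
      eLpNorm (fun x => g x - (1 + ∑ l ∈ F, η l * trigProd l x)) 2 volume + R := by
    have hc (ζ : (Fin d → ℕ) → ℝ) : Continuous fun x : Cube d => ∑ l ∈ F, ζ l * trigProd l x :=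
      continuous_finsetSum _ fun j _ => continuous_const.mul (continuous_trigProd _)
    have e : f - g = ((fun x => f x - (1 + ∑ l ∈ F, θ l * trigProd l x)) -
        (fun x => g x - (1 + ∑ l ∈ F, η l * trigProd l x))) +
        fun x => ∑ l ∈ F, (θ l - η l) * trigProd l x := by
      ext x
      simp only [Pi.add_apply, Pi.sub_apply, sub_mul, Finset.sum_sub_distrib]
      ring
    have m1 : AEStronglyMeasurable (fun x => f x - (1 + ∑ l ∈ F, θ l * trigProd l x)) volume :=
      hf.1.1.1.sub (continuous_const.add (hc θ)).aestronglyMeasurable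
    have m2 : AEStronglyMeasurable (fun x => g x - (1 + ∑ l ∈ F, η l * trigProd l x)) volume :=
      hg.1.1.1.sub (continuous_const.add (hc η)).aestronglyMeasurable
    rw [e]
    refine (eLpNorm_add_le (m1.sub m2) (hc _).aestronglyMeasurable (by norm_num)).trans ?_
    gcongr
    · exact MeasureTheory.eLpNorm_sub_le m1 m2 (by norm_num)
    · rw [eLpNorm_two_eq_sqrt (memLp_of_continuous (hc _) _), hR]
      refine ENNReal.ofReal_le_ofReal (Real.sqrt_le_sqrt ?_)
      have := integral_sum_trigProd_sq F id Function.injective_id.injOn (fun l => θ l - η l)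
        (fun l => θ l - η l)
      simp only [id] at this
      simp_rw [pow_two, this, ← pow_two]
      rw [← Finset.sum_inter_add_sum_sdiff F (box d L)]
      gcongr
      · calc _ ≤ ∑ l ∈ box d L, (θ l - η l) ^ 2 :=
              Finset.sum_le_sum_of_subset_of_nonneg Finset.inter_subset_right
                fun _ _ _ => sq_nonneg _
          _ ≤ _ := Finset.sum_le_sum fun l _ => hδ l
      · exact htail F
  have hlim := (hθ.add hη).add_const R
  rw [zero_add, zero_add] at hlim
  exact ge_of_tendsto hlim (Filter.Eventually.of_forall hbound)

lemma isProbabilityMeasure_densityMeasure {s r : ℝ} {f : Cube d → ℝ}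
    (hf : f ∈ sobolevDensities s r d) : IsProbabilityMeasure (densityMeasure f) := by
  constructor
  rw [densityMeasure, withDensity_apply _ MeasurableSet.univ, Measure.restrict_univ,
    ← ofReal_integral_eq_lintegral_ofReal (integrable_of_mem_sobolevClass hf.1) hf.2.1, hf.2.2,
    ENNReal.ofReal_one]

/-- The integral of `g` under the distribution with density `f`. -/
lemma integral_densityMeasure {s r : ℝ} {f : Cube d → ℝ} (hf : f ∈ sobolevDensities s r d)
    (g : Cube d → ℝ) : ∫ x, g x ∂(densityMeasure f) = ∫ x, f x * g x := by
  have hfm : AEMeasurable (fun x => ENNReal.ofReal (f x)) volume :=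
    hf.1.1.1.aemeasurable.ennreal_ofReal
  rw [densityMeasure, integral_withDensity_eq_integral_toReal_smul₀ hfm (by simp)]
  refine integral_congr_ae ?_
  filter_upwards [hf.2.1] with x hx
  simp [ENNReal.toReal_ofReal hx]

/-- Trigonometric perturbations of the uniform density. -/
lemma perturbation_mem {ι : Type*} [Fintype ι] (l : ι → Fin d → ℕ) (hinj : Function.Injective l)
    (hl0 : ∀ i, l i ≠ 0) (L : ℝ) (hL : ∀ i, indexNorm (l i) ≤ L) {s r : ℝ} (hs : 0 < s)
    (a : ι → ℝ) (ha : L ^ (2 * s) * ∑ i, a i ^ 2 ≤ r ^ 2)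
    (hbound : ∀ x, |∑ i, a i * trigProd (l i) x| ≤ 1) :
    (fun x => 1 + ∑ i, a i * trigProd (l i) x) ∈ sobolevDensities s r d := by
  classical
  have hc : Continuous fun x : Cube d => ∑ i, a i * trigProd (l i) x :=
    continuous_finsetSum _ fun j _ => continuous_const.mul (continuous_trigProd _)
  set θ : (Fin d → ℕ) → ℝ := Function.extend l a 0 with hθdef
  have hθ (i) : θ (l i) = a i := hinj.extend_apply _ _ _
  have hθ' (k) (hk : k ∉ Finset.univ.image l) : θ k = 0 := by
    rw [hθdef, Function.extend_apply' _ _ _ (by simpa using hk)]; rfl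
  refine ⟨⟨memLp_of_continuous (continuous_const.add hc) _, θ, ?_, ?_⟩,
    Filter.Eventually.of_forall fun x => ?_, ?_⟩
  · refine tendsto_const_nhds.congr' ?_
    filter_upwards [Filter.eventually_ge_atTop (Finset.univ.image l)] with F hF
    have e : (fun x => 1 + ∑ i, a i * trigProd (l i) x - (1 + ∑ k ∈ F, θ k * trigProd k x)) =
        fun _ => 0 := by
      ext x
      rw [← Finset.sum_subset hF fun k _ hk => by rw [hθ' k hk, zero_mul],
        Finset.sum_image fun _ _ _ _ h => hinj h]
      simp [hθ]
    rw [e, eLpNorm_zero']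
  · rw [tsum_eq_sum (s := Finset.univ.image l) fun k hk => by rw [hθ' k hk]; simp,
      Finset.sum_image fun _ _ _ _ h => hinj h,
      ← ENNReal.ofReal_sum_of_nonneg (fun l _ =>
        mul_nonneg (Real.rpow_nonneg (indexNorm_nonneg _) _) (sq_nonneg _))]
    refine ENNReal.ofReal_le_ofReal (le_trans ?_ ha)
    rw [Finset.mul_sum]
    refine Finset.sum_le_sum fun i _ => ?_
    rw [hθ]
    gcongr
    · exact indexNorm_nonneg _
    · exact hL i
  · have := (abs_le.1 (hbound x)).1
    simp only; linarith
  · rw [integral_add (integrable_const _) (integrable_of_continuous hc),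
      integral_finsetSum _ fun i _ => (integrable_of_continuous (continuous_trigProd _)).const_mul _]
    simp [integral_const_mul, integral_trigProd _ (hl0 _)]

lemma one_mem_sobolevDensities {s r : ℝ} (hs : 0 < s) :
    (fun _ : Cube d => (1 : ℝ)) ∈ sobolevDensities s r d := by
  have := perturbation_mem (d := d) (ι := Empty) (fun i => i.elim) (fun i => i.elim)
    (fun i => i.elim) 0 (fun i => i.elim) hs (r := r) (fun i => i.elim)
    (by simpa using sq_nonneg r) (by simp)
  simpa using this

end LDPTwoSample

end

noncomputable section

namespace LDPTwoSample

/-! ### Integration against the law of the views -/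

section Privatized

variable {𝒳 H V : Type} [MeasurableSpace 𝒳] [MeasurableSpace H] [MeasurableSpace V]

instance isMarkovKernel_privatized (P : Measure 𝒳) [IsProbabilityMeasure P]
    (κ : Kernel (𝒳 × H) V) [IsMarkovKernel κ] : IsMarkovKernel (privatized P κ) := by
  unfold privatized; infer_instance

lemma lintegral_privatized (P : Measure 𝒳) [IsProbabilityMeasure P] (κ : Kernel (𝒳 × H) V)
    (h : H) {F : V → ENNReal} (hF : Measurable F) :
    ∫⁻ z, F z ∂(privatized P κ h) = ∫⁻ x, ∫⁻ z, F z ∂(κ (x, h)) ∂P := by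
  unfold privatized
  rw [Kernel.lintegral_comp _ _ _ hF, Kernel.lintegral_prod _ _ _ hF.lintegral_kernel]
  simp only [Kernel.const_apply]
  refine lintegral_congr fun x => ?_
  rw [Kernel.lintegral_id' ]
  exact hF.lintegral_kernel.comp measurable_prodMk_left

end Privatized

lemma measurable_snoc {α T : Type} [MeasurableSpace α] [MeasurableSpace T] {t : ℕ}
    {f : α → Fin t → T} {g : α → T} (hf : Measurable f) (hg : Measurable g) :
    Measurable fun a => (Fin.snoc (α := fun _ => T) (f a) (g a) : Fin (t + 1) → T) := by
  rw [measurable_pi_iff]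
  intro i
  refine Fin.lastCases ?_ (fun j => ?_) i
  · simpa using hg
  · simpa using measurable_pi_iff.1 hf j

namespace Mechanism

variable {𝒳 : Type} [MeasurableSpace 𝒳] {n₁ m : ℕ} (M : Mechanism 𝒳 n₁ m)

/-- The channel of the first sample in round `t`. -/
def roundX (t : ℕ) (ht : t < n₁) : Kernel (𝒳 × ((Fin t → M.Z) × (Fin t → M.W))) M.Z := M.QX ⟨t, ht⟩

/-- The channel of the second sample in round `t`. -/
def roundY (t : ℕ) (ht : t < n₁) : Kernel (𝒳 × ((Fin t → M.Z) × (Fin t → M.W))) M.W := M.QY ⟨t, ht⟩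

/-- The channel of the second sample in the unpaired round `k`. -/
def roundY' (k : ℕ) (hk : k < m) :
    Kernel (𝒳 × ((Fin n₁ → M.Z) × (Fin (n₁ + k) → M.W))) M.W := M.QY' ⟨k, hk⟩

instance (t : ℕ) (ht : t < n₁) : IsMarkovKernel (M.roundX t ht) := M.markovX ⟨t, ht⟩
instance (t : ℕ) (ht : t < n₁) : IsMarkovKernel (M.roundY t ht) := M.markovY ⟨t, ht⟩
instance (k : ℕ) (hk : k < m) : IsMarkovKernel (M.roundY' k hk) := M.markovY' ⟨k, hk⟩

/-- Append the new views of a round to the history. -/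
def extend {t : ℕ} (q : ((Fin t → M.Z) × (Fin t → M.W)) × (M.Z × M.W)) :
    (Fin (t + 1) → M.Z) × (Fin (t + 1) → M.W) :=
  (Fin.snoc (α := fun _ => M.Z) q.1.1 q.2.1, Fin.snoc (α := fun _ => M.W) q.1.2 q.2.2)

lemma measurable_extend {t : ℕ} : Measurable (M.extend (t := t)) :=
  (measurable_snoc (measurable_fst.comp measurable_fst) (measurable_fst.comp measurable_snd)).prodMk
    (measurable_snoc (measurable_snd.comp measurable_fst) (measurable_snd.comp measurable_snd))

variable (PX PY : Measure 𝒳)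

lemma pairedLaw_succ (t : ℕ) (ht : t + 1 ≤ n₁) :
    M.pairedLaw PX PY (t + 1) ht = ((M.pairedLaw PX PY t (Nat.le_of_succ_le ht)) ⊗ₘ
        (privatized PX (M.roundX t ht) ×ₖ privatized PY (M.roundY t ht))).map M.extend := rfl

/-- Append a new view of the second sample to the history. -/
def extendRight {k : ℕ} (q : ((Fin n₁ → M.Z) × (Fin (n₁ + k) → M.W)) × M.W) :
    (Fin n₁ → M.Z) × (Fin (n₁ + (k + 1)) → M.W) :=
  (q.1.1, Fin.snoc (α := fun _ => M.W) q.1.2 q.2)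

lemma measurable_extendRight {k : ℕ} : Measurable (M.extendRight (k := k)) :=
  (measurable_fst.comp measurable_fst).prodMk
    (measurable_snoc (measurable_snd.comp measurable_fst) measurable_snd)

lemma extendedLaw_succ (k : ℕ) (hk : k + 1 ≤ m) :
    M.extendedLaw PX PY (k + 1) hk = ((M.extendedLaw PX PY k (Nat.le_of_succ_le hk)) ⊗ₘ
        privatized PY (M.roundY' k hk)).map M.extendRight := rfl

variable [IsProbabilityMeasure PX] [IsProbabilityMeasure PY]

instance isProbabilityMeasure_pairedLaw (t : ℕ) (ht : t ≤ n₁) :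
    IsProbabilityMeasure (M.pairedLaw PX PY t ht) := by
  induction t with
  | zero => unfold pairedLaw; infer_instance
  | succ t ih =>
    have := ih (Nat.le_of_succ_le ht)
    rw [pairedLaw_succ]
    exact Measure.isProbabilityMeasure_map M.measurable_extend.aemeasurable

lemma lintegral_pairedLaw_succ (t : ℕ) (ht : t + 1 ≤ n₁)
    {F : (Fin (t + 1) → M.Z) × (Fin (t + 1) → M.W) → ENNReal} (hF : Measurable F) :
    ∫⁻ v, F v ∂(M.pairedLaw PX PY (t + 1) ht) =
      ∫⁻ h, ∫⁻ z, ∫⁻ w, F (M.extend (h, (z, w))) ∂(privatized PY (M.roundY t ht) h)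
        ∂(privatized PX (M.roundX t ht) h) ∂(M.pairedLaw PX PY t (Nat.le_of_succ_le ht)) := by
  have hFe : Measurable fun q => F (M.extend (t := t) q) := hF.comp M.measurable_extend
  rw [pairedLaw_succ, lintegral_map hF M.measurable_extend, Measure.lintegral_compProd hFe]
  refine lintegral_congr fun h => ?_
  rw [Kernel.lintegral_prod]
  exact hFe.comp measurable_prodMk_left

instance isProbabilityMeasure_extendedLaw (k : ℕ) (hk : k ≤ m) :
    IsProbabilityMeasure (M.extendedLaw PX PY k hk) := by
  induction k with
  | zero => unfold extendedLaw; infer_instance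
  | succ k ih =>
    have := ih (Nat.le_of_succ_le hk)
    rw [extendedLaw_succ]
    exact Measure.isProbabilityMeasure_map M.measurable_extendRight.aemeasurable

lemma lintegral_extendedLaw_succ (k : ℕ) (hk : k + 1 ≤ m)
    {F : (Fin n₁ → M.Z) × (Fin (n₁ + (k + 1)) → M.W) → ENNReal} (hF : Measurable F) :
    ∫⁻ v, F v ∂(M.extendedLaw PX PY (k + 1) hk) =
      ∫⁻ h, ∫⁻ w, F (M.extendRight (h, w)) ∂(privatized PY (M.roundY' k hk) h)
        ∂(M.extendedLaw PX PY k (Nat.le_of_succ_le hk)) := by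
  rw [extendedLaw_succ, lintegral_map hF M.measurable_extendRight,
    Measure.lintegral_compProd (f := fun q => F (M.extendRight q))
      (hF.comp M.measurable_extendRight)]

/-- The views of the paired rounds. -/
def pairedViews {k : ℕ} (v : (Fin n₁ → M.Z) × (Fin (n₁ + k) → M.W)) :
    (Fin n₁ → M.Z) × (Fin n₁ → M.W) := (v.1, fun i => v.2 (Fin.castAdd k i))

lemma measurable_pairedViews {k : ℕ} : Measurable (M.pairedViews (k := k)) :=
  measurable_fst.prodMk (measurable_pi_iff.2 fun i =>
    (measurable_pi_apply (Fin.castAdd k i)).comp measurable_snd)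

lemma extendedLaw_map_pairedViews (k : ℕ) (hk : k ≤ m) :
    (M.extendedLaw PX PY k hk).map M.pairedViews = M.pairedLaw PX PY n₁ le_rfl := by
  induction k with
  | zero => exact Measure.map_id
  | succ k ih =>
    rw [extendedLaw_succ, Measure.map_map M.measurable_pairedViews M.measurable_extendRight,
      ← ih (Nat.le_of_succ_le hk)]
    have : M.pairedViews ∘ M.extendRight (k := k) = M.pairedViews ∘ Prod.fst := by
      funext q
      refine Prod.ext rfl (funext fun i => ?_)
      have : (Fin.castAdd (k + 1) i : Fin (n₁ + (k + 1))) = Fin.castSucc (Fin.castAdd k i) := rfl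
      simp only [pairedViews, extendRight, Function.comp_apply, this]
      exact Fin.snoc_castSucc (α := fun _ => M.W) _ _ _
    rw [this, ← Measure.map_map M.measurable_pairedViews measurable_fst]
    congr 1
    exact Measure.fst_compProd _ _

lemma law_preimage_pairedViews {S : Set ((Fin n₁ → M.Z) × (Fin n₁ → M.W))}
    (hS : MeasurableSet S) :
    M.law PX PY (M.pairedViews ⁻¹' S) = M.pairedLaw PX PY n₁ le_rfl S := by
  rw [← M.extendedLaw_map_pairedViews PX PY m le_rfl, Measure.map_apply M.measurable_pairedViews hS]
  rfl

/-- The unpaired rounds act on the paired views through a channel that only depends on the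
distribution of the second sample. -/
lemma exists_lintegral_extendedLaw_eq (k : ℕ) (hk : k ≤ m)
    {F : (Fin n₁ → M.Z) × (Fin (n₁ + k) → M.W) → ENNReal} (hF : Measurable F) (hF1 : ∀ v, F v ≤ 1) :
    ∃ G : (Fin n₁ → M.Z) × (Fin n₁ → M.W) → ENNReal, Measurable G ∧ (∀ v, G v ≤ 1) ∧
      ∀ (PX : Measure 𝒳) [IsProbabilityMeasure PX],
        ∫⁻ v, F v ∂(M.extendedLaw PX PY k hk) = ∫⁻ v, G v ∂(M.pairedLaw PX PY n₁ le_rfl) := by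
  induction k with
  | zero => exact ⟨F, hF, hF1, fun PX _ => rfl⟩
  | succ k ih =>
    have hk' := Nat.le_of_succ_le hk
    -- The last view is integrated out. Its kernel involves only `PY`, so the new integrand is the
    -- same for every `PX`.
    obtain ⟨G, hG, hG1, h⟩ := ih hk'
      (F := fun h => ∫⁻ w, F (M.extendRight (h, w)) ∂(privatized PY (M.roundY' k hk) h))
      ((hF.comp M.measurable_extendRight).lintegral_kernel_prod_right')
      (fun v => (lintegral_mono fun w => hF1 _).trans (by simp))
    refine ⟨G, hG, hG1, fun PX _ => ?_⟩
    rw [lintegral_extendedLaw_succ _ _ _ _ _ hF, h PX]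

end Mechanism

end LDPTwoSample

end

noncomputable section

namespace LDPTwoSample

/-! ### Randomized response -/

/-- The sign of a bit. -/
def bitSign (b : Bool) : ℝ := if b then 1 else -1

/-- The law of a bit whose sign has mean `v`. -/
def signLaw (v : ℝ) : Measure Bool :=
  ENNReal.ofReal ((1 + v) / 2) • Measure.dirac true +
    ENNReal.ofReal ((1 - v) / 2) • Measure.dirac false

lemma isProbabilityMeasure_signLaw {v : ℝ} (hv : |v| ≤ 1) : IsProbabilityMeasure (signLaw v) := by
  constructor
  obtain ⟨h1, h2⟩ := abs_le.1 hv
  simp only [signLaw, Measure.add_apply, Measure.smul_apply, measure_univ, smul_eq_mul, mul_one]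
  rw [← ENNReal.ofReal_add (by linarith) (by linarith), ← ENNReal.ofReal_one]
  congr 1; ring

lemma lintegral_signLaw (v : ℝ) (F : Bool → ENNReal) :
    ∫⁻ b, F b ∂(signLaw v) =
      ENNReal.ofReal ((1 + v) / 2) * F true + ENNReal.ofReal ((1 - v) / 2) * F false := by
  simp [signLaw, lintegral_add_measure, lintegral_smul_measure]

/-- Hoeffding's lemma: a variable with values in [-1, 1] has variance proxy 1. -/
lemma exp_mgf_le {v : ℝ} (hv : |v| ≤ 1) (c : ℝ) :
    (1 + v) / 2 * Real.exp c + (1 - v) / 2 * Real.exp (-c) ≤ Real.exp (c * v + c ^ 2 / 2) := by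
  have := isProbabilityMeasure_signLaw hv
  obtain ⟨h1, h2⟩ := abs_le.1 hv
  have hint (F : Bool → ℝ) : ∫ b, F b ∂(signLaw v) = (1 + v) / 2 * F true + (1 - v) / 2 * F false := by
    rw [signLaw, integral_add_measure
      (Integrable.of_finite.smul_measure ENNReal.ofReal_ne_top)
      (Integrable.of_finite.smul_measure ENNReal.ofReal_ne_top),
      integral_smul_measure, integral_smul_measure]
    simp [ENNReal.toReal_ofReal (show 0 ≤ (1 + v) / 2 by linarith),
      ENNReal.toReal_ofReal (show 0 ≤ (1 - v) / 2 by linarith)]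
  have hm : ∫ b, bitSign b ∂(signLaw v) = v := by rw [hint]; simp [bitSign]; ring
  have h := hasSubgaussianMGF_of_mem_Icc (μ := signLaw v) (X := bitSign) (a := -1) (b := 1)
    (Measurable.of_discrete.aemeasurable)
    (Filter.Eventually.of_forall fun b => by cases b <;> simp [bitSign])
  have h' := h.mgf_le c
  rw [mgf, hm, hint] at h'
  simp only [bitSign, if_true, Bool.false_eq_true, if_false] at h'
  have hn : ((‖(1 : ℝ) - -1‖₊ / 2) ^ 2 : NNReal) = 1 := by
    ext; simp; norm_num
  rw [hn] at h'
  calc _ = Real.exp (c * v) * ((1 + v) / 2 * Real.exp (c * (1 - v)) +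
          (1 - v) / 2 * Real.exp (c * (-1 - v))) := by
        rw [mul_add, mul_left_comm, ← Real.exp_add, mul_left_comm, ← Real.exp_add]
        ring_nf
    _ ≤ Real.exp (c * v) * Real.exp (1 * c ^ 2 / 2) := by gcongr; simpa using h'
    _ = _ := by rw [← Real.exp_add]; ring_nf

/-- The channel that releases a bit whose sign has mean `η * u`. -/
def bitKernel {α : Type} [MeasurableSpace α] (η : ℝ) (u : α → ℝ) (hu : Measurable u) :
    Kernel α Bool where
  toFun a := signLaw (η * u a)
  measurable' := by
    refine Measure.measurable_of_measurable_coe _ fun s _ => ?_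
    simp only [signLaw, Measure.add_apply, Measure.smul_apply, smul_eq_mul]
    fun_prop

lemma bitKernel_apply {α : Type} [MeasurableSpace α] (η : ℝ) (u : α → ℝ) (hu : Measurable u)
    (a : α) : bitKernel η u hu a = signLaw (η * u a) := rfl

/-- For ε ≤ 1 one has (1 + ε/4)/(1 − ε/4) ≤ 1 + ε ≤ e^ε. This is why a statistic bounded by 1 is
released with amplitude ε/4. -/
lemma signLaw_le {ε v w : ℝ} (hε0 : 0 < ε) (hε : ε ≤ 1) (hv : |v| ≤ ε / 4) (hw : |w| ≤ ε / 4)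
    (S : Set Bool) : signLaw v S ≤ ENNReal.ofReal (Real.exp ε) * signLaw w S := by
  have key {a b : ℝ} (ha : |a| ≤ ε / 4) (hb : |b| ≤ ε / 4) :
      ENNReal.ofReal ((1 + a) / 2) ≤
        ENNReal.ofReal (Real.exp ε) * ENNReal.ofReal ((1 + b) / 2) := by
    rw [← ENNReal.ofReal_mul (Real.exp_pos _).le]
    refine ENNReal.ofReal_le_ofReal ?_
    have h1 := (abs_le.1 ha).2
    have h2 := (abs_le.1 hb).1
    have h3 := Real.add_one_le_exp ε
    nlinarith
  have hv' : |-v| ≤ ε / 4 := by rwa [abs_neg]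
  have hw' : |-w| ≤ ε / 4 := by rwa [abs_neg]
  simp only [signLaw, Measure.add_apply, Measure.smul_apply, smul_eq_mul, mul_add, ← mul_assoc]
  gcongr
  · exact key hv hw
  · simpa [sub_eq_add_neg] using key hv' hw'

/-! ### Bit mechanisms -/

/-- A policy prescribes the statistic `u t x U` of the datum `x` that is released in round `t`,
when the differences of the signs of the earlier views are given by `U`. -/
structure Policy (d : ℕ) where
  u : ℕ → Cube d → (ℕ → ℝ) → ℝ
  measurable : ∀ t U, Measurable fun x => u t x U
  abs_le_one : ∀ t x U, |u t x U| ≤ 1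
  predictable : ∀ t x U U', (∀ i < t, U i = U' i) → u t x U = u t x U'

/-- The differences of the signs of the views of the two samples. -/
def diffs {t : ℕ} (h : (Fin t → Bool) × (Fin t → Bool)) (i : ℕ) : ℝ :=
  if hi : i < t then bitSign (h.1 ⟨i, hi⟩) - bitSign (h.2 ⟨i, hi⟩) else 0

variable {d : ℕ}

lemma Policy.measurable_uncurry (π : Policy d) (t : ℕ) :
    Measurable fun p : Cube d × ((Fin t → Bool) × (Fin t → Bool)) => π.u t p.1 (diffs p.2) :=
  measurable_from_prod_countable_left fun h => π.measurable t (diffs h)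

/-- The mechanism that releases one randomized bit per datum according to a policy. -/
def Policy.mechanism (π : Policy d) {ε : ℝ} (hε0 : 0 < ε) (hε : ε ≤ 1) (n₁ m : ℕ) :
    Mechanism (Cube d) n₁ m where
  Z := Bool
  W := Bool
  QX i := bitKernel (ε / 4) _ (π.measurable_uncurry i)
  QY i := bitKernel (ε / 4) _ (π.measurable_uncurry i)
  -- Fair coins: the unpaired data of the second sample are not used.
  QY' _ := bitKernel (ε / 4) (fun _ => 0) measurable_const
  markovX i := ⟨fun a => isProbabilityMeasure_signLaw (by
    rw [abs_mul, abs_of_nonneg (by positivity)]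
    have := π.abs_le_one i a.1 (diffs a.2)
    nlinarith [abs_nonneg (π.u i a.1 (diffs a.2))])⟩
  markovY i := ⟨fun a => isProbabilityMeasure_signLaw (by
    rw [abs_mul, abs_of_nonneg (by positivity)]
    have := π.abs_le_one i a.1 (diffs a.2)
    nlinarith [abs_nonneg (π.u i a.1 (diffs a.2))])⟩
  markovY' k := ⟨fun a => isProbabilityMeasure_signLaw (by simp)⟩

section

variable (π : Policy d) {ε : ℝ} (hε0 : 0 < ε) (hε : ε ≤ 1) (n₁ m : ℕ)

lemma Policy.abs_mul_le (hε0 : 0 < ε) (t : ℕ) (x : Cube d) (U : ℕ → ℝ) :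
    |ε / 4 * π.u t x U| ≤ ε / 4 := by
  rw [abs_mul, abs_of_nonneg (by positivity)]
  exact mul_le_of_le_one_right (by positivity) (π.abs_le_one _ _ _)

lemma Policy.isLDP : (π.mechanism hε0 hε n₁ m).IsLDP ε := by
  refine ⟨fun i x x' h S _ => ?_, fun i x x' h S _ => ?_, fun k x x' h S _ => ?_⟩
  · exact signLaw_le hε0 hε (π.abs_mul_le hε0 _ _ _) (π.abs_mul_le hε0 _ _ _) S
  · exact signLaw_le hε0 hε (π.abs_mul_le hε0 _ _ _) (π.abs_mul_le hε0 _ _ _) S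
  · exact signLaw_le hε0 hε (by simp; positivity) (by simp; positivity) S

lemma Policy.isNonInteractive (hπ : ∀ t x U U', π.u t x U = π.u t x U') :
    (π.mechanism hε0 hε n₁ m).IsNonInteractive := by
  refine ⟨fun i x h h' => ?_, fun i x h h' => ?_, fun k x h h' => rfl⟩
  · change signLaw (ε / 4 * π.u i x (diffs h)) = signLaw (ε / 4 * π.u i x (diffs h'))
    rw [hπ]
  · change signLaw (ε / 4 * π.u i x (diffs h)) = signLaw (ε / 4 * π.u i x (diffs h'))
    rw [hπ]

lemma Policy.abs_integral_le (P : Measure (Cube d)) [IsProbabilityMeasure P] (t : ℕ) (U : ℕ → ℝ) :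
    |∫ x, π.u t x U ∂P| ≤ 1 := by
  have := norm_integral_le_of_norm_le_const (μ := P) (f := fun x => π.u t x U) (C := 1)
    (Filter.Eventually.of_forall fun x => π.abs_le_one t x U)
  simpa using this

/-- The law of a bit is affine in its mean, so averaging over the datum only averages the mean. -/
lemma lintegral_privatized_bitKernel {H : Type} [MeasurableSpace H] (P : Measure (Cube d))
    [IsProbabilityMeasure P] {η : ℝ} (hη : |η| ≤ 1) (u : Cube d × H → ℝ) (hu : Measurable u)
    (hu1 : ∀ p, |u p| ≤ 1) (h : H) (F : Bool → ENNReal) :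
    ∫⁻ b, F b ∂(privatized P (bitKernel η u hu) h) =
      ∫⁻ b, F b ∂(signLaw (η * ∫ x, u (x, h) ∂P)) := by
  have hui : Integrable (fun x => u (x, h)) P :=
    Integrable.of_bound (hu.comp measurable_prodMk_right).aestronglyMeasurable 1
      (Filter.Eventually.of_forall fun x => hu1 _)
  have hb (x) : |η * u (x, h)| ≤ 1 := by
    rw [abs_mul]; exact mul_le_one₀ hη (abs_nonneg _) (hu1 _)
  have hp (x) := abs_le.1 (hb x)
  rw [lintegral_privatized _ _ _ Measurable.of_discrete]
  simp_rw [bitKernel_apply, lintegral_signLaw]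
  have m1 : Measurable fun x => ENNReal.ofReal ((1 + η * u (x, h)) / 2) := by
    have := hu.comp (measurable_prodMk_right (y := h)); fun_prop
  have m2 : Measurable fun x => ENNReal.ofReal ((1 - η * u (x, h)) / 2) := by
    have := hu.comp (measurable_prodMk_right (y := h)); fun_prop
  rw [lintegral_add_left (m1.mul_const _), lintegral_mul_const _ m1, lintegral_mul_const _ m2,
    ← ofReal_integral_eq_lintegral_ofReal, ← ofReal_integral_eq_lintegral_ofReal]
  · rw [integral_div, integral_add (integrable_const _) (hui.const_mul _), integral_div,
      integral_sub (integrable_const _) (hui.const_mul _), integral_const_mul]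
    simp
  · exact (((integrable_const _).sub (hui.const_mul _)).div_const _)
  · exact Filter.Eventually.of_forall fun x => by have := hp x; simp only [Pi.zero_apply]; linarith
  · exact (((integrable_const _).add (hui.const_mul _)).div_const _)
  · exact Filter.Eventually.of_forall fun x => by have := hp x; simp only [Pi.zero_apply]; linarith

/-- The conditional mean of the difference of the signs in round `t`. -/
def Policy.drift (ε : ℝ) (PX PY : Measure (Cube d)) (t : ℕ) (U : ℕ → ℝ) : ℝ :=
  ε / 4 * (∫ x, π.u t x U ∂PX - ∫ x, π.u t x U ∂PY)

lemma Policy.drift_congr (PX PY : Measure (Cube d)) (t : ℕ) {U U' : ℕ → ℝ}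
    (h : ∀ i < t, U i = U' i) : π.drift ε PX PY t U = π.drift ε PX PY t U' := by
  unfold drift
  simp_rw [fun x => π.predictable t x U U' h]

/-- The exponent of the exponential supermartingale with predictable weights `c`. -/
def Policy.exponent (ε : ℝ) (PX PY : Measure (Cube d)) (c : ℕ → (ℕ → ℝ) → ℝ) (t : ℕ)
    (U : ℕ → ℝ) : ℝ :=
  ∑ i ∈ Finset.range t, (c i U * (U i - π.drift ε PX PY i U) - c i U ^ 2)

lemma diffs_snoc_lt {t : ℕ} (h : (Fin t → Bool) × (Fin t → Bool)) (z w : Bool) {i : ℕ}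
    (hi : i < t) :
    diffs ((Fin.snoc (α := fun _ => Bool) h.1 z : Fin (t + 1) → Bool),
      (Fin.snoc (α := fun _ => Bool) h.2 w : Fin (t + 1) → Bool)) i = diffs h i := by
  have e : (⟨i, hi.trans (Nat.lt_succ_self t)⟩ : Fin (t + 1)) = Fin.castSucc ⟨i, hi⟩ := rfl
  simp only [diffs, dif_pos hi, dif_pos (hi.trans (Nat.lt_succ_self t)), e]
  rw [Fin.snoc_castSucc, Fin.snoc_castSucc]

lemma diffs_snoc_self {t : ℕ} (h : (Fin t → Bool) × (Fin t → Bool)) (z w : Bool) :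
    diffs ((Fin.snoc (α := fun _ => Bool) h.1 z : Fin (t + 1) → Bool),
      (Fin.snoc (α := fun _ => Bool) h.2 w : Fin (t + 1) → Bool)) t = bitSign z - bitSign w := by
  have e : (⟨t, Nat.lt_succ_self t⟩ : Fin (t + 1)) = Fin.last t := rfl
  simp only [diffs, dif_pos (Nat.lt_succ_self t), e]
  rw [Fin.snoc_last, Fin.snoc_last]

/-- The law of the views of the paired rounds, as a measure on bits. -/
def Policy.bitLaw (PX PY : Measure (Cube d)) (t : ℕ) (ht : t ≤ n₁) :
    Measure ((Fin t → Bool) × (Fin t → Bool)) :=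
  (π.mechanism hε0 hε n₁ m).pairedLaw PX PY t ht

instance Policy.isProbabilityMeasure_bitLaw (PX PY : Measure (Cube d)) [IsProbabilityMeasure PX]
    [IsProbabilityMeasure PY] (t : ℕ) (ht : t ≤ n₁) :
    IsProbabilityMeasure (π.bitLaw hε0 hε n₁ m PX PY t ht) :=
  Mechanism.isProbabilityMeasure_pairedLaw _ _ _ _ _

/-- Given the past, the two new signs are independent, and the weight a = c_t is a known number
because `c` is predictable. Hoeffding's lemma with a for one sign and −a for the other costs
e^{a²/2} twice, which the compensator c_t² in `exponent` cancels exactly. -/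
lemma Policy.lintegral_exp_exponent_le (PX PY : Measure (Cube d)) [IsProbabilityMeasure PX]
    [IsProbabilityMeasure PY] (c : ℕ → (ℕ → ℝ) → ℝ)
    (hc : ∀ t U U', (∀ i < t, U i = U' i) → c t U = c t U') (t : ℕ) (ht : t ≤ n₁) :
    ∫⁻ h, ENNReal.ofReal (Real.exp (π.exponent ε PX PY c t (diffs h)))
      ∂(π.bitLaw hε0 hε n₁ m PX PY t ht) ≤ 1 := by
  induction t with
  | zero =>
    simp [exponent]
  | succ t ih =>
    refine le_trans ?_ (ih (Nat.le_of_succ_le ht))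
    have hdisc : ∀ F : (Fin (t + 1) → Bool) × (Fin (t + 1) → Bool) → ENNReal, Measurable F :=
      fun F => Measurable.of_discrete
    have hε4 : |ε / 4| ≤ 1 := by rw [abs_of_pos (by positivity)]; linarith
    refine ((π.mechanism hε0 hε n₁ m).lintegral_pairedLaw_succ PX PY t ht (hdisc _)).trans_le ?_
    refine lintegral_mono fun h => ?_
    set U := diffs h with hU
    set vX := ε / 4 * ∫ x, π.u t x U ∂PX with hvX
    set vY := ε / 4 * ∫ x, π.u t x U ∂PY with hvY
    have hX1 : |vX| ≤ 1 := by
      rw [hvX, abs_mul]; exact mul_le_one₀ hε4 (abs_nonneg _) (π.abs_integral_le PX t U)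
    have hY1 : |vY| ≤ 1 := by
      rw [hvY, abs_mul]; exact mul_le_one₀ hε4 (abs_nonneg _) (π.abs_integral_le PY t U)
    have hd : π.drift ε PX PY t U = vX - vY := by rw [drift, hvX, hvY]; ring
    have key (z w : Bool) : π.exponent ε PX PY c (t + 1)
        (diffs ((π.mechanism hε0 hε n₁ m).extend (h, (z, w)))) =
        π.exponent ε PX PY c t U + (c t U * (bitSign z - bitSign w - (vX - vY)) - c t U ^ 2) := by
      have hlt (i) (hi : i < t) : diffs ((π.mechanism hε0 hε n₁ m).extend (h, (z, w))) i = U i :=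
        diffs_snoc_lt h z w hi
      have hself : diffs ((π.mechanism hε0 hε n₁ m).extend (h, (z, w))) t = bitSign z - bitSign w :=
        diffs_snoc_self h z w
      rw [exponent, Finset.sum_range_succ, hself, hc t _ U hlt, π.drift_congr PX PY t hlt, hd]
      congr 1
      refine Finset.sum_congr rfl fun i hi => ?_
      have hi := Finset.mem_range.1 hi
      rw [hlt i hi, hc i _ U fun j hj => hlt j (hj.trans hi),
        π.drift_congr PX PY i fun j hj => hlt j (hj.trans hi)]
    have hpX (F : Bool → ENNReal) :
        ∫⁻ b, F b ∂(privatized PX ((π.mechanism hε0 hε n₁ m).roundX t ht) h) =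
        ∫⁻ b, F b ∂(signLaw vX) :=
      lintegral_privatized_bitKernel PX hε4 _ (π.measurable_uncurry t)
        (fun p => π.abs_le_one _ _ _) h F
    have hpY (F : Bool → ENNReal) :
        ∫⁻ b, F b ∂(privatized PY ((π.mechanism hε0 hε n₁ m).roundY t ht) h) =
        ∫⁻ b, F b ∂(signLaw vY) :=
      lintegral_privatized_bitKernel PY hε4 _ (π.measurable_uncurry t)
        (fun p => π.abs_le_one _ _ _) h F
    refine (lintegral_congr fun z => hpY _).trans_le ((hpX _).trans_le ?_)
    simp only [key]
    set a := c t U with ha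
    set e0 := π.exponent ε PX PY c t U
    obtain ⟨hX2, hX3⟩ := abs_le.1 hX1
    obtain ⟨hY2, hY3⟩ := abs_le.1 hY1
    have hY1' : |-vY| ≤ 1 := by rwa [abs_neg]
    simp only [lintegral_signLaw, bitSign, if_true, Bool.false_eq_true, if_false]
    have p1 : 0 ≤ (1 + vX) / 2 := by linarith
    have p2 : 0 ≤ (1 - vX) / 2 := by linarith
    have p3 : 0 ≤ (1 + vY) / 2 := by linarith
    have p4 : 0 ≤ (1 - vY) / 2 := by linarith
    simp only [← ENNReal.ofReal_mul p3, ← ENNReal.ofReal_mul p4]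
    rw [← ENNReal.ofReal_add (by positivity) (by positivity),
      ← ENNReal.ofReal_add (by positivity) (by positivity), ← ENNReal.ofReal_mul p1,
      ← ENNReal.ofReal_mul p2, ← ENNReal.ofReal_add (by positivity) (by positivity)]
    refine ENNReal.ofReal_le_ofReal ?_
    have hX := exp_mgf_le hX1 a
    have hY := exp_mgf_le hY1 (-a)
    rw [neg_neg] at hY
    calc _ = Real.exp (e0 - a * (vX - vY) - a ^ 2) *
          (((1 + vX) / 2 * Real.exp a + (1 - vX) / 2 * Real.exp (-a)) *
          ((1 + vY) / 2 * Real.exp (-a) + (1 - vY) / 2 * Real.exp a)) := by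
          have s1 : e0 + (a * (1 - 1 - (vX - vY)) - a ^ 2) =
            (e0 - a * (vX - vY) - a ^ 2) + a + -a := by ring
          have s2 : e0 + (a * (1 - -1 - (vX - vY)) - a ^ 2) =
            (e0 - a * (vX - vY) - a ^ 2) + a + a := by ring
          have s3 : e0 + (a * (-1 - 1 - (vX - vY)) - a ^ 2) =
            (e0 - a * (vX - vY) - a ^ 2) + -a + -a := by ring
          have s4 : e0 + (a * (-1 - -1 - (vX - vY)) - a ^ 2) =
            (e0 - a * (vX - vY) - a ^ 2) + -a + a := by ring
          rw [s1, s2, s3, s4]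
          simp only [Real.exp_add]
          ring
      _ ≤ Real.exp (e0 - a * (vX - vY) - a ^ 2) *
          (Real.exp (a * vX + a ^ 2 / 2) * Real.exp (-a * vY + (-a) ^ 2 / 2)) := by
          gcongr
      _ = Real.exp e0 := by
          rw [← Real.exp_add, ← Real.exp_add]; ring_nf

/-- The exponential Markov inequality for the supermartingale. -/
lemma Policy.measure_le_exp (PX PY : Measure (Cube d)) [IsProbabilityMeasure PX]
    [IsProbabilityMeasure PY] (c : ℕ → (ℕ → ℝ) → ℝ)
    (hc : ∀ t U U', (∀ i < t, U i = U' i) → c t U = c t U') (t : ℕ) (ht : t ≤ n₁) (v : ℝ)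
    (S : Set ((Fin t → Bool) × (Fin t → Bool)))
    (hS : ∀ h ∈ S, v ≤ π.exponent ε PX PY c t (diffs h)) :
    π.bitLaw hε0 hε n₁ m PX PY t ht S ≤ ENNReal.ofReal (Real.exp (-v)) := by
  have h1 := π.lintegral_exp_exponent_le hε0 hε n₁ m PX PY c hc t ht
  have h2 : ENNReal.ofReal (Real.exp v) * π.bitLaw hε0 hε n₁ m PX PY t ht S ≤ 1 := by
    refine le_trans ?_ h1
    rw [← setLIntegral_const]
    refine (setLIntegral_mono Measurable.of_discrete fun h hh => ?_).trans
      (setLIntegral_le_lintegral S _)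
    exact ENNReal.ofReal_le_ofReal (Real.exp_le_exp.2 (hS h hh))
  rw [Real.exp_neg, ENNReal.ofReal_inv_of_pos (Real.exp_pos _)]
  rw [mul_comm] at h2
  rwa [ENNReal.le_inv_iff_mul_le]

end

end LDPTwoSample

end

noncomputable section

namespace LDPTwoSample

/-! ### Self-normalized two-stage tests -/

variable {d : ℕ}

/-- The self-normalized test with weights `a`: reject if the weighted sum of the differences
exceeds `t` times the root of the sum of the squared weights. -/
def exceeds (a : ℕ → (ℕ → ℝ) → ℝ) (n : ℕ) (t : ℝ) (U : ℕ → ℝ) : Prop :=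
  t * √(∑ i ∈ Finset.range n, a i U ^ 2) < ∑ i ∈ Finset.range n, a i U * U i

/-- The weights vanish before round `m₁` and only depend on the rounds before `m₁`. -/
structure IsStageWeight (a : ℕ → (ℕ → ℝ) → ℝ) (m₁ : ℕ) : Prop where
  eq_zero : ∀ i < m₁, ∀ U, a i U = 0
  congr : ∀ i U U', (∀ j < m₁, U j = U' j) → a i U = a i U'

/-- The normalizer involves the weights of later rounds, so predictability is not automatic. Before
round `m₁` the numerator vanishes, and from then on all the weights are already determined. -/
lemma IsStageWeight.predictable {a : ℕ → (ℕ → ℝ) → ℝ} {m₁ : ℕ} (ha : IsStageWeight a m₁)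
    (n : ℕ) (b : ℝ) (t : ℕ) (U U' : ℕ → ℝ) (h : ∀ i < t, U i = U' i) :
    b * a t U / √(∑ i ∈ Finset.range n, a i U ^ 2) =
      b * a t U' / √(∑ i ∈ Finset.range n, a i U' ^ 2) := by
  by_cases ht : t < m₁
  · rw [ha.eq_zero t ht, ha.eq_zero t ht]; simp
  · have h' : ∀ i, a i U = a i U' := fun i => ha.congr i U U' fun j hj => h j (by omega)
    simp_rw [h']

section

variable (π : Policy d) {ε : ℝ} (hε0 : 0 < ε) (hε : ε ≤ 1) (n₁ m : ℕ)

/-- Normalizing the weights turns the random quadratic compensator into the constant b². This is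
what makes the tail bounds uniform over the outcome of the first stage. -/
lemma Policy.exponent_normalized (PX PY : Measure (Cube d)) (a : ℕ → (ℕ → ℝ) → ℝ) (b : ℝ)
    (U : ℕ → ℝ) (hA : 0 < √(∑ i ∈ Finset.range n₁, a i U ^ 2)) :
    π.exponent ε PX PY (fun i U => b * a i U / √(∑ i ∈ Finset.range n₁, a i U ^ 2)) n₁ U =
      b * (∑ i ∈ Finset.range n₁, a i U * U i -
        ∑ i ∈ Finset.range n₁, a i U * π.drift ε PX PY i U) /
        √(∑ i ∈ Finset.range n₁, a i U ^ 2) - b ^ 2 := by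
  unfold exponent
  set A := √(∑ i ∈ Finset.range n₁, a i U ^ 2) with hAdef
  have hA2 : ∑ i ∈ Finset.range n₁, a i U ^ 2 = A ^ 2 :=
    (Real.sq_sqrt (Finset.sum_nonneg fun _ _ => sq_nonneg _)).symm
  rw [Finset.sum_sub_distrib]
  congr 1
  · rw [← Finset.sum_sub_distrib, Finset.mul_sum, Finset.sum_div]
    exact Finset.sum_congr rfl fun i _ => by ring
  · have : ∀ i, (b * a i U / A) ^ 2 = b ^ 2 / A ^ 2 * a i U ^ 2 := fun i => by ring
    rw [Finset.sum_congr rfl fun i _ => this i, ← Finset.mul_sum, hA2]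
    field_simp

lemma sum_weights_eq_zero {a : ℕ → (ℕ → ℝ) → ℝ} {U : ℕ → ℝ}
    (hA : ¬ 0 < √(∑ i ∈ Finset.range n₁, a i U ^ 2)) (v : ℕ → ℝ) :
    ∑ i ∈ Finset.range n₁, a i U * v i = 0 := by
  rw [Real.sqrt_pos, not_lt] at hA
  have h0 := le_antisymm hA (Finset.sum_nonneg fun _ _ => sq_nonneg _)
  rw [Finset.sum_eq_zero_iff_of_nonneg fun _ _ => sq_nonneg _] at h0
  refine Finset.sum_eq_zero fun i hi => ?_
  rw [pow_eq_zero_iff two_ne_zero |>.1 (h0 i hi), zero_mul]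

/-- Under the null hypothesis the drift vanishes. The choice b = t/2 maximizes bt − b² and gives
t²/4; a vanishing normalizer makes the statistic 0, which is not a rejection. -/
lemma Policy.measure_exceeds_le (P : Measure (Cube d)) [IsProbabilityMeasure P]
    {a : ℕ → (ℕ → ℝ) → ℝ} {m₁ : ℕ} (ha : IsStageWeight a m₁) {t : ℝ} (ht : 0 < t) :
    π.bitLaw hε0 hε n₁ m P P n₁ le_rfl {h | exceeds a n₁ t (diffs h)} ≤
      ENNReal.ofReal (Real.exp (-(t ^ 2 / 4))) := by
  refine π.measure_le_exp hε0 hε n₁ m P P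
    (fun i U => t / 2 * a i U / √(∑ i ∈ Finset.range n₁, a i U ^ 2))
    (ha.predictable n₁ (t / 2)) n₁ le_rfl (t ^ 2 / 4) _ fun h hh => ?_
  simp only [Set.mem_ofPred_eq, exceeds] at hh
  by_cases hA : 0 < √(∑ i ∈ Finset.range n₁, a i (diffs h) ^ 2)
  · rw [π.exponent_normalized n₁ P P a _ _ hA]
    have hd : ∀ i, π.drift ε P P i (diffs h) = 0 := fun i => by simp [drift]
    simp only [hd, mul_zero, Finset.sum_const_zero, sub_zero]
    have : t / 2 * t ≤ t / 2 * (∑ i ∈ Finset.range n₁, a i (diffs h) * diffs h i) /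
        √(∑ i ∈ Finset.range n₁, a i (diffs h) ^ 2) := by
      rw [le_div_iff₀ hA, mul_assoc]
      gcongr
    linarith [this]
  · rw [sum_weights_eq_zero n₁ hA] at hh
    have := Real.sqrt_nonneg (∑ i ∈ Finset.range n₁, a i (diffs h) ^ 2)
    exact absurd hh (not_lt.2 (by positivity))

/-- If the drift exceeds twice the threshold and the test still accepts, the centred statistic is
below minus one threshold. This is the same tail event as under the null hypothesis, with the
weights negated. -/
lemma Policy.measure_not_exceeds_le (PX PY : Measure (Cube d)) [IsProbabilityMeasure PX]
    [IsProbabilityMeasure PY] {a : ℕ → (ℕ → ℝ) → ℝ} {m₁ : ℕ} (ha : IsStageWeight a m₁) {t : ℝ}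
    (ht : 0 < t) :
    π.bitLaw hε0 hε n₁ m PX PY n₁ le_rfl {h | ¬ exceeds a n₁ t (diffs h)} ≤
      π.bitLaw hε0 hε n₁ m PX PY n₁ le_rfl {h |
        ∑ i ∈ Finset.range n₁, a i (diffs h) * π.drift ε PX PY i (diffs h) ≤
          2 * t * √(∑ i ∈ Finset.range n₁, a i (diffs h) ^ 2)} +
      ENNReal.ofReal (Real.exp (-(t ^ 2 / 4))) := by
  set good : Set ((Fin n₁ → Bool) × (Fin n₁ → Bool)) := {h |
        ∑ i ∈ Finset.range n₁, a i (diffs h) * π.drift ε PX PY i (diffs h) ≤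
          2 * t * √(∑ i ∈ Finset.range n₁, a i (diffs h) ^ 2)}
  refine (measure_le_inter_add_sdiff _ _ good).trans (add_le_add (measure_mono
    Set.inter_subset_right) ?_)
  refine π.measure_le_exp hε0 hε n₁ m PX PY
    (fun i U => -(t / 2) * a i U / √(∑ i ∈ Finset.range n₁, a i U ^ 2))
    (ha.predictable n₁ _) n₁ le_rfl (t ^ 2 / 4) _ fun h hh => ?_
  obtain ⟨h1, h2⟩ := hh
  simp only [Set.mem_ofPred_eq, exceeds, not_lt, good, not_le] at h1 h2
  by_cases hA : 0 < √(∑ i ∈ Finset.range n₁, a i (diffs h) ^ 2)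
  · rw [π.exponent_normalized n₁ PX PY a _ _ hA]
    have : t / 2 * t ≤ -(t / 2) * (∑ i ∈ Finset.range n₁, a i (diffs h) * diffs h i -
        ∑ i ∈ Finset.range n₁, a i (diffs h) * π.drift ε PX PY i (diffs h)) /
        √(∑ i ∈ Finset.range n₁, a i (diffs h) ^ 2) := by
      rw [le_div_iff₀ hA, neg_mul, ← mul_neg, mul_assoc]
      gcongr
      linarith
    linarith [this]
  · rw [sum_weights_eq_zero n₁ hA] at h2
    have := Real.sqrt_nonneg (∑ i ∈ Finset.range n₁, a i (diffs h) ^ 2)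
    exact absurd h2 (not_lt.2 (by positivity))

/-- A policy and weights give a level-`α` test, whose type-II error is controlled by the
probability that the drift is small. -/
lemma exists_test {s r : ℝ} {n₂ : ℕ} {a : ℕ → (ℕ → ℝ) → ℝ} {m₁ : ℕ} (ha : IsStageWeight a m₁)
    {t α : ℝ} (ht : 0 < t) (hα : Real.exp (-(t ^ 2 / 4)) ≤ α) (inter : Bool)
    (hπ : inter = false → ∀ t x U U', π.u t x U = π.u t x U') :
    ∃ M ∈ mechanisms inter d n₁ n₂ ε, ∃ φ ∈ levelTests s r M α,
      ∀ f ∈ sobolevDensities s r d, ∀ g ∈ sobolevDensities s r d,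
        M.law (densityMeasure f) (densityMeasure g) {v | φ v = false} ≤
        π.bitLaw hε0 hε n₁ (n₂ - n₁) (densityMeasure f) (densityMeasure g) n₁ le_rfl {h |
          ∑ i ∈ Finset.range n₁, a i (diffs h) *
            π.drift ε (densityMeasure f) (densityMeasure g) i (diffs h) ≤
            2 * t * √(∑ i ∈ Finset.range n₁, a i (diffs h) ^ 2)} +
        ENNReal.ofReal (Real.exp (-(t ^ 2 / 4))) := by
  classical
  let M := π.mechanism hε0 hε n₁ (n₂ - n₁)
  let ψ : (Fin n₁ → Bool) × (Fin n₁ → Bool) → Bool := fun h => decide (exceeds a n₁ t (diffs h))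
  have hψ : Measurable ψ := Measurable.of_discrete
  let φ : M.Views → Bool := fun v => ψ (M.pairedViews v)
  have hφ : Measurable φ := hψ.comp M.measurable_pairedViews
  refine ⟨M, ⟨π.isLDP hε0 hε _ _, fun h => π.isNonInteractive hε0 hε _ _ (hπ h)⟩, φ,
    ⟨hφ, ?_⟩, fun f hf g hg => ?_⟩
  · refine iSup₂_le fun p hp => ?_
    obtain ⟨hf, hg, hfg⟩ := hp
    have := isProbabilityMeasure_densityMeasure hf
    have e : densityMeasure p.2 = densityMeasure p.1 :=
      withDensity_congr_ae (hfg.symm.mono fun x hx => by simp only [hx])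
    rw [e]
    have e2 : {v | φ v = true} = M.pairedViews ⁻¹' {h | exceeds a n₁ t (diffs h)} := by
      ext v; simp [φ, ψ]
    refine ((congrArg (M.law _ _) e2).trans (M.law_preimage_pairedViews _ _ (MeasurableSet.of_discrete
      (α := (Fin n₁ → Bool) × (Fin n₁ → Bool))))).trans_le ?_
    exact (π.measure_exceeds_le hε0 hε n₁ (n₂ - n₁) (densityMeasure p.1) ha ht).trans
      (ENNReal.ofReal_le_ofReal hα)
  · have := isProbabilityMeasure_densityMeasure hf
    have := isProbabilityMeasure_densityMeasure hg
    have e2 : {v | φ v = false} = M.pairedViews ⁻¹' {h | ¬ exceeds a n₁ t (diffs h)} := by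
      ext v; simp [φ, ψ]
    refine ((congrArg (M.law _ _) e2).trans (M.law_preimage_pairedViews _ _ (MeasurableSet.of_discrete
      (α := (Fin n₁ → Bool) × (Fin n₁ → Bool))))).trans_le ?_
    exact π.measure_not_exceeds_le hε0 hε n₁ (n₂ - n₁) _ _ ha ht

end

/-! ### Estimating a block of coefficients -/

lemma sum_range_mul_eq (F : ℕ → ℝ) (q N : ℕ) :
    ∑ i ∈ Finset.range (q * N), F i =
      ∑ k ∈ Finset.range N, ∑ j ∈ Finset.range q, F (j * N + k) := by
  rw [Finset.sum_comm]
  induction q with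
  | zero => simp
  | succ q ih => rw [add_mul, one_mul, Finset.sum_range_add, ih, Finset.sum_range_succ]

lemma mul_add_mod_of_lt' {j N k : ℕ} (hk : k < N) : (j * N + k) % N = k := by
  rw [mul_comm, Nat.mul_add_mod, Nat.mod_eq_of_lt hk]

/-- In the first `q * N` rounds the policy releases the basis functions `b 0, …, b (N - 1)`
cyclically. -/
def IsCyclic (π : Policy d) (b : ℕ → Fin d → ℕ) (N q : ℕ) : Prop :=
  ∀ i < q * N, ∀ x U, π.u i x U = trigProd (b (i % N)) x / √2 ^ d

/-- The sum of the differences released for the basis function `b k`. -/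
def blockSum (N q k : ℕ) (U : ℕ → ℝ) : ℝ := ∑ j ∈ Finset.range q, U (j * N + k)

lemma blockSum_congr {N q k : ℕ} (hk : k < N) {U U' : ℕ → ℝ} (h : ∀ i < q * N, U i = U' i) :
    blockSum N q k U = blockSum N q k U' := by
  refine Finset.sum_congr rfl fun j hj => h _ ?_
  have := Finset.mem_range.1 hj
  calc j * N + k < j * N + N := by omega
    _ = (j + 1) * N := by ring
    _ ≤ q * N := Nat.mul_le_mul_right _ this

section

variable (π : Policy d) {ε : ℝ} (hε0 : 0 < ε) (hε : ε ≤ 1) (n₁ m : ℕ)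
  {b : ℕ → Fin d → ℕ} {N q : ℕ}

/-- The difference of the coefficients of two densities. -/
def gap (b : ℕ → Fin d → ℕ) (f g : Cube d → ℝ) (k : ℕ) : ℝ := coeff f (b k) - coeff g (b k)

lemma integral_trigProd_densityMeasure {s r : ℝ} {f : Cube d → ℝ} (hf : f ∈ sobolevDensities s r d)
    (l : Fin d → ℕ) : ∫ x, trigProd l x ∂(densityMeasure f) = coeff f l :=
  integral_densityMeasure hf _

lemma drift_of_isCyclic (hπ : IsCyclic π b N q) {s r : ℝ} {f g : Cube d → ℝ}
    (hf : f ∈ sobolevDensities s r d) (hg : g ∈ sobolevDensities s r d) {i : ℕ} (hi : i < q * N)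
    (U : ℕ → ℝ) : π.drift ε (densityMeasure f) (densityMeasure g) i U =
      ε / (4 * √2 ^ d) * gap b f g (i % N) := by
  unfold Policy.drift gap
  simp_rw [hπ i hi, integral_div, integral_trigProd_densityMeasure hf,
    integral_trigProd_densityMeasure hg]
  field_simp

/-- The centered block sums. -/
def noise (ε : ℝ) (b : ℕ → Fin d → ℕ) (N q : ℕ) (f g : Cube d → ℝ) (k : ℕ) (U : ℕ → ℝ) : ℝ :=
  blockSum N q k U - q * (ε / (4 * √2 ^ d)) * gap b f g k

/-- With weights that depend only on the residue of the round, the supermartingale becomes a linear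
form in the noise vector with compensator q‖w‖². The vector of block noises is thus sub-Gaussian
with variance proxy 2q in every direction, although the rounds may depend on each other. -/
lemma exponent_of_isCyclic (hπ : IsCyclic π b N q) {s r : ℝ} {f g : Cube d → ℝ}
    (hf : f ∈ sobolevDensities s r d) (hg : g ∈ sobolevDensities s r d)
    (hn : q * N ≤ n₁) (w : ℕ → ℝ) (U : ℕ → ℝ) :
    π.exponent ε (densityMeasure f) (densityMeasure g)
      (fun i _ => if i < q * N then w (i % N) else 0) n₁ U =
      ∑ k ∈ Finset.range N, w k * noise ε b N q f g k U - q * ∑ k ∈ Finset.range N, w k ^ 2 := by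
  unfold Policy.exponent
  rw [← Finset.sum_range_add_sum_Ico _ hn, add_eq_left.2]
  · rw [Finset.sum_congr rfl (g := fun i => w (i % N) * (U i -
      ε / (4 * √2 ^ d) * gap b f g (i % N)) - w (i % N) ^ 2) fun i hi => by
        have hi := Finset.mem_range.1 hi
        simp only [if_pos hi]
        rw [drift_of_isCyclic π hπ hf hg hi]]
    rw [sum_range_mul_eq, Finset.mul_sum, ← Finset.sum_sub_distrib]
    refine Finset.sum_congr rfl fun k hk => ?_
    simp_rw [mul_add_mod_of_lt' (Finset.mem_range.1 hk)]
    rw [Finset.sum_sub_distrib, ← Finset.mul_sum, Finset.sum_sub_distrib, noise, blockSum]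
    simp only [Finset.sum_const, Finset.card_range, nsmul_eq_mul]; ring
  · refine Finset.sum_eq_zero fun i hi => ?_
    have := (Finset.mem_Ico.1 hi).1
    simp only [if_neg (not_lt.2 this)]; ring

lemma lintegral_exp_noise_le (hπ : IsCyclic π b N q) {s r : ℝ} {f g : Cube d → ℝ}
    (hf : f ∈ sobolevDensities s r d) (hg : g ∈ sobolevDensities s r d)
    (hn : q * N ≤ n₁) (w : ℕ → ℝ) :
    ∫⁻ h, ENNReal.ofReal (Real.exp (∑ k ∈ Finset.range N, w k * noise ε b N q f g k (diffs h) -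
        q * ∑ k ∈ Finset.range N, w k ^ 2))
      ∂(π.bitLaw hε0 hε n₁ m (densityMeasure f) (densityMeasure g) n₁ le_rfl) ≤ 1 := by
  have := isProbabilityMeasure_densityMeasure hf
  have := isProbabilityMeasure_densityMeasure hg
  have h := π.lintegral_exp_exponent_le hε0 hε n₁ m (densityMeasure f) (densityMeasure g)
    (fun i _ => if i < q * N then w (i % N) else 0) (fun _ _ _ _ => rfl) n₁ le_rfl
  simp_rw [exponent_of_isCyclic π n₁ hπ hf hg hn w] at h
  exact h

lemma measure_noise_le (hπ : IsCyclic π b N q) {s r : ℝ} {f g : Cube d → ℝ}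
    (hf : f ∈ sobolevDensities s r d) (hg : g ∈ sobolevDensities s r d)
    (hn : q * N ≤ n₁) (w : ℕ → ℝ) (v : ℝ) (S : Set ((Fin n₁ → Bool) × (Fin n₁ → Bool)))
    (hS : ∀ h ∈ S, v ≤ ∑ k ∈ Finset.range N, w k * noise ε b N q f g k (diffs h) -
        q * ∑ k ∈ Finset.range N, w k ^ 2) :
    π.bitLaw hε0 hε n₁ m (densityMeasure f) (densityMeasure g) n₁ le_rfl S ≤
      ENNReal.ofReal (Real.exp (-v)) := by
  have := isProbabilityMeasure_densityMeasure hf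
  have := isProbabilityMeasure_densityMeasure hg
  refine π.measure_le_exp hε0 hε n₁ m (densityMeasure f) (densityMeasure g)
    (fun i _ => if i < q * N then w (i % N) else 0) (fun _ _ _ _ => rfl) n₁ le_rfl v S
    fun h hh => ?_
  rw [exponent_of_isCyclic π n₁ hπ hf hg hn w]
  exact hS h hh

/-- The signal is not cancelled by the noise. -/
lemma measure_inner_noise_le (hπ : IsCyclic π b N q) {s r : ℝ} {f g : Cube d → ℝ}
    (hf : f ∈ sobolevDensities s r d) (hg : g ∈ sobolevDensities s r d)
    (hn : q * N ≤ n₁) (hq : 0 < q) {t : ℝ} (ht : 0 < t)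
    (hδ : 0 < √(∑ k ∈ Finset.range N, gap b f g k ^ 2)) :
    π.bitLaw hε0 hε n₁ m (densityMeasure f) (densityMeasure g) n₁ le_rfl
      {h | ∑ k ∈ Finset.range N, gap b f g k * noise ε b N q f g k (diffs h) ≤
        -(t * √q * √(∑ k ∈ Finset.range N, gap b f g k ^ 2))} ≤
      ENNReal.ofReal (Real.exp (-(t ^ 2 / 4))) := by
  set D := √(∑ k ∈ Finset.range N, gap b f g k ^ 2) with hD
  have hq' : (0 : ℝ) < √q := Real.sqrt_pos.2 (by exact_mod_cast hq)
  have hq2 : (q : ℝ) = √q ^ 2 := (Real.sq_sqrt (by positivity)).symm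
  have hD2 : ∑ k ∈ Finset.range N, gap b f g k ^ 2 = D ^ 2 :=
    (Real.sq_sqrt (Finset.sum_nonneg fun _ _ => sq_nonneg _)).symm
  -- The maximizer of λ·t√q·D − qλ²D², with maximum t²/4.
  set lam := t / (2 * √q * D) with hlam
  refine measure_noise_le π hε0 hε n₁ m hπ hf hg hn (fun k => -lam * gap b f g k) _ _
    fun h hh => ?_
  simp only [Set.mem_ofPred_eq] at hh
  have e1 : ∑ k ∈ Finset.range N, -lam * gap b f g k * noise ε b N q f g k (diffs h) =
      lam * -(∑ k ∈ Finset.range N, gap b f g k * noise ε b N q f g k (diffs h)) := by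
    rw [← Finset.sum_neg_distrib, Finset.mul_sum]
    exact Finset.sum_congr rfl fun k _ => by ring
  have e2 : ∑ k ∈ Finset.range N, (-lam * gap b f g k) ^ 2 = lam ^ 2 * D ^ 2 := by
    rw [← hD2, Finset.mul_sum]
    exact Finset.sum_congr rfl fun k _ => by ring
  rw [e1, e2]
  have hl : 0 < lam := by positivity
  have h1 : lam * (t * √q * D) ≤
      lam * -(∑ k ∈ Finset.range N, gap b f g k * noise ε b N q f g k (diffs h)) := by
    gcongr; linarith
  have h2 : lam * (t * √q * D) = t ^ 2 / 2 := by rw [hlam]; field_simp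
  have h3 : (q : ℝ) * (lam ^ 2 * D ^ 2) = t ^ 2 / 4 := by
    rw [hq2, hlam]; field_simp; ring
  linarith

end

end LDPTwoSample

end

noncomputable section

namespace LDPTwoSample

/-! ### Size of the noise -/

/-- By the power mean inequality, the p-th power of the mean of y² is at most the mean of y^{2p},
which is at most (2p)! times the mean of e^{|y|}. Taking `p` logarithmic in the error probability
turns exponential moments of single coordinates into a bound on the Euclidean norm, without
independence of the coordinates. -/
lemma sum_sq_le_of_sum_exp_le (N p : ℕ) (hN : 0 < N) (hp : 0 < p) (y : ℕ → ℝ)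
    (h : ∑ k ∈ Finset.range N, (Real.exp (y k) + Real.exp (-y k)) ≤ N * Real.exp p) :
    ∑ k ∈ Finset.range N, y k ^ 2 ≤ N * (4 * p) ^ 2 := by
  have hN' : (0 : ℝ) < N := by exact_mod_cast hN
  have hp' : (0 : ℝ) < p := by exact_mod_cast hp
  have h1 := Real.pow_arith_mean_le_arith_mean_pow (Finset.range N) (fun _ => (N : ℝ)⁻¹)
    (fun k => y k ^ 2) (fun _ _ => by positivity) (by simp [hN'.ne']) (fun _ _ => sq_nonneg _) p
  rw [← Finset.mul_sum, ← Finset.mul_sum] at h1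
  have h2 (k : ℕ) : (y k ^ 2) ^ p ≤ (2 * p) ^ (2 * p) * (Real.exp (y k) + Real.exp (-y k)) := by
    have e1 := Real.pow_div_factorial_le_exp |y k| (abs_nonneg _) (2 * p)
    have e2 : Real.exp |y k| ≤ Real.exp (y k) + Real.exp (-y k) := by
      rcases abs_cases (y k) with ⟨h, -⟩ | ⟨h, -⟩ <;> rw [h] <;>
        linarith [Real.exp_pos (y k), Real.exp_pos (-y k)]
    have e3 : ((2 * p).factorial : ℝ) ≤ (2 * p) ^ (2 * p) := by
      exact_mod_cast Nat.factorial_le_pow (2 * p)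
    rw [div_le_iff₀ (by positivity)] at e1
    calc (y k ^ 2) ^ p = |y k| ^ (2 * p) := by rw [pow_mul, sq_abs]
      _ ≤ Real.exp |y k| * (2 * p).factorial := e1
      _ ≤ (Real.exp (y k) + Real.exp (-y k)) * (2 * p) ^ (2 * p) := by gcongr
      _ = _ := by ring
  have h3 : ((N : ℝ)⁻¹ * ∑ k ∈ Finset.range N, y k ^ 2) ^ p ≤ ((4 * p) ^ 2) ^ p := by
    calc _ ≤ (N : ℝ)⁻¹ * ∑ k ∈ Finset.range N, (y k ^ 2) ^ p := h1
      _ ≤ (N : ℝ)⁻¹ * ∑ k ∈ Finset.range N,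
            ((2 * p) ^ (2 * p) * (Real.exp (y k) + Real.exp (-y k))) := by
          gcongr with k; exact h2 k
      _ ≤ (N : ℝ)⁻¹ * ((2 * p) ^ (2 * p) * (N * Real.exp p)) := by
          rw [← Finset.mul_sum]; gcongr
      _ = ((2 * p) ^ 2 * Real.exp 1) ^ p := by
          rw [mul_pow _ (Real.exp 1), ← pow_mul, ← Real.exp_nat_mul, mul_one]; field_simp
      _ ≤ ((4 * p) ^ 2) ^ p := by
          gcongr
          nlinarith [Real.exp_one_lt_d9, sq_nonneg (p : ℝ)]
  have h4 := (pow_le_pow_iff_left₀ (by positivity) (by positivity) hp.ne').1 h3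
  rwa [inv_mul_le_iff₀ hN'] at h4

variable {d : ℕ}

section

variable (π : Policy d) {ε : ℝ} (hε0 : 0 < ε) (hε : ε ≤ 1) (n₁ m : ℕ)
  {b : ℕ → Fin d → ℕ} {N q : ℕ}

/-- A single weight ±1/√q has compensator 1, hence the bound e. -/
lemma lintegral_exp_single_noise_le (hπ : IsCyclic π b N q) {s r : ℝ} {f g : Cube d → ℝ}
    (hf : f ∈ sobolevDensities s r d) (hg : g ∈ sobolevDensities s r d)
    (hn : q * N ≤ n₁) (hq : 0 < q) {k : ℕ} (hk : k < N) (σ : ℝ) (hσ : σ ^ 2 = 1) :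
    ∫⁻ h, ENNReal.ofReal (Real.exp (σ * (noise ε b N q f g k (diffs h) / √q)))
      ∂(π.bitLaw hε0 hε n₁ m (densityMeasure f) (densityMeasure g) n₁ le_rfl) ≤
      ENNReal.ofReal (Real.exp 1) := by
  have hq' : (0 : ℝ) < √q := Real.sqrt_pos.2 (by exact_mod_cast hq)
  have hq2 : √(q : ℝ) ^ 2 = q := Real.sq_sqrt (by positivity)
  have h := lintegral_exp_noise_le π hε0 hε n₁ m hπ hf hg hn
    (fun j => if j = k then σ / √q else 0)
  have e (h : (Fin n₁ → Bool) × (Fin n₁ → Bool)) :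
      ∑ j ∈ Finset.range N, (if j = k then σ / √q else 0) * noise ε b N q f g j (diffs h) -
        q * ∑ j ∈ Finset.range N, (if j = k then σ / √q else 0) ^ 2 =
      σ * (noise ε b N q f g k (diffs h) / √q) + -1 := by
    have : ∀ j, (if j = k then σ / √q else 0) ^ 2 = if j = k then 1 / (q : ℝ) else 0 := fun j => by
      split_ifs
      · rw [div_pow, hσ, hq2]
      · simp
    simp_rw [this, ite_mul, zero_mul]
    rw [Finset.sum_ite_eq', Finset.sum_ite_eq', if_pos (Finset.mem_range.2 hk)]
    rw [if_pos (Finset.mem_range.2 hk)]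
    have : (q : ℝ) ≠ 0 := by positivity
    field_simp
    ring
  simp_rw [e, Real.exp_add, ENNReal.ofReal_mul (Real.exp_pos _).le] at h
  rw [lintegral_mul_const _ Measurable.of_discrete, Real.exp_neg,
    ENNReal.ofReal_inv_of_pos (Real.exp_pos _)] at h
  rw [← ENNReal.le_inv_iff_mul_le, inv_inv] at h
  exact h

/-- The noise has Euclidean norm of order `√(q N)`. -/
lemma measure_norm_noise_le (hπ : IsCyclic π b N q) {s r : ℝ} {f g : Cube d → ℝ}
    (hf : f ∈ sobolevDensities s r d) (hg : g ∈ sobolevDensities s r d)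
    (hn : q * N ≤ n₁) (hq : 0 < q) (hN : 0 < N) {p : ℕ} (hp : 0 < p) {γ : ℝ} (hγ : 0 < γ)
    (hpγ : 2 * Real.exp 1 / γ ≤ Real.exp p) :
    π.bitLaw hε0 hε n₁ m (densityMeasure f) (densityMeasure g) n₁ le_rfl
      {h | q * N * (4 * p) ^ 2 < ∑ k ∈ Finset.range N, noise ε b N q f g k (diffs h) ^ 2} ≤
      ENNReal.ofReal γ := by
  set P := π.bitLaw hε0 hε n₁ m (densityMeasure f) (densityMeasure g) n₁ le_rfl
  have hq' : (0 : ℝ) < q := by exact_mod_cast hq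
  have hN' : (0 : ℝ) < N := by exact_mod_cast hN
  have hq2 : √(q : ℝ) ^ 2 = q := Real.sq_sqrt (by positivity)
  set y : ℕ → (Fin n₁ → Bool) × (Fin n₁ → Bool) → ℝ :=
    fun k h => noise ε b N q f g k (diffs h) / √q with hy
  set S : Set ((Fin n₁ → Bool) × (Fin n₁ → Bool)) :=
    {h | q * N * (4 * p) ^ 2 < ∑ k ∈ Finset.range N, noise ε b N q f g k (diffs h) ^ 2}
  have h1 : ∫⁻ h, ENNReal.ofReal (∑ k ∈ Finset.range N, (Real.exp (y k h) + Real.exp (-y k h))) ∂P ≤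
      ENNReal.ofReal (N * (2 * Real.exp 1)) := by
    calc _ = ∑ k ∈ Finset.range N, (∫⁻ h, ENNReal.ofReal (Real.exp (1 * y k h)) ∂P +
          ∫⁻ h, ENNReal.ofReal (Real.exp ((-1) * y k h)) ∂P) := by
          rw [← lintegral_congr fun h => (ENNReal.ofReal_sum_of_nonneg fun k _ => by positivity).symm,
            lintegral_finsetSum _ fun _ _ => Measurable.of_discrete]
          refine Finset.sum_congr rfl fun k _ => ?_
          rw [← lintegral_add_left Measurable.of_discrete]
          refine lintegral_congr fun h => ?_
          rw [one_mul, neg_one_mul, ← ENNReal.ofReal_add (by positivity) (by positivity)]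
      _ ≤ ∑ k ∈ Finset.range N, (ENNReal.ofReal (Real.exp 1) + ENNReal.ofReal (Real.exp 1)) := by
          gcongr with k hk
          · exact lintegral_exp_single_noise_le π hε0 hε n₁ m hπ hf hg hn hq
              (Finset.mem_range.1 hk) 1 (by norm_num)
          · exact lintegral_exp_single_noise_le π hε0 hε n₁ m hπ hf hg hn hq
              (Finset.mem_range.1 hk) (-1) (by norm_num)
      _ = _ := by
          rw [← ENNReal.ofReal_add (by positivity) (by positivity),
            ← ENNReal.ofReal_sum_of_nonneg fun _ _ => by positivity]
          congr 1; simp; ring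
  -- Markov's inequality for ∑ (e^{y_k} + e^{-y_k}): its mean is at most 2eN, and on `S` it exceeds
  -- N·e^p by `sum_sq_le_of_sum_exp_le`.
  have h2 : ENNReal.ofReal (N * Real.exp p) * P S ≤ ENNReal.ofReal (N * (2 * Real.exp 1)) := by
    refine le_trans ?_ h1
    rw [← setLIntegral_const]
    refine (setLIntegral_mono Measurable.of_discrete fun h hh => ?_).trans
      (setLIntegral_le_lintegral S _)
    refine ENNReal.ofReal_le_ofReal ?_
    by_contra hlt
    have := sum_sq_le_of_sum_exp_le N p hN hp (fun k => y k h) (not_le.1 hlt).le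
    simp only [hy, div_pow, hq2, ← Finset.sum_div] at this
    rw [div_le_iff₀ hq'] at this
    have hh' : q * N * (4 * p) ^ 2 < ∑ k ∈ Finset.range N, noise ε b N q f g k (diffs h) ^ 2 := hh
    linarith
  have h3 : ENNReal.ofReal (N * (2 * Real.exp 1)) ≤
      ENNReal.ofReal (N * Real.exp p) * ENNReal.ofReal γ := by
    rw [← ENNReal.ofReal_mul (by positivity)]
    refine ENNReal.ofReal_le_ofReal ?_
    rw [div_le_iff₀ hγ] at hpγ
    rw [mul_assoc]; gcongr
  have h4 : ENNReal.ofReal (N * Real.exp p) ≠ 0 := by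
    rw [Ne, ENNReal.ofReal_eq_zero, not_le]; positivity
  exact (ENNReal.mul_le_mul_iff_right h4 ENNReal.ofReal_ne_top).1 (h2.trans h3)

/-- The noise polynomial is small on a finite set of points. -/
lemma measure_grid_noise_le (hπ : IsCyclic π b N q) {s r : ℝ} {f g : Cube d → ℝ}
    (hf : f ∈ sobolevDensities s r d) (hg : g ∈ sobolevDensities s r d)
    (hn : q * N ≤ n₁) (hq : 0 < q) (hN : 0 < N) {κ : Type} [Fintype κ] (y : κ → Cube d) (v : ℝ) :
    π.bitLaw hε0 hε n₁ m (densityMeasure f) (densityMeasure g) n₁ le_rfl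
      {h | ∃ i, √2 ^ d * √(q * N) * v <
        |∑ k ∈ Finset.range N, noise ε b N q f g k (diffs h) * trigProd (b k) (y i)|} ≤
      ENNReal.ofReal (Fintype.card κ * (2 * Real.exp (1 - v))) := by
  set P := π.bitLaw hε0 hε n₁ m (densityMeasure f) (densityMeasure g) n₁ le_rfl
  have hq' : (0 : ℝ) < q := by exact_mod_cast hq
  have hN' : (0 : ℝ) < N := by exact_mod_cast hN
  -- Chosen so that the weights ±φ_k(y)/T have compensator at most 1, since φ_k² ≤ 2^d.
  set T := √2 ^ d * √(q * N) with hT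
  have hT0 : 0 < T := by positivity
  have hT2 : T ^ 2 = 2 ^ d * (q * N) := by
    rw [hT, mul_pow, Real.sq_sqrt (by positivity), ← pow_mul, mul_comm d, pow_mul,
      Real.sq_sqrt (by norm_num)]
  have key (i : κ) (σ : ℝ) (hσ : σ ^ 2 = 1) : P {h | T * v < σ *
      ∑ k ∈ Finset.range N, noise ε b N q f g k (diffs h) * trigProd (b k) (y i)} ≤
      ENNReal.ofReal (Real.exp (1 - v)) := by
    have := measure_noise_le π hε0 hε n₁ m hπ hf hg hn
      (fun k => σ / T * trigProd (b k) (y i)) (v - 1) {h | T * v < σ *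
        ∑ k ∈ Finset.range N, noise ε b N q f g k (diffs h) * trigProd (b k) (y i)}
      fun h hh => by
        have e1 : ∑ k ∈ Finset.range N, σ / T * trigProd (b k) (y i) *
            noise ε b N q f g k (diffs h) = (σ * ∑ k ∈ Finset.range N,
              noise ε b N q f g k (diffs h) * trigProd (b k) (y i)) / T := by
          rw [Finset.mul_sum, Finset.sum_div]
          exact Finset.sum_congr rfl fun k _ => by ring
        have e2 : (q : ℝ) * ∑ k ∈ Finset.range N, (σ / T * trigProd (b k) (y i)) ^ 2 ≤ 1 := by
          have : ∑ k ∈ Finset.range N, (σ / T * trigProd (b k) (y i)) ^ 2 ≤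
              ∑ k ∈ Finset.range N, (1 / T ^ 2 * 2 ^ d) := by
            refine Finset.sum_le_sum fun k _ => ?_
            rw [mul_pow, div_pow, hσ]
            gcongr
            exact trigProd_sq_le _ _
          calc _ ≤ (q : ℝ) * ∑ k ∈ Finset.range N, (1 / T ^ 2 * 2 ^ d) := by gcongr
            _ = 1 := by
              rw [hT2]; simp only [Finset.sum_const, Finset.card_range, nsmul_eq_mul]
              field_simp
        rw [e1]
        have e3 : v ≤ (σ * ∑ k ∈ Finset.range N,
              noise ε b N q f g k (diffs h) * trigProd (b k) (y i)) / T := by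
          rw [le_div_iff₀ hT0, mul_comm]; exact (show _ < _ from hh).le
        linarith
    rwa [neg_sub] at this
  calc P {h | ∃ i, T * v <
        |∑ k ∈ Finset.range N, noise ε b N q f g k (diffs h) * trigProd (b k) (y i)|}
      ≤ P (⋃ i, ({h | T * v < 1 *
          ∑ k ∈ Finset.range N, noise ε b N q f g k (diffs h) * trigProd (b k) (y i)} ∪
          {h | T * v < (-1) *
          ∑ k ∈ Finset.range N, noise ε b N q f g k (diffs h) * trigProd (b k) (y i)})) := by
        refine measure_mono fun h hh => ?_
        obtain ⟨i, hi⟩ := hh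
        refine Set.mem_iUnion.2 ⟨i, ?_⟩
        rcases lt_abs.1 hi with h | h
        · exact Or.inl (by simpa using h)
        · exact Or.inr (by simpa using h)
    _ ≤ ∑ i, P ({h | T * v < 1 *
          ∑ k ∈ Finset.range N, noise ε b N q f g k (diffs h) * trigProd (b k) (y i)} ∪
          {h | T * v < (-1) *
          ∑ k ∈ Finset.range N, noise ε b N q f g k (diffs h) * trigProd (b k) (y i)}) :=
        measure_iUnion_fintype_le _ _
    _ ≤ ∑ _i : κ, (ENNReal.ofReal (Real.exp (1 - v)) + ENNReal.ofReal (Real.exp (1 - v))) := by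
        refine Finset.sum_le_sum fun i _ => (measure_union_le _ _).trans ?_
        gcongr
        · exact key i 1 (by norm_num)
        · exact key i (-1) (by norm_num)
    _ = _ := by
        rw [← ENNReal.ofReal_add (by positivity) (by positivity),
          ← ENNReal.ofReal_sum_of_nonneg fun _ _ => by positivity]
        congr 1; simp; ring

end

lemma abs_diffs_le {t : ℕ} (h : (Fin t → Bool) × (Fin t → Bool)) (i : ℕ) : |diffs h i| ≤ 2 := by
  unfold diffs
  split_ifs with hi
  · cases h.1 ⟨i, hi⟩ <;> cases h.2 ⟨i, hi⟩ <;> norm_num [bitSign]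
  · simp

lemma abs_coeff_le {s r : ℝ} {f : Cube d → ℝ} (hf : f ∈ sobolevDensities s r d)
    (l : Fin d → ℕ) : |coeff f l| ≤ √2 ^ d := by
  have := isProbabilityMeasure_densityMeasure hf
  rw [← integral_trigProd_densityMeasure hf]
  have := norm_integral_le_of_norm_le_const (μ := densityMeasure f) (f := trigProd l)
    (C := √2 ^ d) (Filter.Eventually.of_forall fun x => abs_trigProd_le l x)
  simpa using this

/-- A deterministic bound, needed only for the discretization error of the noise polynomial: block
sums are at most 2q, and coefficients of a density at most √2^d. -/
lemma abs_noise_le {ε : ℝ} (hε0 : 0 < ε) (hε : ε ≤ 1) {s r : ℝ} {f g : Cube d → ℝ}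
    (hf : f ∈ sobolevDensities s r d) (hg : g ∈ sobolevDensities s r d) (b : ℕ → Fin d → ℕ)
    (N q k : ℕ) {t : ℕ} (h : (Fin t → Bool) × (Fin t → Bool)) :
    |noise ε b N q f g k (diffs h)| ≤ 3 * q := by
  have h1 : |blockSum N q k (diffs h)| ≤ 2 * q := by
    refine (Finset.abs_sum_le_sum_abs _ _).trans ?_
    refine (Finset.sum_le_sum fun j _ => abs_diffs_le h _).trans ?_
    simp [mul_comm]
  have h2 : |gap b f g k| ≤ 2 * √2 ^ d := by
    unfold gap
    have := abs_sub (coeff f (b k)) (coeff g (b k))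
    linarith [abs_coeff_le hf (b k), abs_coeff_le hg (b k)]
  have h3 : |q * (ε / (4 * √2 ^ d)) * gap b f g k| ≤ q := by
    rw [abs_mul, abs_of_nonneg (by positivity)]
    calc _ ≤ q * (ε / (4 * √2 ^ d)) * (2 * √2 ^ d) := by gcongr
      _ = q * (ε / 2) := by field_simp; ring
      _ ≤ q * 1 := by gcongr; linarith
      _ = q := mul_one _
  unfold noise
  have := abs_sub (blockSum N q k (diffs h)) (q * (ε / (4 * √2 ^ d)) * gap b f g k)
  linarith

end LDPTwoSample

end

noncomputable section

namespace LDPTwoSample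

/-! ### The non-interactive test -/

variable {d : ℕ}

lemma card_box (d L : ℕ) : (box d L).card = L ^ d := by simp [box]

lemma exists_enumeration (d L : ℕ) : ∃ b : ℕ → Fin d → ℕ, (∀ k < L ^ d, b k ∈ box d L) ∧
    ∀ F : (Fin d → ℕ) → ℝ, ∑ k ∈ Finset.range (L ^ d), F (b k) = ∑ l ∈ box d L, F l := by
  classical
  have e := (box d L).equivFinOfCardEq (card_box d L)
  refine ⟨fun k => if h : k < L ^ d then (e.symm ⟨k, h⟩ : Fin d → ℕ) else 0, fun k hk => ?_,
    fun F => ?_⟩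
  · simp only [dif_pos hk]; exact (e.symm ⟨k, hk⟩).2
  · rw [Finset.sum_range, ← Finset.sum_coe_sort (box d L), ← e.symm.sum_comp]
    exact Finset.sum_congr rfl fun k _ => by simp

lemma sum_window (q N n : ℕ) (hn : 2 * (q * N) ≤ n) (F : ℕ → ℝ) :
    ∑ i ∈ Finset.range n, (if q * N ≤ i ∧ i < 2 * (q * N) then F i else 0) =
      ∑ k ∈ Finset.range N, ∑ j ∈ Finset.range q, F (q * N + (j * N + k)) := by
  rw [← sum_range_mul_eq (fun i => F (q * N + i))]
  have h1 := Finset.sum_range_add_sum_Ico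
    (fun i => if q * N ≤ i ∧ i < 2 * (q * N) then F i else 0) hn
  have h2 : ∑ i ∈ Finset.Ico (2 * (q * N)) n,
      (if q * N ≤ i ∧ i < 2 * (q * N) then F i else 0) = 0 :=
    Finset.sum_eq_zero fun i hi => if_neg fun h => by
      have := (Finset.mem_Ico.1 hi).1; omega
  rw [← h1, h2, add_zero, two_mul, Finset.sum_range_add, Finset.sum_eq_zero fun i hi => if_neg fun h => by
    have := Finset.mem_range.1 hi; omega, zero_add]
  refine Finset.sum_congr rfl fun i hi => if_pos ?_
  have := Finset.mem_range.1 hi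
  omega

lemma window_mod {q N j k : ℕ} (hk : k < N) : (q * N + (j * N + k)) % N = k := by
  rw [← add_assoc, ← add_mul, mul_add_mod_of_lt' hk]

/-- The policy that cycles through the basis functions `b 0, …, b (N - 1)`. -/
def cyclicPolicy (b : ℕ → Fin d → ℕ) (N : ℕ) : Policy d where
  u i x _ := trigProd (b (i % N)) x / √2 ^ d
  measurable t _ := (measurable_trigProd _).div_const _
  abs_le_one t x _ := by
    rw [abs_div, abs_of_nonneg (show (0 : ℝ) ≤ √2 ^ d by positivity)]
    exact div_le_one_of_le₀ (abs_trigProd_le _ _) (by positivity)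
  predictable _ _ _ _ _ := rfl

lemma sum_gap_mul_blockSum (ε : ℝ) (b : ℕ → Fin d → ℕ) (N q : ℕ) (f g : Cube d → ℝ) (U : ℕ → ℝ) :
    ∑ k ∈ Finset.range N, gap b f g k * blockSum N q k U =
      q * (ε / (4 * √2 ^ d)) * ∑ k ∈ Finset.range N, gap b f g k ^ 2 +
      ∑ k ∈ Finset.range N, gap b f g k * noise ε b N q f g k U := by
  rw [Finset.mul_sum, ← Finset.sum_add_distrib]
  exact Finset.sum_congr rfl fun k _ => by unfold noise; ring

/-- The Minkowski inequality for finite sums of squares. -/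
lemma sqrt_sum_add_sq_le {ι : Type*} (s : Finset ι) (u v : ι → ℝ) :
    √(∑ i ∈ s, (u i + v i) ^ 2) ≤ √(∑ i ∈ s, u i ^ 2) + √(∑ i ∈ s, v i ^ 2) := by
  have hu : 0 ≤ ∑ i ∈ s, u i ^ 2 := Finset.sum_nonneg fun _ _ => sq_nonneg _
  have hv : 0 ≤ ∑ i ∈ s, v i ^ 2 := Finset.sum_nonneg fun _ _ => sq_nonneg _
  rw [Real.sqrt_le_left (by positivity), add_sq, Real.sq_sqrt hu, Real.sq_sqrt hv]
  have hcs := Real.sum_mul_le_sqrt_mul_sqrt s u v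
  have : ∑ i ∈ s, (u i + v i) ^ 2 = ∑ i ∈ s, u i ^ 2 + 2 * ∑ i ∈ s, u i * v i +
      ∑ i ∈ s, v i ^ 2 := by
    rw [Finset.mul_sum, ← Finset.sum_add_distrib, ← Finset.sum_add_distrib]
    exact Finset.sum_congr rfl fun i _ => by ring
  linarith

/-- The numerical condition for detection. -/
lemma lt_of_signal {x t R : ℝ} (ht : 0 < t) (hR : 0 ≤ R) (hx0 : 0 ≤ x)
    (hx : 64 * t ^ 2 + 8 * t * R ≤ x ^ 2) : 8 * t ≤ x ∧ 2 * t * (x + R) < x ^ 2 / 2 := by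
  have h8 : 8 * t ≤ x := by
    refine abs_le_of_sq_le_sq' ?_ hx0 |>.2
    nlinarith [mul_nonneg ht.le hR]
  refine ⟨h8, ?_⟩
  -- From x ≥ 8t, 2tx ≤ x²/4; from the hypothesis, 2tR ≤ x²/4 − 16t².
  nlinarith [mul_nonneg ht.le hR, mul_pos ht ht]

/-- Both stages cycle through the same N = L^d basis functions, and the statistic correlates the two
estimates of the coefficient vector. The first-stage noise vector has norm about √(qN), which
produces the term √(L^d)·4p in the detection condition; `p` is logarithmic in 1/β. -/
lemma exists_noninteractive_test {s r ε : ℝ} (hε0 : 0 < ε) (hε : ε ≤ 1) (n₁ n₂ L q p : ℕ)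
    (hL : 0 < L) (hq : 0 < q) (hp : 0 < p) (hn : 2 * (q * L ^ d) ≤ n₁) {α β t : ℝ} (hβ : 0 < β)
    (ht : 0 < t) (htα : Real.exp (-(t ^ 2 / 4)) ≤ α) (htβ : Real.exp (-(t ^ 2 / 4)) ≤ β / 4)
    (hpβ : 4 * Real.exp 1 / β ≤ Real.exp p) :
    ∃ M ∈ mechanisms false d n₁ n₂ ε, ∃ φ ∈ levelTests s r M α,
      ∀ f ∈ sobolevDensities s r d, ∀ g ∈ sobolevDensities s r d,
        64 * t ^ 2 + 8 * t * (√((L : ℝ) ^ d) * (4 * p)) ≤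
          q * ε ^ 2 / (16 * 2 ^ d) * ∑ l ∈ box d L, (coeff f l - coeff g l) ^ 2 →
        M.law (densityMeasure f) (densityMeasure g) {v | φ v = false} ≤ ENNReal.ofReal β := by
  obtain ⟨b, -, hbsum⟩ := exists_enumeration d L
  set N := L ^ d with hNdef
  have hN : 0 < N := by positivity
  set π : Policy d := cyclicPolicy b N with hπdef
  -- The first-stage estimate enters through the weights of the test and not through the channels,
  -- so the mechanism stays non-interactive.
  set a : ℕ → (ℕ → ℝ) → ℝ := fun i U =>
    if q * N ≤ i ∧ i < 2 * (q * N) then blockSum N q (i % N) U else 0 with hadef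
  have ha : IsStageWeight a (q * N) := by
    refine ⟨fun i hi U => if_neg fun h => by omega, fun i U U' h => ?_⟩
    simp only [hadef, blockSum_congr (Nat.mod_lt i hN) h]
  obtain ⟨M, hM, φ, hφ, hbound⟩ := exists_test (s := s) (r := r) π hε0 hε n₁ (n₂ := n₂) ha ht htα
    false (fun _ _ _ _ _ => rfl)
  refine ⟨M, hM, φ, hφ, fun f hf g hg hsig => (hbound f hf g hg).trans ?_⟩
  have hcyc (q' : ℕ) : IsCyclic π b N q' := fun i _ x U => rfl
  set P := π.bitLaw hε0 hε n₁ (n₂ - n₁) (densityMeasure f) (densityMeasure g) n₁ le_rfl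
  have hq' : (0 : ℝ) < q := by exact_mod_cast hq
  set Δ := ∑ k ∈ Finset.range N, gap b f g k ^ 2 with hΔ
  have hΔbox : ∑ l ∈ box d L, (coeff f l - coeff g l) ^ 2 = Δ :=
    (hbsum fun l => (coeff f l - coeff g l) ^ 2).symm
  have hΔ0 : 0 ≤ Δ := Finset.sum_nonneg fun _ _ => sq_nonneg _
  set κ := ε / (4 * √2 ^ d) with hκ
  have hκ0 : 0 < κ := by positivity
  have hκ2 : κ ^ 2 = ε ^ 2 / (16 * 2 ^ d) := by
    rw [hκ, div_pow, mul_pow, ← pow_mul, mul_comm d, pow_mul, Real.sq_sqrt (by norm_num)]; norm_num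
  set x := √q * κ * √Δ with hx
  have hx0 : 0 ≤ x := by positivity
  have hx2 : x ^ 2 = q * ε ^ 2 / (16 * 2 ^ d) * Δ := by
    rw [hx, mul_pow, mul_pow, hκ2, Real.sq_sqrt hq'.le, Real.sq_sqrt hΔ0]; ring
  rw [hΔbox, ← hx2] at hsig
  obtain ⟨h8, hlt⟩ := lt_of_signal ht (by positivity) hx0 hsig
  have hΔpos : 0 < √Δ := by
    by_contra h
    have : √Δ = 0 := le_antisymm (not_lt.1 h) (Real.sqrt_nonneg _)
    rw [hx, this, mul_zero] at h8
    linarith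
  -- Write x² = qκ²Δ and R = √N·4p. Off the two bad events the drift of the statistic is at least
  -- q(x² − tx) ≥ qx²/2, while the norm of the weights is √q times the norm of the block sums, at
  -- most q(x + R). By `lt_of_signal` the drift then exceeds 2t times that norm.
  have hincl : {h : (Fin n₁ → Bool) × (Fin n₁ → Bool) |
        ∑ i ∈ Finset.range n₁, a i (diffs h) *
            π.drift ε (densityMeasure f) (densityMeasure g) i (diffs h) ≤
            2 * t * √(∑ i ∈ Finset.range n₁, a i (diffs h) ^ 2)} ⊆
      {h | ∑ k ∈ Finset.range N, gap b f g k * noise ε b N q f g k (diffs h) ≤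
        -(t * √q * √Δ)} ∪
      {h | q * N * (4 * p) ^ 2 < ∑ k ∈ Finset.range N, noise ε b N q f g k (diffs h) ^ 2} := by
    intro h hh
    by_contra hcon
    simp only [Set.mem_union, Set.mem_ofPred_eq, not_or, not_le, not_lt] at hcon hh
    obtain ⟨hc1, hc2⟩ := hcon
    set U := diffs h
    have e1 : ∑ i ∈ Finset.range n₁, a i U ^ 2 =
        q * ∑ k ∈ Finset.range N, blockSum N q k U ^ 2 := by
      have : ∀ i, a i U ^ 2 = if q * N ≤ i ∧ i < 2 * (q * N) then blockSum N q (i % N) U ^ 2 else 0 :=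
        fun i => by simp only [hadef]; split_ifs <;> simp
      simp_rw [this]
      rw [sum_window q N n₁ hn, Finset.mul_sum]
      refine Finset.sum_congr rfl fun k hk => ?_
      simp_rw [window_mod (Finset.mem_range.1 hk)]
      simp
    have e2 : ∑ i ∈ Finset.range n₁, a i U *
        π.drift ε (densityMeasure f) (densityMeasure g) i U =
        q * κ * ∑ k ∈ Finset.range N, gap b f g k * blockSum N q k U := by
      have : ∀ i ∈ Finset.range n₁, a i U * π.drift ε (densityMeasure f) (densityMeasure g) i U =
          if q * N ≤ i ∧ i < 2 * (q * N) then
            κ * (gap b f g (i % N) * blockSum N q (i % N) U) else 0 := fun i hi => by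
        have hi' : i < n₁ * N := (Finset.mem_range.1 hi).trans_le (Nat.le_mul_of_pos_right _ hN)
        rw [drift_of_isCyclic π (hcyc n₁) hf hg hi']
        simp only [hadef]; split_ifs <;> ring
      rw [Finset.sum_congr rfl this, sum_window q N n₁ hn, Finset.mul_sum]
      refine Finset.sum_congr rfl fun k hk => ?_
      simp_rw [window_mod (Finset.mem_range.1 hk)]
      simp; ring
    have e3 := sum_gap_mul_blockSum ε b N q f g U
    have e4 : √(∑ k ∈ Finset.range N, blockSum N q k U ^ 2) ≤
        q * κ * √Δ + √q * (√((L : ℝ) ^ d) * (4 * p)) := by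
      have hsplit : ∀ k, blockSum N q k U = q * κ * gap b f g k + noise ε b N q f g k U :=
        fun k => by unfold noise; ring
      simp_rw [hsplit]
      refine (sqrt_sum_add_sq_le _ _ _).trans (add_le_add (le_of_eq ?_) ?_)
      · simp_rw [mul_pow _ (gap b f g _)]
        rw [← Finset.mul_sum, Real.sqrt_mul (by positivity), Real.sqrt_sq (by positivity)]
      · refine (Real.sqrt_le_sqrt hc2).trans (le_of_eq ?_)
        rw [Real.sqrt_mul (by positivity), Real.sqrt_sq (by positivity), Real.sqrt_mul hq'.le,
          hNdef]
        push_cast; ring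
    rw [e1, e2, Real.sqrt_mul hq'.le, e3] at hh
    have hq2 : √(q : ℝ) * √q = q := Real.mul_self_sqrt hq'.le
    have h5 : q * (x ^ 2 / 2) ≤ q * κ * (q * κ * Δ +
        ∑ k ∈ Finset.range N, gap b f g k * noise ε b N q f g k U) := by
      have : q * κ * (q * κ * Δ + -(t * √q * √Δ)) = q * (x ^ 2 - t * x) := by
        have hx2' : x ^ 2 = q * κ ^ 2 * Δ := by rw [hx2, hκ2]; ring
        linear_combination (-(q : ℝ)) * hx2' + q * t * hx
      calc _ ≤ q * (x ^ 2 - t * x) := by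
            gcongr; nlinarith
        _ = q * κ * (q * κ * Δ + -(t * √q * √Δ)) := this.symm
        _ ≤ _ := by gcongr
    have h6 : 2 * t * (√q * √(∑ k ∈ Finset.range N, blockSum N q k U ^ 2)) ≤
        q * (2 * t * (x + √((L : ℝ) ^ d) * (4 * p))) := by
      calc _ ≤ 2 * t * (√q * (q * κ * √Δ + √q * (√((L : ℝ) ^ d) * (4 * p)))) := by gcongr
        _ = _ := by
            linear_combination 2 * t * (√((L : ℝ) ^ d) * (4 * p)) * hq2 - 2 * t * q * hx
    have h7 := mul_lt_mul_of_pos_left hlt hq'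
    linarith
  have hnN : q * N ≤ n₁ := by omega
  calc _ ≤ P ({h | ∑ k ∈ Finset.range N, gap b f g k * noise ε b N q f g k (diffs h) ≤
        -(t * √q * √Δ)} ∪
      {h | q * N * (4 * p) ^ 2 < ∑ k ∈ Finset.range N, noise ε b N q f g k (diffs h) ^ 2}) +
        ENNReal.ofReal (β / 4) :=
        add_le_add (measure_mono hincl) (ENNReal.ofReal_le_ofReal htβ)
    _ ≤ ENNReal.ofReal (β / 4) + ENNReal.ofReal (β / 2) + ENNReal.ofReal (β / 4) := by
        gcongr
        refine (measure_union_le _ _).trans (add_le_add ?_ ?_)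
        · exact (measure_inner_noise_le π hε0 hε n₁ _ (hcyc q) hf hg hnN hq ht hΔpos).trans
            (ENNReal.ofReal_le_ofReal htβ)
        · refine measure_norm_noise_le π hε0 hε n₁ _ (hcyc q) hf hg hnN hq hN hp (by positivity) ?_
          refine le_trans (le_of_eq ?_) hpβ
          field_simp; ring
    _ = ENNReal.ofReal β := by
        rw [← ENNReal.ofReal_add (by positivity) (by positivity),
          ← ENNReal.ofReal_add (by positivity) (by positivity)]
        congr 1; ring

end LDPTwoSample

end

noncomputable section

namespace LDPTwoSample

/-! ### The interactive test -/

variable {d : ℕ}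

/-- The trigonometric polynomial whose coefficients are the block sums. -/
def blockPoly (b : ℕ → Fin d → ℕ) (N q : ℕ) (U : ℕ → ℝ) (x : Cube d) : ℝ :=
  ∑ k ∈ Finset.range N, blockSum N q k U * trigProd (b k) x

/-- A bound for the block polynomial. -/
def blockBound (b : ℕ → Fin d → ℕ) (N q : ℕ) (U : ℕ → ℝ) : ℝ :=
  -- The summand 1 keeps the denominator of the released statistic positive; it is negligible
  -- against the noise level √(qN).
  1 + ⨆ x, |blockPoly b N q U x|

lemma abs_blockPoly_le_blockBound (b : ℕ → Fin d → ℕ) (N q : ℕ) (U : ℕ → ℝ) (x : Cube d) :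
    |blockPoly b N q U x| ≤ blockBound b N q U := by
  have hb : BddAbove (Set.range fun x => |blockPoly b N q U x|) := by
    refine ⟨∑ k ∈ Finset.range N, |blockSum N q k U| * √2 ^ d, ?_⟩
    rintro _ ⟨x, rfl⟩
    refine (Finset.abs_sum_le_sum_abs _ _).trans (Finset.sum_le_sum fun k _ => ?_)
    rw [abs_mul]
    exact mul_le_mul_of_nonneg_left (abs_trigProd_le _ _) (abs_nonneg _)
  have := le_ciSup hb x
  unfold blockBound
  linarith

lemma one_le_blockBound (b : ℕ → Fin d → ℕ) (N q : ℕ) (U : ℕ → ℝ) : 1 ≤ blockBound b N q U := by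
  unfold blockBound
  have := Real.iSup_nonneg fun x => abs_nonneg (blockPoly b N q U x)
  linarith

lemma blockPoly_congr (b : ℕ → Fin d → ℕ) {N q : ℕ} {U U' : ℕ → ℝ} (h : ∀ i < q * N, U i = U' i) :
    blockPoly b N q U = blockPoly b N q U' := by
  funext x
  exact Finset.sum_congr rfl fun k hk => by rw [blockSum_congr (Finset.mem_range.1 hk) h]

/-- The policy that first estimates the coefficients, and then releases the normalized estimate of
the difference of the densities at the datum. -/
def plugInPolicy (b : ℕ → Fin d → ℕ) (N q : ℕ) : Policy d where
  u i x U := if i < q * N then trigProd (b (i % N)) x / √2 ^ d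
    else blockPoly b N q U x / blockBound b N q U
  measurable t U := by
    split_ifs
    · exact (measurable_trigProd _).div_const _
    · refine Measurable.div_const ?_ _
      unfold blockPoly
      exact Finset.measurable_sum _ fun k _ => (measurable_trigProd _).const_mul _
  abs_le_one t x U := by
    split_ifs
    · rw [abs_div, abs_of_nonneg (show (0 : ℝ) ≤ √2 ^ d by positivity)]
      exact div_le_one_of_le₀ (abs_trigProd_le _ _) (by positivity)
    · have h1 := one_le_blockBound b N q U
      rw [abs_div, abs_of_nonneg (zero_le_one.trans h1)]
      exact div_le_one_of_le₀ (abs_blockPoly_le_blockBound b N q U x) (zero_le_one.trans h1)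
  predictable t x U U' h := by
    split_ifs with ht
    · rfl
    · have := blockPoly_congr b (U := U) (U' := U') (q := q) (N := N) fun i hi => h i (by omega)
      simp only [blockBound, this]

lemma integral_blockPoly {s r : ℝ} {f : Cube d → ℝ} (hf : f ∈ sobolevDensities s r d)
    (b : ℕ → Fin d → ℕ) (N q : ℕ) (U : ℕ → ℝ) :
    ∫ x, blockPoly b N q U x ∂(densityMeasure f) =
      ∑ k ∈ Finset.range N, blockSum N q k U * coeff f (b k) := by
  have := isProbabilityMeasure_densityMeasure hf
  unfold blockPoly
  rw [integral_finsetSum _ fun k _ => ?_]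
  · simp_rw [integral_const_mul, integral_trigProd_densityMeasure hf]
  · exact (Integrable.of_bound (measurable_trigProd _).aestronglyMeasurable (√2 ^ d)
      (Filter.Eventually.of_forall fun x => abs_trigProd_le _ x)).const_mul _

/-- The mean of the released statistic differs between the samples by the inner product of the
estimate with the true coefficient gap, divided by the sup norm τ of the estimate. With qN rounds in
the second stage the noise is of order √(qN), and τ is also of order √(qN) up to `x + v`. The factor
√N of the non-interactive condition is thereby replaced by the logarithmic quantity `v + 2`. -/
lemma exists_interactive_test {s r ε : ℝ} (hd : 1 ≤ d) (hε0 : 0 < ε) (hε : ε ≤ 1)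
    (n₁ n₂ L q : ℕ) (hL : 0 < L) (hq : 0 < q) (hn : 2 * (q * L ^ d) ≤ n₁) {α β t v : ℝ}
    (ht : 0 < t) (htα : Real.exp (-(t ^ 2 / 4)) ≤ α) (htβ : Real.exp (-(t ^ 2 / 4)) ≤ β / 4)
    (hv : 0 ≤ v)
    (hvβ : (21 * d * n₁ * n₁ + 1 : ℝ) ^ d * (2 * Real.exp (1 - v)) ≤ β / 2) :
    ∃ M ∈ mechanisms true d n₁ n₂ ε, ∃ φ ∈ levelTests s r M α,
      ∀ f ∈ sobolevDensities s r d, ∀ g ∈ sobolevDensities s r d,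
        64 * t ^ 2 + 8 * t * (v + 2) ≤
          q * ε ^ 2 / (16 * 2 ^ d) * ∑ l ∈ box d L, (coeff f l - coeff g l) ^ 2 →
        M.law (densityMeasure f) (densityMeasure g) {v | φ v = false} ≤ ENNReal.ofReal β := by
  obtain ⟨b, hbbox, hbsum⟩ := exists_enumeration d L
  set N := L ^ d with hNdef
  have hN : 0 < N := by positivity
  have hLN : L ≤ N := Nat.le_self_pow (by omega) L
  have hNqN : N ≤ q * N := Nat.le_mul_of_pos_left _ hq
  have hnN : q * N ≤ n₁ := by omega
  set π : Policy d := plugInPolicy b N q with hπdef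
  -- Constant weights: here the adaptation to the first stage sits in the channel.
  set a : ℕ → (ℕ → ℝ) → ℝ := fun i _ =>
    if q * N ≤ i ∧ i < 2 * (q * N) then 1 else 0 with hadef
  have ha : IsStageWeight a (q * N) :=
    ⟨fun i hi U => if_neg fun h => by omega, fun i U U' h => rfl⟩
  obtain ⟨M, hM, φ, hφ, hbound⟩ := exists_test (s := s) (r := r) π hε0 hε n₁ (n₂ := n₂) ha ht htα
    true (by simp)
  refine ⟨M, hM, φ, hφ, fun f hf g hg hsig => (hbound f hf g hg).trans ?_⟩
  have hcyc : IsCyclic π b N q := fun i hi x U => if_pos hi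
  set P := π.bitLaw hε0 hε n₁ (n₂ - n₁) (densityMeasure f) (densityMeasure g) n₁ le_rfl
  have hq' : (0 : ℝ) < q := by exact_mod_cast hq
  have hN' : (0 : ℝ) < N := by exact_mod_cast hN
  set Δ := ∑ k ∈ Finset.range N, gap b f g k ^ 2 with hΔ
  have hΔbox : ∑ l ∈ box d L, (coeff f l - coeff g l) ^ 2 = Δ :=
    (hbsum fun l => (coeff f l - coeff g l) ^ 2).symm
  have hΔ0 : 0 ≤ Δ := Finset.sum_nonneg fun _ _ => sq_nonneg _
  set B := √(2 : ℝ) ^ d with hB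
  have hB1 : 1 ≤ B := one_le_pow₀ (Real.one_le_sqrt.2 (by norm_num))
  have hB2 : B ^ 2 = 2 ^ d := by
    rw [hB, ← pow_mul, mul_comm d, pow_mul, Real.sq_sqrt (by norm_num)]
  set κ := ε / (4 * B) with hκ
  have hκ0 : 0 < κ := by positivity
  have hκ2 : κ ^ 2 = ε ^ 2 / (16 * 2 ^ d) := by
    rw [hκ, div_pow, mul_pow, hB2]; norm_num
  set x := √q * κ * √Δ with hx
  have hx0 : 0 ≤ x := by positivity
  have hx2 : x ^ 2 = q * ε ^ 2 / (16 * 2 ^ d) * Δ := by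
    rw [hx, mul_pow, mul_pow, hκ2, Real.sq_sqrt hq'.le, Real.sq_sqrt hΔ0]; ring
  have hx2' : x ^ 2 = q * κ ^ 2 * Δ := by rw [hx2, hκ2]; ring
  rw [hΔbox, ← hx2] at hsig
  obtain ⟨h8, hlt⟩ := lt_of_signal ht (by positivity) hx0 hsig
  have hΔpos : 0 < √Δ := by
    by_contra h
    have : √Δ = 0 := le_antisymm (not_lt.1 h) (Real.sqrt_nonneg _)
    rw [hx, this, mul_zero] at h8
    linarith
  have hqN1 : 1 ≤ √((q : ℝ) * N) := by
    rw [Real.one_le_sqrt]; exact_mod_cast Nat.mul_pos hq hN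
  -- Off the bad events the inner product of gap and block sums, times κ, is at least x²/2, and the
  -- sup norm τ is at most B√(qN)(x + v + 2). A drift of at most 2t√(qN) would then contradict
  -- `lt_of_signal`.
  have hincl : {h : (Fin n₁ → Bool) × (Fin n₁ → Bool) |
        ∑ i ∈ Finset.range n₁, a i (diffs h) *
            π.drift ε (densityMeasure f) (densityMeasure g) i (diffs h) ≤
            2 * t * √(∑ i ∈ Finset.range n₁, a i (diffs h) ^ 2)} ⊆
      {h | ∑ k ∈ Finset.range N, gap b f g k * noise ε b N q f g k (diffs h) ≤
        -(t * √q * √Δ)} ∪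
      {h | ∃ i : Fin d → Fin (21 * d * n₁ * n₁ + 1), B * √(q * N) * v <
        |∑ k ∈ Finset.range N, noise ε b N q f g k (diffs h) *
          trigProd (b k) (gridCube d (21 * d * n₁ * n₁) i)|} := by
    intro h hh
    by_contra hcon
    simp only [Set.mem_union, Set.mem_ofPred_eq, not_or, not_le, not_lt, not_exists] at hcon hh
    obtain ⟨hc1, hc2⟩ := hcon
    set U := diffs h with hU
    set τ := blockBound b N q U with hτ
    have hτ1 : 1 ≤ τ := one_le_blockBound b N q U
    have e1 : ∑ i ∈ Finset.range n₁, a i U ^ 2 = q * N := by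
      have : ∀ i, a i U ^ 2 = if q * N ≤ i ∧ i < 2 * (q * N) then 1 else 0 :=
        fun i => by simp only [hadef]; split_ifs <;> simp
      simp_rw [this]
      rw [sum_window q N n₁ hn]
      simp [mul_comm]
    have e2 : ∑ i ∈ Finset.range n₁, a i U *
        π.drift ε (densityMeasure f) (densityMeasure g) i U =
        q * N * (κ * B * (∑ k ∈ Finset.range N, gap b f g k * blockSum N q k U) / τ) := by
      have : ∀ i ∈ Finset.range n₁, a i U * π.drift ε (densityMeasure f) (densityMeasure g) i U =
          if q * N ≤ i ∧ i < 2 * (q * N) then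
            κ * B * (∑ k ∈ Finset.range N, gap b f g k * blockSum N q k U) / τ else 0 := by
        intro i hi
        simp only [hadef]
        split_ifs with hi'
        · have hu (x : Cube d) : π.u i x U = blockPoly b N q U x / τ :=
            if_neg (not_lt.2 hi'.1)
          rw [one_mul, Policy.drift]
          simp_rw [hu, integral_div, integral_blockPoly hf, integral_blockPoly hg]
          rw [← sub_div, ← Finset.sum_sub_distrib, mul_div_assoc']
          congr 1
          have : κ * B = ε / 4 := by rw [hκ]; field_simp
          rw [this]
          congr 1
          exact Finset.sum_congr rfl fun k _ => by unfold gap; ring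
        · ring
      rw [Finset.sum_congr rfl this, sum_window q N n₁ hn]
      simp; ring
    have e3 := sum_gap_mul_blockSum ε b N q f g U
    -- The noise coefficients have absolute sum at most 3qN and frequencies at most L, so on a grid
    -- with 21dn₁² steps per axis the discretization error is at most B·L·qN/n₁² ≤ B ≤ B√(qN).
    have hns (y : Cube d) : |∑ k ∈ Finset.range N, noise ε b N q f g k U * trigProd (b k) y| ≤
        B * √(q * N) * v + B * √(q * N) := by
      have hn0 : 0 < n₁ := by omega
      have hm0 : 0 < 21 * d * n₁ * n₁ := by positivity
      have := abs_sum_trigProd_le_of_grid (ι := Fin N) (fun k => b k) L (21 * d * n₁ * n₁) hm0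
        (fun k j => by
          have := hbbox k k.2
          simp only [box, Fintype.mem_piFinset, Finset.mem_range] at this
          exact (this j).le)
        (fun k => noise ε b N q f g k U) (B * √(q * N) * v)
        (fun i => by
          have := hc2 i
          rwa [Finset.sum_range] at this) y
      rw [← Finset.sum_range (fun k => noise ε b N q f g k U * trigProd (b k) y),
        ← Finset.sum_range (fun k => |noise ε b N q f g k U|)] at this
      refine this.trans ?_
      have hs : ∑ k ∈ Finset.range N, |noise ε b N q f g k U| ≤ 3 * (q * N) := by
        refine (Finset.sum_le_sum fun k _ => abs_noise_le hε0 hε hf hg b N q k h).trans ?_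
        simp; linarith
      refine add_le_add le_rfl ?_
      rw [mul_assoc]
      refine mul_le_mul_of_nonneg_left ?_ (by positivity)
      have hn' : (0 : ℝ) < n₁ := by exact_mod_cast hn0
      have hd' : (0 : ℝ) < d := by exact_mod_cast hd
      have hqNn : (q : ℝ) * N ≤ n₁ := by exact_mod_cast hnN
      have hLn : (L : ℝ) ≤ n₁ := by exact_mod_cast (hLN.trans hNqN).trans hnN
      calc 7 * (L : ℝ) * d / (21 * d * n₁ * n₁ : ℕ) * ∑ k ∈ Finset.range N, |noise ε b N q f g k U|
          ≤ 7 * (L : ℝ) * d / (21 * d * n₁ * n₁ : ℕ) * (3 * (q * N)) := by gcongr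
        _ = L * (q * N) / (n₁ * n₁) := by push_cast; field_simp; ring
        _ ≤ 1 := by
            rw [div_le_one (by positivity)]; gcongr
        _ ≤ _ := hqN1
    have e4 : τ ≤ B * √(q * N) * (x + (v + 2)) := by
      have hsup : ⨆ y, |blockPoly b N q U y| ≤ B * √(q * N) * (x + (v + 1)) := by
        refine Real.iSup_le (fun y => ?_) (by positivity)
        have hsplit : blockPoly b N q U y =
            q * κ * ∑ k ∈ Finset.range N, gap b f g k * trigProd (b k) y +
            ∑ k ∈ Finset.range N, noise ε b N q f g k U * trigProd (b k) y := by
          unfold blockPoly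
          rw [Finset.mul_sum, ← Finset.sum_add_distrib]
          exact Finset.sum_congr rfl fun k _ => by unfold noise; ring
        -- Cauchy–Schwarz, with ∑ φ_k(y)² ≤ N·2^d. The signal polynomial contributes qκ√Δ·√N·B =
        -- B√(qN)·x to the sup norm.
        have hcs : |∑ k ∈ Finset.range N, gap b f g k * trigProd (b k) y| ≤ √Δ * (√N * B) := by
          have h1 := Finset.sum_mul_sq_le_sq_mul_sq (Finset.range N) (gap b f g)
            (fun k => trigProd (b k) y)
          have h2 : ∑ k ∈ Finset.range N, trigProd (b k) y ^ 2 ≤ N * 2 ^ d := by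
            refine (Finset.sum_le_sum fun k _ => trigProd_sq_le (b k) y).trans ?_
            simp
          refine abs_le_of_sq_le_sq ?_ (by positivity)
          rw [mul_pow, mul_pow, Real.sq_sqrt hΔ0, Real.sq_sqrt hN'.le, hB2]
          exact h1.trans (mul_le_mul_of_nonneg_left h2 hΔ0)
        rw [hsplit]
        calc _ ≤ q * κ * |∑ k ∈ Finset.range N, gap b f g k * trigProd (b k) y| +
              |∑ k ∈ Finset.range N, noise ε b N q f g k U * trigProd (b k) y| := by
              refine (abs_add_le _ _).trans (le_of_eq ?_)
              rw [abs_mul, abs_of_pos (by positivity : 0 < q * κ)]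
          _ ≤ q * κ * (√Δ * (√N * B)) + (B * √(q * N) * v + B * √(q * N)) := by
              gcongr; exact hns y
          _ = _ := by
              rw [Real.sqrt_mul hq'.le, hx]
              linear_combination (-(κ * √Δ * √N * B)) * Real.mul_self_sqrt hq'.le
      have : 1 ≤ B * √(q * N) := one_le_mul_of_one_le_of_one_le hB1 hqN1
      rw [hτ, blockBound]
      linarith
    set I := ∑ k ∈ Finset.range N, gap b f g k * noise ε b N q f g k U with hI
    have h5 : x ^ 2 / 2 ≤ κ * ∑ k ∈ Finset.range N, gap b f g k * blockSum N q k U := by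
      rw [e3]
      have : κ * (q * κ * Δ + -(t * √q * √Δ)) = x ^ 2 - t * x := by
        linear_combination (-1 : ℝ) * hx2' + t * hx
      calc _ ≤ x ^ 2 - t * x := by nlinarith
        _ = κ * (q * κ * Δ + -(t * √q * √Δ)) := this.symm
        _ ≤ _ := by gcongr
    rw [e1, e2] at hh
    set T := √((q : ℝ) * N) with hT
    have hT2 : (q : ℝ) * N = T * T := (Real.mul_self_sqrt (by positivity)).symm
    have hτ0 : 0 < τ := by linarith
    have hT0 : 0 < T := by linarith
    rw [hT2, mul_div_assoc', div_le_iff₀ hτ0] at hh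
    have hh2 : T * B * (x ^ 2 / 2) ≤ 2 * t * τ := by
      refine le_of_mul_le_mul_left ?_ hT0
      calc T * (T * B * (x ^ 2 / 2)) = T * T * (B * (x ^ 2 / 2)) := by ring
        _ ≤ T * T * (B * (κ * ∑ k ∈ Finset.range N, gap b f g k * blockSum N q k U)) := by gcongr
        _ ≤ 2 * t * T * τ := le_trans (le_of_eq (by ring)) hh
        _ = T * (2 * t * τ) := by ring
    have hh3 : 2 * t * τ ≤ T * B * (2 * t * (x + (v + 2))) := by
      calc _ ≤ 2 * t * (B * T * (x + (v + 2))) := by gcongr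
        _ = _ := by ring
    have := mul_lt_mul_of_pos_left hlt (show 0 < T * B by positivity)
    linarith
  have hβ : 0 ≤ β := by have := Real.exp_pos (-(t ^ 2 / 4)); linarith
  calc _ ≤ P ({h | ∑ k ∈ Finset.range N, gap b f g k * noise ε b N q f g k (diffs h) ≤
        -(t * √q * √Δ)} ∪
      {h | ∃ i : Fin d → Fin (21 * d * n₁ * n₁ + 1), B * √(q * N) * v <
        |∑ k ∈ Finset.range N, noise ε b N q f g k (diffs h) *
          trigProd (b k) (gridCube d (21 * d * n₁ * n₁) i)|}) +
        ENNReal.ofReal (β / 4) :=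
        add_le_add (measure_mono hincl) (ENNReal.ofReal_le_ofReal htβ)
    _ ≤ ENNReal.ofReal (β / 4) + ENNReal.ofReal (β / 2) + ENNReal.ofReal (β / 4) := by
        gcongr
        refine (measure_union_le _ _).trans (add_le_add ?_ ?_)
        · exact (measure_inner_noise_le π hε0 hε n₁ _ hcyc hf hg hnN hq ht hΔpos).trans
            (ENNReal.ofReal_le_ofReal htβ)
        · refine (measure_grid_noise_le π hε0 hε n₁ _ hcyc hf hg hnN hq hN _ v).trans
            (ENNReal.ofReal_le_ofReal (le_trans (le_of_eq ?_) hvβ))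
          simp
    _ = ENNReal.ofReal β := by
        rw [← ENNReal.ofReal_add (by positivity) (by positivity),
          ← ENNReal.ofReal_add (by positivity) (by positivity)]
        congr 1; ring

end LDPTwoSample

end

noncomputable section

namespace LDPTwoSample

/-! ### Upper bounds on the separation radius -/

variable {d : ℕ}

lemma minimaxRisk_le {inter : Bool} {s r ε α β p ρ : ℝ} {n₁ n₂ : ℕ} (hα : 0 ≤ α) (hβ : 0 ≤ β)
    (h : ∃ M ∈ mechanisms inter d n₁ n₂ ε, ∃ φ ∈ levelTests s r M α, ∀ f ∈ altPairs s r d p ρ,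
      M.law (densityMeasure f.1) (densityMeasure f.2) {v | φ v = false} ≤ ENNReal.ofReal β) :
    minimaxRisk inter s r d n₁ n₂ ε α p ρ ≤ ENNReal.ofReal (α + β) := by
  obtain ⟨M, hM, φ, hφ, hb⟩ := h
  rw [minimaxRisk, ENNReal.ofReal_add hα hβ]
  gcongr
  exact (iInf₂_le M hM).trans ((iInf₂_le φ hφ).trans (iSup₂_le hb))

lemma separationRadius_le {inter : Bool} {s r ε α β p ρ : ℝ} {n₁ n₂ : ℕ} (hρ : 0 < ρ)
    (h : minimaxRisk inter s r d n₁ n₂ ε α p ρ ≤ ENNReal.ofReal (α + β)) :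
    separationRadius inter s r d n₁ n₂ ε α β p ≤ ρ :=
  csInf_le ⟨0, fun _ hx => hx.1.le⟩ ⟨hρ, h⟩

/-- On a probability space the L_p norm is at most the L₂ norm for p ≤ 2, so the upper bounds need
only be proved in L₂. -/
lemma two_of_altPairs {s r p ρ : ℝ} (hp2 : p ≤ 2) {f : (Cube d → ℝ) × (Cube d → ℝ)}
    (hf : f ∈ altPairs s r d p ρ) : ENNReal.ofReal ρ ≤ eLpNorm (f.1 - f.2) 2 volume := by
  refine hf.2.2.trans (eLpNorm_le_eLpNorm_of_exponent_le ?_ (hf.1.1.1.1.sub hf.2.1.1.1.1))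
  rw [show (2 : ENNReal) = ENNReal.ofReal 2 by simp]
  exact ENNReal.ofReal_le_ofReal hp2

lemma coeff_zero {s r : ℝ} {f : Cube d → ℝ} (hf : f ∈ sobolevDensities s r d) : coeff f 0 = 1 := by
  simp [coeff, trigProd_zero, hf.2.2]

lemma eLpNorm_sub_le_two_mul {s r : ℝ} (hs : 0 < s) (hr : 0 ≤ r) {f g : Cube d → ℝ}
    (hf : f ∈ sobolevDensities s r d) (hg : g ∈ sobolevDensities s r d) :
    eLpNorm (f - g) 2 volume ≤ ENNReal.ofReal (2 * r) := by
  have h := eLpNorm_sub_le_of_coeff hs hf hg 1 le_rfl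
  have hb : box d 1 = {0} := by
    ext l; simp [box, funext_iff]
  rw [hb, Finset.sum_singleton, coeff_zero hf, coeff_zero hg] at h
  have : √((1 - 1 : ℝ) ^ 2 + 4 * r ^ 2 * ((1 : ℕ) : ℝ) ^ (-(2 * s))) = 2 * r := by
    rw [Nat.cast_one, Real.one_rpow, show (1 - 1 : ℝ) ^ 2 + 4 * r ^ 2 * 1 = (2 * r) ^ 2 by ring,
      Real.sqrt_sq (by positivity)]
  rwa [this] at h

lemma altPairs_eq_empty {s r p ρ : ℝ} (hs : 0 < s) (hr : 0 ≤ r) (hp2 : p ≤ 2) (hρ : 2 * r < ρ) :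
    altPairs s r d p ρ = ∅ := by
  by_contra hne
  obtain ⟨f, hf⟩ := Set.nonempty_iff_ne_empty.2 hne
  have h := (two_of_altPairs hp2 hf).trans (eLpNorm_sub_le_two_mul hs hr hf.1 hf.2.1)
  have := (ENNReal.ofReal_le_ofReal_iff (by positivity)).1 h
  linarith

lemma exp_neg_sq_quarter {y : ℝ} (hy : 0 < y) (hy1 : y ≤ 1) :
    Real.exp (-((2 * √(Real.log (1 / y))) ^ 2 / 4)) = y := by
  have h0 : 0 ≤ Real.log (1 / y) := Real.log_nonneg (by rw [le_div_iff₀ hy]; linarith)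
  rw [mul_pow, Real.sq_sqrt h0, show (-(2 ^ 2 * Real.log (1 / y) / 4)) = Real.log y by
    rw [one_div, Real.log_inv]; ring, Real.exp_log hy]

/-- The class has L₂ diameter at most 2r, so beyond 2r there are no alternatives and any level-α
test will do; zero weights give a test that never rejects. This settles the regime where the claimed
radius exceeds 2r, and makes the set of admissible radii nonempty for the lower bounds. -/
lemma minimaxRisk_le_of_large {inter : Bool} {s r ε α β p ρ : ℝ} {n₁ n₂ : ℕ} (hs : 0 < s)
    (hr : 0 ≤ r) (hp2 : p ≤ 2) (hε0 : 0 < ε) (hε : ε ≤ 1) (hα : 0 < α) (hα1 : α ≤ 1 / 2)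
    (hβ : 0 ≤ β) (hρ : 2 * r < ρ) :
    minimaxRisk inter s r d n₁ n₂ ε α p ρ ≤ ENNReal.ofReal (α + β) := by
  have ht : 0 < 2 * √(Real.log (1 / α)) := by
    have : 0 < Real.log (1 / α) := Real.log_pos (by rw [lt_div_iff₀ hα]; linarith)
    positivity
  obtain ⟨M, hM, φ, hφ, -⟩ := exists_test (s := s) (r := r) (n₂ := n₂)
    (cyclicPolicy (d := d) (fun _ => 0) 0) hε0 hε n₁
    (a := fun _ _ => 0) (m₁ := 0) ⟨fun _ _ _ => rfl, fun _ _ _ _ => rfl⟩ ht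
    (exp_neg_sq_quarter hα (by linarith)).le inter (fun _ _ _ _ _ => rfl)
  refine minimaxRisk_le hα.le hβ ⟨M, hM, φ, hφ, fun f hf => ?_⟩
  rw [altPairs_eq_empty hs hr hp2 hρ] at hf
  exact absurd hf (Set.notMem_empty _)

lemma separationRadius_le_of_large {inter : Bool} {s r ε α β p ρ : ℝ} {n₁ n₂ : ℕ} (hs : 0 < s)
    (hr : 0 ≤ r) (hp2 : p ≤ 2) (hε0 : 0 < ε) (hε : ε ≤ 1) (hα : 0 < α) (hα1 : α ≤ 1 / 2)
    (hβ : 0 ≤ β) (hρ : 2 * r < ρ) :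
    separationRadius inter s r d n₁ n₂ ε α β p ≤ ρ :=
  separationRadius_le (by linarith) (minimaxRisk_le_of_large hs hr hp2 hε0 hε hα hα1 hβ hρ)

/-- The choice of the resolution level. -/
lemma exists_resolution {s r k A E ε : ℝ} {n₁ : ℕ} (hd : 1 ≤ d) (hs : 0 < s) (hk : (d : ℝ) ≤ k)
    (hA : 2 ≤ A) (hε0 : 0 < ε) (hε : ε ≤ 1) (hE : E = n₁ * ε ^ 2) (hAE : A ≤ E) {G : ℝ}
    (hG : 0 ≤ G) :
    ∃ L q : ℕ, 0 < L ∧ 0 < q ∧ 2 * (q * L ^ d) ≤ n₁ ∧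
      ∀ f ∈ sobolevDensities s r d, ∀ g ∈ sobolevDensities s r d,
        ENNReal.ofReal (√(4 * r ^ 2 * 4 ^ s + G) * (A / E) ^ (s / (2 * s + k))) ≤
          eLpNorm (f - g) 2 volume →
        G / (64 * 2 ^ d) * A * (L : ℝ) ^ (k - d) ≤
          q * ε ^ 2 / (16 * 2 ^ d) * ∑ l ∈ box d L, (coeff f l - coeff g l) ^ 2 := by
  have hk0 : 0 < k := lt_of_lt_of_le (by exact_mod_cast hd) hk
  have hA0 : 0 < A := by linarith
  have hE0 : 0 < E := by linarith
  -- The real solution of z^{2s+k} = E/A. The exponent `k` is 3d/2 without interaction and d with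
  -- it, so that L^{k-d} is √(L^d) or 1, as the detection conditions require.
  set z := (E / A) ^ (1 / (2 * s + k)) with hz
  have hEA : 1 ≤ E / A := by rwa [le_div_iff₀ hA0, one_mul]
  have hz1 : 1 ≤ z := Real.one_le_rpow hEA (by positivity)
  have hz0 : 0 < z := by linarith
  have hzpow : z ^ (2 * s + k) = E / A := by
    rw [hz, ← Real.rpow_mul (by positivity), one_div_mul_cancel (by positivity), Real.rpow_one]
  have hzs : (A / E) ^ (s / (2 * s + k)) = z ^ (-s) := by
    rw [hz, ← Real.rpow_mul (by positivity), ← inv_div E A, Real.inv_rpow (by positivity),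
      ← Real.rpow_neg (by positivity)]
    congr 1; ring
  set L := ⌊z⌋₊ with hL
  have hL1 : 1 ≤ L := Nat.le_floor (by simpa using hz1)
  have hLz : (L : ℝ) ≤ z := Nat.floor_le hz0.le
  have hL0 : (0 : ℝ) < L := by exact_mod_cast hL1
  have hLz2 : z / 2 ≤ L := by
    have := Nat.lt_floor_add_one z
    have h1 : (1 : ℝ) ≤ L := by exact_mod_cast hL1
    linarith
  have hn0 : 0 ≤ (n₁ : ℝ) := by positivity
  have hEn : E ≤ n₁ := by
    rw [hE]; exact mul_le_of_le_one_right hn0 (pow_le_one₀ hε0.le hε)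
  have hNz : ((L ^ d : ℕ) : ℝ) ≤ z ^ (d : ℝ) := by
    rw [Real.rpow_natCast]; push_cast; gcongr
  -- L^d ≤ z^d ≤ z^{2s+k} = E/A ≤ n₁/2, so at least one full cycle fits into each of the two stages.
  have h2N : 2 * L ^ d ≤ n₁ := by
    have h1 : z ^ (d : ℝ) ≤ E / A := by
      rw [← hzpow]; exact Real.rpow_le_rpow_of_exponent_le hz1 (by linarith)
    have h2 : E / A ≤ n₁ / 2 := by gcongr
    have : ((2 * L ^ d : ℕ) : ℝ) ≤ n₁ := by push_cast at hNz ⊢; linarith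
    exact_mod_cast this
  have hN0 : 0 < L ^ d := by positivity
  -- The number of full cycles in each half of the rounds. As it is at least 1, rounding down loses
  -- at most a factor 2.
  set q := n₁ / (2 * L ^ d) with hq
  have hq1 : 1 ≤ q := (Nat.one_le_div_iff (by positivity)).2 h2N
  have hqn : n₁ ≤ 4 * L ^ d * q := by
    have h1 := Nat.div_add_mod n₁ (2 * L ^ d)
    have h2 := Nat.mod_lt n₁ (show 0 < 2 * L ^ d by positivity)
    rw [← hq] at h1
    have h3 : 2 * L ^ d ≤ 2 * L ^ d * q := Nat.le_mul_of_pos_right _ hq1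
    nlinarith
  refine ⟨L, q, hL1, hq1, ?_, fun f hf g hg hfg => ?_⟩
  · calc 2 * (q * L ^ d) = q * (2 * L ^ d) := by ring
      _ ≤ n₁ := Nat.div_mul_le_self _ _
  set Δ := ∑ l ∈ box d L, (coeff f l - coeff g l) ^ 2 with hΔ
  have hΔ0 : 0 ≤ Δ := Finset.sum_nonneg fun _ _ => sq_nonneg _
  have h1 := hfg.trans (eLpNorm_sub_le_of_coeff hs hf hg L hL1)
  rw [hzs, ENNReal.ofReal_le_ofReal_iff (Real.sqrt_nonneg _)] at h1
  have h2 : (4 * r ^ 2 * 4 ^ s + G) * z ^ (-(2 * s)) ≤ Δ + 4 * r ^ 2 * (L : ℝ) ^ (-(2 * s)) := by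
    have h3 := pow_le_pow_left₀ (by positivity) h1 2
    have e : (z ^ (-s)) ^ 2 = z ^ (-(2 * s)) := by
      rw [← Real.rpow_natCast, ← Real.rpow_mul hz0.le]; congr 1; push_cast; ring
    rwa [Real.sq_sqrt (by positivity), mul_pow, Real.sq_sqrt (by positivity), e] at h3
  have h3 : (L : ℝ) ^ (-(2 * s)) ≤ 4 ^ s * z ^ (-(2 * s)) := by
    calc (L : ℝ) ^ (-(2 * s)) ≤ (z / 2) ^ (-(2 * s)) :=
          Real.rpow_le_rpow_of_nonpos (by positivity) hLz2 (by linarith)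
      _ = 4 ^ s * z ^ (-(2 * s)) := by
          rw [Real.div_rpow hz0.le (by norm_num), Real.rpow_neg (by norm_num : (0 : ℝ) ≤ 2),
            Real.rpow_mul (by norm_num)]
          norm_num [mul_comm]
  -- The constant 4r²·4^s of the separation absorbs the truncation bias, since L ≥ z/2 gives L^{-2s}
  -- ≤ 4^s z^{-2s}. What remains is the signal G·z^{-2s}.
  have h4 : G * z ^ (-(2 * s)) ≤ Δ := by
    have := mul_le_mul_of_nonneg_left h3 (show 0 ≤ 4 * r ^ 2 by positivity)
    linarith
  have h5 : E / (4 * z ^ (d : ℝ)) ≤ q * ε ^ 2 := by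
    rw [div_le_iff₀ (by positivity), hE]
    have : (n₁ : ℝ) ≤ 4 * (L ^ d : ℕ) * q := by exact_mod_cast hqn
    calc n₁ * ε ^ 2 ≤ (4 * (L ^ d : ℕ) * q) * ε ^ 2 := by gcongr
      _ ≤ (4 * z ^ (d : ℝ) * q) * ε ^ 2 := by gcongr
      _ = _ := by ring
  have h6 : E = A * z ^ (2 * s + k) := by rw [hzpow]; field_simp
  calc G / (64 * 2 ^ d) * A * (L : ℝ) ^ (k - d) ≤ G / (64 * 2 ^ d) * A * z ^ (k - d) := by
        gcongr
    _ = E / (4 * z ^ (d : ℝ)) / (16 * 2 ^ d) * (G * z ^ (-(2 * s))) := by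
        have : z ^ (k - d) = z ^ (2 * s + k) * z ^ (-(2 * s)) / z ^ (d : ℝ) := by
          rw [← Real.rpow_add hz0, ← Real.rpow_sub hz0]; congr 1; ring
        rw [this, h6]
        field_simp
        ring
    _ ≤ q * ε ^ 2 / (16 * 2 ^ d) * Δ := by gcongr

lemma log_sixteen_gt : 2.7 < Real.log 16 := by
  have : (16 : ℝ) = 2 ^ 4 := by norm_num
  rw [this, Real.log_pow]
  have := Real.log_two_gt_d9
  push_cast; linarith

/-- Elementary bounds for the logarithmic quantities. -/
lemma log_bounds {α β : ℝ} (hα : 0 < α) (hβ : 0 < β) (hαβ : α + β ≤ 1 / 2) :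
    2.7 < Real.log (1 / (α * β)) ∧ Real.log (1 / β) ≤ Real.log (1 / (α * β)) ∧
      0 < 2 * √(Real.log (1 / (α * β / 4))) ∧
      (2 * √(Real.log (1 / (α * β / 4)))) ^ 2 ≤ 8 * Real.log (1 / (α * β)) ∧
      2 * √(Real.log (1 / (α * β / 4))) ≤ 3 * Real.log (1 / (α * β)) := by
  have hab : 0 < α * β := by positivity
  have hab16 : α * β ≤ 1 / 16 := by nlinarith [sq_nonneg (α - β)]
  set l := Real.log (1 / (α * β)) with hl
  have hl1 : Real.log 16 ≤ l := by
    refine Real.log_le_log (by norm_num) ?_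
    rw [le_div_iff₀ hab]; linarith
  have h27 := log_sixteen_gt
  have h4 : Real.log (1 / (α * β / 4)) = l + Real.log 4 := by
    rw [hl, ← Real.log_mul (by positivity) (by norm_num)]; congr 1; field_simp
  have h416 : Real.log 16 = 2 * Real.log 4 := by
    rw [show (16 : ℝ) = 4 ^ 2 by norm_num, Real.log_pow]; norm_num
  have hpos : 0 < Real.log (1 / (α * β / 4)) := by rw [h4]; linarith
  have hsq : (2 * √(Real.log (1 / (α * β / 4)))) ^ 2 ≤ 8 * l := by
    rw [mul_pow, Real.sq_sqrt hpos.le, h4]; linarith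
  refine ⟨by linarith, ?_, by positivity, hsq, ?_⟩
  · refine Real.log_le_log (by positivity) ?_
    gcongr
    exact mul_le_of_le_one_left hβ.le (by linarith)
  · refine abs_le_of_sq_le_sq' ?_ (by linarith) |>.2
    nlinarith

/-- The threshold t = 2(log(4/(αβ)))^{1/2} makes the tail e^{-t²/4} equal to αβ/4, below both error
budgets. -/
lemma one_div_four_mul_le {α β : ℝ} (hα : 0 < α) (hβ : 0 < β) (hαβ : α + β ≤ 1 / 2) :
    Real.exp (-((2 * √(Real.log (1 / (α * β / 4)))) ^ 2 / 4)) ≤ α ∧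
      Real.exp (-((2 * √(Real.log (1 / (α * β / 4)))) ^ 2 / 4)) ≤ β / 4 := by
  have hab : 0 < α * β := by positivity
  rw [exp_neg_sq_quarter (by positivity) (by nlinarith)]
  constructor <;> nlinarith

lemma sqrt_const_gt {r s G : ℝ} (hr : 0 < r) (hs : 0 < s) (hG : 0 < G) :
    2 * r < √(4 * r ^ 2 * 4 ^ s + G) := by
  rw [Real.lt_sqrt (by positivity)]
  have : (1 : ℝ) ≤ 4 ^ s := Real.one_le_rpow (by norm_num) hs.le
  nlinarith [sq_nonneg r, mul_pos hr hr]

lemma le_mul_rpow_of_one_le {a C w e : ℝ} (hC : a < C) (ha : 0 ≤ a) (hw : 1 ≤ w) (he : 0 ≤ e) :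
    a < C * w ^ e := by
  have := Real.one_le_rpow hw he
  nlinarith

lemma radiusNI_le {s r p ε α β : ℝ} {n₁ n₂ : ℕ} (hd : 1 ≤ d) (hs : 0 < s) (hr : 0 < r)
    (hp2 : p ≤ 2) (hε0 : 0 < ε) (hε : ε ≤ 1) (hα : 0 < α) (hβ : 0 < β)
    (hαβ : α + β ≤ 1 / 2) (hn : 1 ≤ n₁) :
    radiusNI s r d n₁ n₂ ε α β p ≤ √(4 * r ^ 2 * 4 ^ s + 64 * 2 ^ d * 800) *
      (Real.log (1 / (α * β)) ^ 2 / (n₁ * ε ^ 2)) ^ (2 * s / (4 * s + 3 * d)) := by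
  obtain ⟨hl, hlβ, ht0, ht2, ht3⟩ := log_bounds hα hβ hαβ
  obtain ⟨htα, htβ⟩ := one_div_four_mul_le hα hβ hαβ
  set l := Real.log (1 / (α * β)) with hldef
  set t := 2 * √(Real.log (1 / (α * β / 4))) with ht
  have hn0 : (0 : ℝ) < n₁ := by exact_mod_cast hn
  have hE0 : 0 < n₁ * ε ^ 2 := by positivity
  have hC := sqrt_const_gt hr hs (show (0 : ℝ) < 64 * 2 ^ d * 800 by positivity)
  by_cases hy : l ^ 2 ≤ n₁ * ε ^ 2
  · have hexp : 2 * s / (4 * s + 3 * d) = s / (2 * s + 3 * d / 2) := by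
      rw [div_eq_div_iff (by positivity) (by positivity)]; ring
    obtain ⟨L, q, hL, hq, hLq, hsig⟩ := exists_resolution (r := r) (k := 3 * d / 2) (A := l ^ 2)
      hd hs (by have : (0 : ℝ) ≤ d := by positivity
                linarith) (by nlinarith) hε0 hε rfl hy
      (show (0 : ℝ) ≤ 64 * 2 ^ d * 800 by positivity)
    -- The least `p` for which the bad event on the norm of the noise has probability at most β/2 by
    -- `measure_norm_noise_le`.
    set p' := ⌈Real.log (4 * Real.exp 1 / β)⌉₊ with hp'
    have hlog4 : Real.log (4 * Real.exp 1 / β) = Real.log 4 + 1 + Real.log (1 / β) := by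
      rw [mul_div_assoc, Real.log_mul (by norm_num) (by positivity), div_eq_mul_one_div,
        Real.log_mul (by positivity) (by positivity), Real.log_exp]
      ring
    have hlog4' : Real.log 4 ≤ 1.4 := by
      rw [show (4 : ℝ) = 2 ^ 2 by norm_num, Real.log_pow]
      have := Real.log_two_lt_d9
      push_cast; linarith
    have hlog40 : 0 < Real.log 4 := Real.log_pos (by norm_num)
    have hlogβ : 0 < Real.log (1 / β) := Real.log_pos (by rw [lt_div_iff₀ hβ]; linarith)
    have hp0 : 0 < p' := Nat.ceil_pos.2 (by rw [hlog4]; positivity)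
    have hp3 : (p' : ℝ) ≤ 3 * l := by
      have := Nat.ceil_lt_add_one (show 0 ≤ Real.log (4 * Real.exp 1 / β) by rw [hlog4]; positivity)
      rw [← hp', hlog4] at this
      linarith
    have hpβ : 4 * Real.exp 1 / β ≤ Real.exp p' := by
      rw [← Real.log_le_iff_le_exp (by positivity)]
      exact Nat.le_ceil _
    obtain ⟨M, hM, φ, hφ, hb⟩ := exists_noninteractive_test (s := s) (r := r) hε0 hε n₁ n₂ L q p'
      hL hq hp0 hLq hβ ht0 htα htβ hpβ
    refine separationRadius_le (by positivity)
      (minimaxRisk_le hα.le hβ.le ⟨M, hM, φ, hφ, fun f hf => ?_⟩)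
    refine hb f.1 hf.1 f.2 hf.2.1 (le_trans ?_ (hsig f.1 hf.1 f.2 hf.2.1 ?_))
    · have hLr : (L : ℝ) ^ ((3 * d / 2 : ℝ) - d) = √((L : ℝ) ^ d) := by
        rw [Real.sqrt_eq_rpow, ← Real.rpow_natCast, ← Real.rpow_mul (by positivity)]
        congr 1; ring
      have hL1 : 1 ≤ √((L : ℝ) ^ d) := by
        rw [Real.one_le_sqrt]; exact one_le_pow₀ (by exact_mod_cast hL)
      rw [hLr]
      have e : 64 * 2 ^ d * 800 / (64 * 2 ^ d : ℝ) = 800 := by field_simp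
      rw [e]
      -- Source of the constant 800 = 512 + 8·36: t² ≤ 8l, t ≤ 3l and p' ≤ 3l, where l > 1.
      have h1 : 64 * t ^ 2 ≤ 512 * l ^ 2 := by nlinarith
      have h2 : t * (4 * p') ≤ 36 * l ^ 2 := by
        calc t * (4 * p') ≤ 3 * l * (4 * (3 * l)) := by gcongr
          _ = _ := by ring
      calc _ ≤ 512 * l ^ 2 * √((L : ℝ) ^ d) + 8 * (36 * l ^ 2) * √((L : ℝ) ^ d) := by
            refine add_le_add ?_ ?_
            · nlinarith [sq_nonneg l]
            · calc 8 * t * (√((L : ℝ) ^ d) * (4 * p')) = 8 * (t * (4 * p')) * √((L : ℝ) ^ d) := by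
                    ring
                _ ≤ _ := by gcongr
        _ ≤ _ := by nlinarith [mul_nonneg (sq_nonneg l) (zero_le_one.trans hL1)]
    · rw [← hexp]
      exact two_of_altPairs hp2 hf
  -- If l² > n₁ε² the base of the power is at least 1, and the claimed bound exceeds 2r.
  · refine separationRadius_le_of_large hs hr.le hp2 hε0 hε hα (by linarith) hβ.le ?_
    refine le_mul_rpow_of_one_le hC (by positivity) ?_ (by positivity)
    rw [le_div_iff₀ hE0, one_mul]; exact (not_le.1 hy).le

lemma log_four_le : Real.log 4 ≤ 1.4 := by
  rw [show (4 : ℝ) = 2 ^ 2 by norm_num, Real.log_pow]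
  have := Real.log_two_lt_d9
  push_cast; linarith

/-- The union bound over (21dn₁² + 1)^d grid points costs a multiple of the logarithm of the sample
size, which is where log(n₂/β) enters the interactive rate. -/
lemma grid_log_bound {D n lam b : ℝ} (hD : 1 ≤ D) (hn : 1 ≤ n) (hlam : 0.69 < lam)
    (hlog : Real.log n ≤ lam) (hb : b ≤ lam) :
    1 + (Real.log 4 + D * Real.log (21 * D * n * n + 1) + b) + 2 ≤ (10 + 40 * D ^ 2) * lam := by
  have hn0 : 0 < n := by linarith
  have hlogg : Real.log (21 * D * n * n + 1) ≤ 22 * D + 2 * lam := by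
    have h1 : 21 * D * n * n + 1 ≤ 22 * D * (n * n) := by
      have := one_le_mul_of_one_le_of_one_le hD (one_le_mul_of_one_le_of_one_le hn hn)
      linarith
    calc Real.log (21 * D * n * n + 1) ≤ Real.log (22 * D * (n * n)) :=
          Real.log_le_log (by positivity) h1
      _ = Real.log (22 * D) + (Real.log n + Real.log n) := by
          rw [Real.log_mul (by positivity) (by positivity), Real.log_mul hn0.ne' hn0.ne']
      _ ≤ _ := by
          have := Real.log_le_sub_one_of_pos (show (0 : ℝ) < 22 * D by positivity)
          linarith
  have h1 : D * Real.log (21 * D * n * n + 1) ≤ 22 * D ^ 2 + 2 * (D * lam) := by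
    calc _ ≤ D * (22 * D + 2 * lam) := by gcongr
      _ = _ := by ring
  have h2 : D ≤ D ^ 2 := by nlinarith
  have h4 : D * lam ≤ D ^ 2 * lam := by gcongr
  have h3 : 0.69 * D ^ 2 ≤ D ^ 2 * lam := by
    rw [mul_comm]; gcongr
  have := log_four_le
  linarith

lemma radiusI_le {s r p ε α β : ℝ} {n₁ n₂ : ℕ} (hd : 1 ≤ d) (hs : 0 < s) (hr : 0 < r)
    (hp2 : p ≤ 2) (hε0 : 0 < ε) (hε : ε ≤ 1) (hα : 0 < α) (hβ : 0 < β)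
    (hαβ : α + β ≤ 1 / 2) (hn : 1 ≤ n₁) (hn12 : n₁ ≤ n₂) :
    radiusI s r d n₁ n₂ ε α β p ≤
      √(4 * r ^ 2 * 4 ^ s + 64 * 2 ^ d * (768 + 24 * (10 + 40 * d ^ 2))) *
      ((Real.log (n₂ / β) * Real.log (1 / (α * β))) ^ 2 / (n₁ * ε ^ 2)) ^
        (2 * s / (4 * s + 2 * d)) := by
  obtain ⟨hl, hlβ, ht0, ht2, ht3⟩ := log_bounds hα hβ hαβ
  obtain ⟨htα, htβ⟩ := one_div_four_mul_le hα hβ hαβ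
  set l := Real.log (1 / (α * β)) with hldef
  set t := 2 * √(Real.log (1 / (α * β / 4))) with ht
  have hn0 : (0 : ℝ) < n₁ := by exact_mod_cast hn
  have hn1 : (1 : ℝ) ≤ n₁ := by exact_mod_cast hn
  have hn2 : (n₁ : ℝ) ≤ n₂ := by exact_mod_cast hn12
  have hn20 : (0 : ℝ) < n₂ := by linarith
  have hd1 : (1 : ℝ) ≤ d := by exact_mod_cast hd
  have hE0 : 0 < n₁ * ε ^ 2 := by positivity
  set lam := Real.log (n₂ / β) with hlam
  have hlamsum : lam = Real.log n₂ + Real.log (1 / β) := by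
    rw [hlam, div_eq_mul_one_div, Real.log_mul (by positivity) (by positivity)]
  have hlogn1 : 0 ≤ Real.log n₁ := Real.log_nonneg hn1
  have hlogn : Real.log n₁ ≤ Real.log n₂ := Real.log_le_log hn0 hn2
  have hlogβ : 0.69 < Real.log (1 / β) := by
    have : Real.log 2 ≤ Real.log (1 / β) :=
      Real.log_le_log (by norm_num) (by rw [le_div_iff₀ hβ]; linarith)
    linarith [Real.log_two_gt_d9]
  have hlam1 : 0.69 < lam := by linarith
  set H : ℝ := 10 + 40 * d ^ 2 with hH
  have hC := sqrt_const_gt hr hs (show (0 : ℝ) < 64 * 2 ^ d * (768 + 24 * H) by positivity)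
  have hΛ : 1.8 < lam * l := by nlinarith
  by_cases hy : (lam * l) ^ 2 ≤ n₁ * ε ^ 2
  · have hexp : 2 * s / (4 * s + 2 * d) = s / (2 * s + d) := by
      rw [div_eq_div_iff (by positivity) (by positivity)]; ring
    obtain ⟨L, q, hL, hq, hLq, hsig⟩ := exists_resolution (r := r) (k := d) (A := (lam * l) ^ 2)
      hd hs le_rfl (le_trans (by norm_num) (pow_le_pow_left₀ (by norm_num) hΛ.le 2)) hε0 hε rfl hy
      (show (0 : ℝ) ≤ 64 * 2 ^ d * (768 + 24 * H) by positivity)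
    set g : ℝ := 21 * d * n₁ * n₁ + 1 with hg
    have hg1 : 1 ≤ g := by rw [hg]; have : 0 ≤ 21 * (d : ℝ) * n₁ * n₁ := by positivity
                           linarith
    -- The solution of g^d·2e^{1-v} = β/2, so that the grid event uses half of the type-II budget.
    set v := 1 + Real.log (4 * g ^ d / β) with hv
    have hlogv : Real.log (4 * g ^ d / β) = Real.log 4 + d * Real.log g + Real.log (1 / β) := by
      rw [div_eq_mul_one_div, Real.log_mul (by positivity) (by positivity),
        Real.log_mul (by norm_num) (by positivity), Real.log_pow]
    have hlogg0 : 0 ≤ Real.log g := Real.log_nonneg hg1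
    have hlog40 : 0 < Real.log 4 := Real.log_pos (by norm_num)
    have hv0 : 0 ≤ v := by
      rw [hv, hlogv]
      have : 0 ≤ d * Real.log g := by positivity
      linarith
    have hvH : v + 2 ≤ H * lam := by
      rw [hv, hlogv]
      exact grid_log_bound hd1 hn1 hlam1 (by linarith) (by linarith)
    have hvβ : (21 * d * n₁ * n₁ + 1 : ℝ) ^ d * (2 * Real.exp (1 - v)) ≤ β / 2 := by
      have : 1 - v = -Real.log (4 * g ^ d / β) := by rw [hv]; ring
      rw [this, Real.exp_neg, Real.exp_log (by positivity), ← hg]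
      refine le_of_eq ?_
      field_simp
      norm_num
    obtain ⟨M, hM, φ, hφ, hb⟩ := exists_interactive_test (s := s) (r := r) hd hε0 hε n₁ n₂ L q
      hL hq hLq ht0 htα htβ hv0 hvβ
    refine separationRadius_le (by positivity)
      (minimaxRisk_le hα.le hβ.le ⟨M, hM, φ, hφ, fun f hf => ?_⟩)
    refine hb f.1 hf.1 f.2 hf.2.1 (le_trans ?_ (hsig f.1 hf.1 f.2 hf.2.1 ?_))
    · have e : 64 * 2 ^ d * (768 + 24 * H) / (64 * 2 ^ d : ℝ) = 768 + 24 * H := by field_simp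
      rw [e, sub_self, Real.rpow_zero, mul_one]
      have h1 : lam * l ≤ (lam * l) ^ 2 := le_self_pow₀ (by linarith) two_ne_zero
      have h2 : l ≤ 1.5 * (lam * l) := by
        have : 0.69 * l ≤ lam * l := mul_le_mul_of_nonneg_right hlam1.le (by linarith)
        linarith
      have h3 : t * (v + 2) ≤ 3 * l * (H * lam) := by gcongr
      -- Source of 768 + 24H: t² ≤ 8l gives 512·l, and 512·1.5 = 768 by l ≤ 1.5·lam·l; t ≤ 3l and v
      -- + 2 ≤ H·lam give 24H.
      calc 64 * t ^ 2 + 8 * t * (v + 2) ≤ 64 * (8 * l) + 8 * (3 * l * (H * lam)) := by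
            rw [mul_assoc 8 t]; gcongr
        _ = 512 * l + 24 * H * (lam * l) := by ring
        _ ≤ 768 * (lam * l) ^ 2 + 24 * H * (lam * l) ^ 2 := by
            gcongr ?_ + 24 * H * ?_
            linarith
        _ = _ := by ring
    · rw [← hexp]
      exact two_of_altPairs hp2 hf
  · refine separationRadius_le_of_large hs hr.le hp2 hε0 hε hα (by linarith) hβ.le ?_
    refine le_mul_rpow_of_one_le hC (by positivity) ?_ (by positivity)
    rw [le_div_iff₀ hE0, one_mul]; exact (not_le.1 hy).le

end LDPTwoSample

end

noncomputable section

namespace LDPTwoSample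

/-! ### Posterior distribution of a datum given its private view -/

section Posterior

variable {𝒳 H V : Type} [MeasurableSpace 𝒳] [MeasurableSpace H] [MeasurableSpace V]

/-- The joint law of history, view and datum. -/
def jointLaw (μ : Measure H) (P : Measure 𝒳) (κ : Kernel (𝒳 × H) V) : Measure ((H × V) × 𝒳) :=
  ((μ.prod P) ⊗ₘ (κ.comap Prod.swap measurable_swap)).map fun q => ((q.1.1, q.2), q.1.2)

/-- The joint law of history and view. -/
def viewLaw (μ : Measure H) (P : Measure 𝒳) (κ : Kernel (𝒳 × H) V) : Measure (H × V) :=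
  μ ⊗ₘ privatized P κ

/-- `π` is a conditional distribution of the datum given the history and the view. -/
def IsPosterior (μ : Measure H) (P : Measure 𝒳) (κ : Kernel (𝒳 × H) V)
    (π : Kernel (H × V) 𝒳) : Prop :=
  jointLaw μ P κ = viewLaw μ P κ ⊗ₘ π

variable (μ : Measure H) [IsProbabilityMeasure μ] (P : Measure 𝒳) [IsProbabilityMeasure P]
  (κ : Kernel (𝒳 × H) V) [IsMarkovKernel κ]

instance : IsProbabilityMeasure (viewLaw μ P κ) := by unfold viewLaw; infer_instance

lemma measurable_regroup : Measurable fun q : (H × 𝒳) × V => ((q.1.1, q.2), q.1.2) := by fun_prop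

instance : IsProbabilityMeasure (jointLaw μ P κ) :=
  Measure.isProbabilityMeasure_map measurable_regroup.aemeasurable

lemma lintegral_jointLaw {F : (H × V) × 𝒳 → ENNReal} (hF : Measurable F) :
    ∫⁻ q, F q ∂(jointLaw μ P κ) = ∫⁻ h, ∫⁻ x, ∫⁻ z, F ((h, z), x) ∂(κ (x, h)) ∂P ∂μ := by
  rw [jointLaw, lintegral_map hF measurable_regroup,
    Measure.lintegral_compProd (f := fun q : (H × 𝒳) × V => F ((q.1.1, q.2), q.1.2))
      (hF.comp measurable_regroup), lintegral_prod]
  · rfl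
  · exact (Measurable.lintegral_kernel_prod_right'
      (κ := κ.comap Prod.swap measurable_swap) (hF.comp measurable_regroup)).aemeasurable

lemma lintegral_viewLaw (P : Measure 𝒳) [IsProbabilityMeasure P] {F : H × V → ENNReal}
    (hF : Measurable F) :
    ∫⁻ q, F q ∂(viewLaw μ P κ) = ∫⁻ h, ∫⁻ x, ∫⁻ z, F (h, z) ∂(κ (x, h)) ∂P ∂μ := by
  rw [viewLaw, Measure.lintegral_compProd hF]
  exact lintegral_congr fun h => lintegral_privatized P κ h (hF.comp measurable_prodMk_left)

lemma fst_jointLaw : (jointLaw μ P κ).fst = viewLaw μ P κ := by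
  refine Measure.ext_of_lintegral _ fun F hF => ?_
  rw [Measure.fst, lintegral_map hF measurable_fst,
    lintegral_jointLaw _ _ _ (F := fun q => F q.1) (hF.comp measurable_fst), lintegral_viewLaw _ _ _ hF]

lemma snd_jointLaw : (jointLaw μ P κ).snd = P := by
  refine Measure.ext_of_lintegral _ fun F hF => ?_
  rw [Measure.snd, lintegral_map hF measurable_snd,
    lintegral_jointLaw _ _ _ (F := fun q => F q.2) (hF.comp measurable_snd)]
  simp

lemma exists_isPosterior [StandardBorelSpace 𝒳] [Nonempty 𝒳] :
    ∃ π : Kernel (H × V) 𝒳, IsMarkovKernel π ∧ IsPosterior μ P κ π := by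
  refine ⟨(jointLaw μ P κ).condKernel, inferInstance, ?_⟩
  rw [IsPosterior, ← fst_jointLaw, Measure.disintegrate]

/-- If the channel ignores the history, there is a posterior that ignores the history and serves
for all laws of the history. -/
lemma exists_isPosterior_of_ignoresHistory [StandardBorelSpace 𝒳] [Nonempty 𝒳] [Nonempty H]
    (hκ : IgnoresHistory κ) :
    ∃ π : Kernel V 𝒳, ∃ _ : IsMarkovKernel π,
      ∀ (μ : Measure H) [IsProbabilityMeasure μ], IsPosterior μ P κ (π.comap Prod.snd measurable_snd) := by
  obtain ⟨h₀⟩ := ‹Nonempty H›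
  -- The history is frozen at an arbitrary value. As the channel does not see it, the posterior
  -- found there is valid for every history and every law of it.
  obtain ⟨π, hπ, hpost⟩ := exists_isPosterior (Measure.dirac h₀) P κ
  refine ⟨π.comap (fun z => (h₀, z)) measurable_prodMk_left, inferInstance, fun μ _ => ?_⟩
  have key : ∀ F : V × 𝒳 → ENNReal, Measurable F →
      ∫⁻ x, ∫⁻ z, F (z, x) ∂(κ (x, h₀)) ∂P = ∫⁻ x, ∫⁻ z, ∫⁻ y, F (z, y) ∂(π (h₀, z)) ∂(κ (x, h₀)) ∂P := by
    intro F hF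
    have hF' : Measurable fun q : (H × V) × 𝒳 => F (q.1.2, q.2) := hF.comp (by fun_prop)
    have := congrArg (fun m => ∫⁻ q, F (q.1.2, q.2) ∂m) hpost
    beta_reduce at this
    rw [lintegral_jointLaw _ _ _ hF', Measure.lintegral_compProd hF',
      lintegral_viewLaw _ _ _ (hF'.lintegral_kernel_prod_right'), lintegral_dirac', lintegral_dirac'] at this
    · exact this
    · have h2 := Measurable.lintegral_kernel_prod_right'
        (κ := κ.comap Prod.swap measurable_swap)
        ((hF'.lintegral_kernel_prod_right' (κ := π)).comp
          (show Measurable fun q : (H × 𝒳) × V => (q.1.1, q.2) by fun_prop))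
      exact h2.lintegral_prod_right'
    · have h1 : Measurable fun q : (H × 𝒳) × V => F (q.2, q.1.2) := hF.comp (by fun_prop)
      exact (Measurable.lintegral_kernel_prod_right'
        (κ := κ.comap Prod.swap measurable_swap) h1).lintegral_prod_right'
  refine Measure.ext_of_lintegral _ fun F hF => ?_
  rw [lintegral_jointLaw _ _ _ hF, Measure.lintegral_compProd hF,
    lintegral_viewLaw _ _ _ (hF.lintegral_kernel_prod_right')]
  refine lintegral_congr fun h => ?_
  simp only [hκ _ h h₀, Kernel.comap_apply]
  exact key (fun q => F ((h, q.1), q.2)) (hF.comp (by fun_prop))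

variable {μ P κ} {π : Kernel (H × V) 𝒳} [IsMarkovKernel π]

/-- The likelihood ratio of a view is the posterior mean of the likelihood ratio of the datum. -/
lemma IsPosterior.viewLaw_withDensity (hπ : IsPosterior μ P κ π) {f : 𝒳 → ENNReal}
    (hf : Measurable f) [IsProbabilityMeasure (P.withDensity f)] :
    viewLaw μ (P.withDensity f) κ = (viewLaw μ P κ).withDensity fun q => ∫⁻ x, f x ∂(π q) := by
  refine Measure.ext_of_lintegral _ fun F hF => ?_
  have hm : Measurable fun q => ∫⁻ x, f x ∂(π q) := hf.lintegral_kernel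
  have hFf : Measurable fun q : (H × V) × 𝒳 => f q.2 * F q.1 :=
    (hf.comp measurable_snd).mul (hF.comp measurable_fst)
  rw [lintegral_viewLaw _ _ _ hF, lintegral_withDensity_eq_lintegral_mul _ hm hF]
  have h1 := congrArg (fun m => ∫⁻ q, f q.2 * F q.1 ∂m) hπ
  beta_reduce at h1
  rw [lintegral_jointLaw _ _ _ hFf, Measure.lintegral_compProd hFf] at h1
  have e1 : ∫⁻ q, ((fun q => ∫⁻ x, f x ∂(π q)) * F) q ∂(viewLaw μ P κ) =
      ∫⁻ q, ∫⁻ x, f x * F q ∂(π q) ∂(viewLaw μ P κ) := by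
    refine lintegral_congr fun q => ?_
    rw [lintegral_mul_const _ hf]; rfl
  rw [e1, ← h1]
  refine lintegral_congr fun h => ?_
  have hF1 : Measurable fun x => ∫⁻ z, F (h, z) ∂(κ (x, h)) :=
    (Measurable.lintegral_kernel_prod_right'
        (κ := κ.comap Prod.swap measurable_swap) (f := fun q : (H × 𝒳) × V => F (q.1.1, q.2))
        (hF.comp (by fun_prop))).comp (measurable_prodMk_left (x := h))
  rw [lintegral_withDensity_eq_lintegral_mul _ hf hF1]
  refine lintegral_congr fun x => ?_
  exact (lintegral_const_mul _ (hF.comp measurable_prodMk_left)).symm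

end Posterior

section Privacy

variable {𝒳 H V : Type} [MeasurableSpace 𝒳] [MeasurableSpace H] [MeasurableSpace V]
  {μ : Measure H} [IsProbabilityMeasure μ] {P : Measure 𝒳} [IsProbabilityMeasure P]
  {κ : Kernel (𝒳 × H) V} [IsMarkovKernel κ] {ε : ℝ}

omit [IsMarkovKernel κ] in
lemma privatized_apply (h : H) {S : Set V} (hS : MeasurableSet S) :
    privatized P κ h S = ∫⁻ x, κ (x, h) S ∂P := by
  have := lintegral_privatized P κ h (measurable_one.indicator hS)
  simpa [lintegral_indicator_one hS] using this

-- Averaging the privacy inequality over the second datum replaces it by the marginal law of the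
-- view. Together with the reverse inequality this places the likelihood ratio of joint law and
-- product law in [e^{-ε}, e^ε].
omit [IsMarkovKernel κ] in
lemma IsPrivateKernel.le_privatized (hκ : IsPrivateKernel ε κ) (x : 𝒳) (h : H) :
    κ (x, h) ≤ ENNReal.ofReal (Real.exp ε) • privatized P κ h := by
  refine Measure.le_iff.2 fun S hS => ?_
  rw [Measure.smul_apply, privatized_apply h hS, smul_eq_mul,
    ← lintegral_const_mul' _ _ ENNReal.ofReal_ne_top]
  calc κ (x, h) S = ∫⁻ _, κ (x, h) S ∂P := by simp
    _ ≤ _ := lintegral_mono fun x' => hκ x x' h S hS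

omit [IsMarkovKernel κ] in
lemma IsPrivateKernel.privatized_le (hκ : IsPrivateKernel ε κ) (x : 𝒳) (h : H) :
    privatized P κ h ≤ ENNReal.ofReal (Real.exp ε) • κ (x, h) := by
  refine Measure.le_iff.2 fun S hS => ?_
  rw [Measure.smul_apply, privatized_apply h hS, smul_eq_mul]
  calc ∫⁻ x', κ (x', h) S ∂P ≤ ∫⁻ _, ENNReal.ofReal (Real.exp ε) * κ (x, h) S ∂P :=
        lintegral_mono fun x' => hκ x' x h S hS
    _ = _ := by simp

lemma lintegral_viewLaw_prod {F : (H × V) × 𝒳 → ENNReal} (hF : Measurable F) :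
    ∫⁻ q, F q ∂((viewLaw μ P κ).prod P) =
      ∫⁻ h, ∫⁻ x, ∫⁻ z, F ((h, z), x) ∂(privatized P κ h) ∂P ∂μ := by
  rw [lintegral_prod _ hF.aemeasurable, viewLaw,
    Measure.lintegral_compProd hF.lintegral_prod_right']
  refine lintegral_congr fun h => ?_
  exact lintegral_lintegral_swap (hF.comp (by fun_prop)).aemeasurable

lemma IsPrivateKernel.jointLaw_le (hκ : IsPrivateKernel ε κ) :
    jointLaw μ P κ ≤ ENNReal.ofReal (Real.exp ε) • (viewLaw μ P κ).prod P := by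
  refine Measure.le_iff.2 fun S hS => ?_
  have hF : Measurable (S.indicator (1 : (H × V) × 𝒳 → ENNReal)) := measurable_one.indicator hS
  rw [Measure.smul_apply, ← lintegral_indicator_one hS, ← lintegral_indicator_one hS,
    lintegral_jointLaw _ _ _ hF, lintegral_viewLaw_prod hF, smul_eq_mul,
    ← lintegral_const_mul' _ _ ENNReal.ofReal_ne_top]
  refine lintegral_mono fun h => ?_
  rw [← lintegral_const_mul' _ _ ENNReal.ofReal_ne_top]
  refine lintegral_mono fun x => ?_
  rw [← smul_eq_mul, ← lintegral_smul_measure]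
  exact lintegral_mono' (hκ.le_privatized x h) le_rfl

lemma IsPrivateKernel.prod_le (hκ : IsPrivateKernel ε κ) :
    (viewLaw μ P κ).prod P ≤ ENNReal.ofReal (Real.exp ε) • jointLaw μ P κ := by
  refine Measure.le_iff.2 fun S hS => ?_
  have hF : Measurable (S.indicator (1 : (H × V) × 𝒳 → ENNReal)) := measurable_one.indicator hS
  rw [Measure.smul_apply, ← lintegral_indicator_one hS, ← lintegral_indicator_one hS,
    lintegral_jointLaw _ _ _ hF, lintegral_viewLaw_prod hF, smul_eq_mul,
    ← lintegral_const_mul' _ _ ENNReal.ofReal_ne_top]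
  refine lintegral_mono fun h => ?_
  rw [← lintegral_const_mul' _ _ ENNReal.ofReal_ne_top]
  refine lintegral_mono fun x => ?_
  rw [← smul_eq_mul, ← lintegral_smul_measure]
  exact lintegral_mono' (hκ.privatized_le x h) le_rfl

lemma sq_integral_abs_le {Ω : Type} [MeasurableSpace Ω] {ν : Measure Ω} [IsProbabilityMeasure ν]
    {F : Ω → ℝ} (hF : Integrable F ν) (hF2 : Integrable (fun q => F q ^ 2) ν) :
    (∫ q, |F q| ∂ν) ^ 2 ≤ ∫ q, F q ^ 2 ∂ν := by
  set m := ∫ q, |F q| ∂ν with hm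
  have h1 : Integrable (fun q => 2 * m * |F q|) ν := hF.abs.const_mul _
  have h2 : Integrable (fun q => F q ^ 2 - 2 * m * |F q|) ν := hF2.sub h1
  have h3 : 0 ≤ ∫ q, (F q ^ 2 - 2 * m * |F q| + m ^ 2) ∂ν := integral_nonneg fun q => by
    have : F q ^ 2 - 2 * m * |F q| + m ^ 2 = (|F q| - m) ^ 2 := by rw [sub_sq, sq_abs]; ring
    simp only [this]; positivity
  rw [integral_add h2 (integrable_const _), integral_sub hF2 h1, integral_const_mul, ← hm] at h3
  simp at h3
  linarith

/-- Comparison of means under two measures with likelihood ratio in `[e^{-ε}, e^ε]`. -/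
lemma integral_le_sinh_mul {Ω : Type} [MeasurableSpace Ω] {J ν : Measure Ω} [IsProbabilityMeasure J]
    [IsProbabilityMeasure ν] (hε : 0 ≤ ε) (hJR : J ≤ ENNReal.ofReal (Real.exp ε) • ν)
    (hRJ : ν ≤ ENNReal.ofReal (Real.exp ε) • J) {F : Ω → ℝ} (hF : Measurable F) {B : ℝ}
    (hB : ∀ q, |F q| ≤ B) (h0 : ∫ q, F q ∂ν = 0) :
    ∫ q, F q ∂J ≤ Real.sinh ε * √(∫ q, F q ^ 2 ∂ν) := by
  have hint : ∀ (m : Measure Ω) [IsProbabilityMeasure m] {G : Ω → ℝ} {b : ℝ}, Measurable G →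
      (∀ q, |G q| ≤ b) → Integrable G m := fun m _ G b hG hb =>
    Integrable.of_bound hG.aestronglyMeasurable b (Filter.Eventually.of_forall hb)
  have hmp : Measurable fun q => max (F q) 0 := hF.max measurable_const
  have hmm : Measurable fun q => max (-F q) 0 := hF.neg.max measurable_const
  have hbp : ∀ q, |max (F q) 0| ≤ B := fun q => by
    rw [abs_of_nonneg (le_max_right _ _)]
    exact max_le ((le_abs_self _).trans (hB q)) ((abs_nonneg _).trans (hB q))
  have hbm : ∀ q, |max (-F q) 0| ≤ B := fun q => by
    rw [abs_of_nonneg (le_max_right _ _)]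
    exact max_le ((neg_le_abs _).trans (hB q)) ((abs_nonneg _).trans (hB q))
  have hsub : ∀ q, F q = max (F q) 0 - max (-F q) 0 := fun q => by
    rcases le_total 0 (F q) with h | h
    · rw [max_eq_left h, max_eq_right (by linarith), sub_zero]
    · rw [max_eq_right h, max_eq_left (by linarith)]; ring
  have habs : ∀ q, |F q| = max (F q) 0 + max (-F q) 0 := fun q => by
    rcases le_total 0 (F q) with h | h
    · rw [max_eq_left h, max_eq_right (by linarith), abs_of_nonneg h, add_zero]
    · rw [max_eq_right h, max_eq_left (by linarith), abs_of_nonpos h]; ring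
  have hJ : ∫ q, F q ∂J = ∫ q, max (F q) 0 ∂J - ∫ q, max (-F q) 0 ∂J := by
    rw [← integral_sub (hint J hmp hbp) (hint J hmm hbm)]
    exact integral_congr_ae (Filter.Eventually.of_forall hsub)
  have hR : ∫ q, F q ∂ν = ∫ q, max (F q) 0 ∂ν - ∫ q, max (-F q) 0 ∂ν := by
    rw [← integral_sub (hint ν hmp hbp) (hint ν hmm hbm)]
    exact integral_congr_ae (Filter.Eventually.of_forall hsub)
  have hA : ∫ q, |F q| ∂ν = ∫ q, max (F q) 0 ∂ν + ∫ q, max (-F q) 0 ∂ν := by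
    rw [← integral_add (hint ν hmp hbp) (hint ν hmm hbm)]
    exact integral_congr_ae (Filter.Eventually.of_forall habs)
  have h1 : ∫ q, max (F q) 0 ∂J ≤ Real.exp ε * ∫ q, max (F q) 0 ∂ν := by
    have := integral_mono_measure (f := fun q => max (F q) 0) hJR
      (Filter.Eventually.of_forall fun q => le_max_right _ _)
      ((hint ν hmp hbp).smul_measure ENNReal.ofReal_ne_top)
    rwa [integral_smul_measure, ENNReal.toReal_ofReal (Real.exp_pos ε).le] at this
  have h2 : ∫ q, max (-F q) 0 ∂ν ≤ Real.exp ε * ∫ q, max (-F q) 0 ∂J := by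
    have := integral_mono_measure (f := fun q => max (-F q) 0) hRJ
      (Filter.Eventually.of_forall fun q => le_max_right _ _)
      ((hint J hmm hbm).smul_measure ENNReal.ofReal_ne_top)
    rwa [integral_smul_measure, ENNReal.toReal_ofReal (Real.exp_pos ε).le] at this
  have h2' : Real.exp (-ε) * ∫ q, max (-F q) 0 ∂ν ≤ ∫ q, max (-F q) 0 ∂J := by
    rw [Real.exp_neg, inv_mul_le_iff₀ (Real.exp_pos _)]; exact h2
  have hcs : ∫ q, |F q| ∂ν ≤ √(∫ q, F q ^ 2 ∂ν) := by
    refine Real.le_sqrt_of_sq_le ?_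
    exact sq_integral_abs_le (hint ν hF hB) (hint ν (b := B ^ 2) (hF.pow_const 2) fun q => by
      rw [abs_pow]; exact pow_le_pow_left₀ (abs_nonneg _) (hB q) 2)
  have hs : Real.sinh ε = (Real.exp ε - Real.exp (-ε)) / 2 := Real.sinh_eq ε
  have hs0 : 0 ≤ Real.sinh ε := Real.sinh_nonneg_iff.2 hε
  refine le_trans ?_ (mul_le_mul_of_nonneg_left hcs hs0)
  -- Zero mean makes both parts equal to half of ∫|F|. The mean under J is then at most (e^ε −
  -- e^{-ε}) times that half, that is sinh ε times ∫|F|.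
  have h4 : ∫ q, max (F q) 0 ∂ν = ∫ q, max (-F q) 0 ∂ν := by linarith
  rw [hA, hJ, hs, h4]
  rw [h4] at h1
  linarith

/-- The views carry little information on an orthonormal system of centred functions. -/
lemma IsPosterior.sum_integral_sq_le {π : Kernel (H × V) 𝒳} [IsMarkovKernel π]
    (hπ : IsPosterior μ P κ π) (hκ : IsPrivateKernel ε κ) (hε : 0 ≤ ε) {ι : Type} [Fintype ι]
    [DecidableEq ι] {φ : ι → 𝒳 → ℝ} (hφ : ∀ i, Measurable (φ i)) {B : ℝ} (hB : ∀ i x, |φ i x| ≤ B)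
    (h0 : ∀ i, ∫ x, φ i x ∂P = 0)
    (h1 : ∀ i j, ∫ x, φ i x * φ j x ∂P = if i = j then 1 else 0) :
    ∑ i, ∫ q, (∫ x, φ i x ∂(π q)) ^ 2 ∂(viewLaw μ P κ) ≤ Real.sinh ε ^ 2 := by
  set b : ι → H × V → ℝ := fun i q => ∫ x, φ i x ∂(π q) with hb
  have hbm : ∀ i, Measurable (b i) := fun i =>
    ((hφ i).stronglyMeasurable.integral_kernel).measurable
  have hφi : ∀ (m : Measure 𝒳) [IsProbabilityMeasure m] i, Integrable (φ i) m := fun m _ i =>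
    Integrable.of_bound (hφ i).aestronglyMeasurable B (Filter.Eventually.of_forall (hB i))
  have hbB : ∀ i q, |b i q| ≤ B := fun i q => by
    have := norm_integral_le_of_norm_le_const (μ := π q) (f := φ i) (C := B)
      (Filter.Eventually.of_forall (hB i))
    simpa using this
  -- The self-dual test function: let T be the left-hand side of the claim. Under the joint law F
  -- has mean T; under the product law it has mean 0 and, by orthonormality, second moment T. The
  -- comparison of means reads T ≤ sinh ε·√T.
  set F : (H × V) × 𝒳 → ℝ := fun y => ∑ i, b i y.1 * φ i y.2 with hF
  have hFm : Measurable F := Finset.measurable_sum _ fun i _ =>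
    ((hbm i).comp measurable_fst).mul ((hφ i).comp measurable_snd)
  have hFB : ∀ y, |F y| ≤ ∑ _i : ι, B * B := fun y =>
    (Finset.abs_sum_le_sum_abs _ _).trans (Finset.sum_le_sum fun i _ => by
      rw [abs_mul]
      exact mul_le_mul (hbB i _) (hB i _) (abs_nonneg _) ((abs_nonneg _).trans (hB i y.2)))
  set C : ℝ := ∑ _i : ι, B * B
  have hint : ∀ m : Measure ((H × V) × 𝒳), IsProbabilityMeasure m → Integrable F m := fun m _ =>
    Integrable.of_bound hFm.aestronglyMeasurable C (Filter.Eventually.of_forall hFB)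
  have hint2 : ∀ m : Measure ((H × V) × 𝒳), IsProbabilityMeasure m →
      Integrable (fun y => F y ^ 2) m := fun m _ =>
    Integrable.of_bound (hFm.pow_const 2).aestronglyMeasurable (C ^ 2)
      (Filter.Eventually.of_forall fun y => by
        rw [Real.norm_eq_abs, abs_pow]; exact pow_le_pow_left₀ (abs_nonneg _) (hFB y) 2)
  have hlin : ∀ (m : Measure 𝒳) [IsProbabilityMeasure m] q,
      ∫ x, F (q, x) ∂m = ∑ i, b i q * ∫ x, φ i x ∂m := fun m _ q => by
    simp only [hF]
    rw [integral_finsetSum _ fun i _ => (hφi m i).const_mul _]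
    simp only [integral_const_mul]
  set T := ∑ i, ∫ q, (b i q) ^ 2 ∂(viewLaw μ P κ) with hT
  have hb2 : ∀ i, Integrable (fun q => b i q ^ 2) (viewLaw μ P κ) := fun i =>
    Integrable.of_bound ((hbm i).pow_const 2).aestronglyMeasurable (B ^ 2)
      (Filter.Eventually.of_forall fun y => by
        rw [Real.norm_eq_abs, abs_pow]; exact pow_le_pow_left₀ (abs_nonneg _) (hbB i y) 2)
  have hTs : T = ∫ q, ∑ i, (b i q) ^ 2 ∂(viewLaw μ P κ) := by
    rw [integral_finsetSum _ fun i _ => hb2 i]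
  have e1 : ∫ y, F y ∂(jointLaw μ P κ) = T := by
    have hi := hint (jointLaw μ P κ) inferInstance
    rw [show jointLaw μ P κ = _ from hπ] at hi ⊢
    rw [Measure.integral_compProd hi, hTs]
    refine integral_congr_ae (Filter.Eventually.of_forall fun q => ?_)
    simp only [hlin (π q) q]
    exact Finset.sum_congr rfl fun i _ => (pow_two _).symm
  have e2 : ∫ y, F y ∂((viewLaw μ P κ).prod P) = 0 := by
    rw [integral_prod _ (hint _ inferInstance)]
    simp only [hlin P, h0, mul_zero, Finset.sum_const_zero, integral_zero]
  have e3 : ∫ y, F y ^ 2 ∂((viewLaw μ P κ).prod P) = T := by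
    rw [integral_prod _ (hint2 _ inferInstance), hTs]
    refine integral_congr_ae (Filter.Eventually.of_forall fun q => ?_)
    have hij : ∀ i j, Integrable (fun x => φ i x * φ j x) P := fun i j =>
      Integrable.of_bound ((hφ i).mul (hφ j)).aestronglyMeasurable (B * B)
        (Filter.Eventually.of_forall fun x => by
          rw [Real.norm_eq_abs, abs_mul]
          exact mul_le_mul (hB i _) (hB j _) (abs_nonneg _) ((abs_nonneg _).trans (hB i x)))
    have : ∀ x, F (q, x) ^ 2 = ∑ i, ∑ j, (b i q * b j q) * (φ i x * φ j x) := fun x => by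
      simp only [hF]
      rw [pow_two, Finset.sum_mul_sum]
      exact Finset.sum_congr rfl fun i _ => Finset.sum_congr rfl fun j _ => by ring
    simp only [this]
    rw [integral_finsetSum _ fun i _ => integrable_finsetSum _ fun j _ => (hij i j).const_mul _]
    refine Finset.sum_congr rfl fun i _ => ?_
    rw [integral_finsetSum _ fun j _ => (hij i j).const_mul _]
    simp only [integral_const_mul, h1, mul_ite, mul_one, mul_zero, Finset.sum_ite_eq,
      Finset.mem_univ, if_true, pow_two]
  have key := integral_le_sinh_mul hε (hκ.jointLaw_le (μ := μ) (P := P)) hκ.prod_le hFm hFB e2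
  rw [e1, e3] at key
  have hT0 : 0 ≤ T := Finset.sum_nonneg fun i _ => integral_nonneg fun q => sq_nonneg _
  by_contra hcon
  push Not at hcon
  have h3 : Real.sinh ε < √T := by
    refine Real.lt_sqrt_of_sq_lt hcon
  have h4 : 0 < √T := (Real.sinh_nonneg_iff.2 hε).trans_lt h3
  have h5 : T = √T * √T := (Real.mul_self_sqrt hT0).symm
  have := mul_lt_mul_of_pos_right h3 h4
  linarith

end Privacy

end LDPTwoSample

end

noncomputable section

namespace LDPTwoSample

/-! ### Likelihood ratio of the views -/

lemma viewLaw_eq_prod {𝒳 H V : Type} [MeasurableSpace 𝒳] [MeasurableSpace H] [MeasurableSpace V]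
    (μ : Measure H) [IsProbabilityMeasure μ] (P : Measure 𝒳) [IsProbabilityMeasure P]
    {κ : Kernel (𝒳 × H) V} [IsMarkovKernel κ] (hκ : IgnoresHistory κ) (h₀ : H) :
    viewLaw μ P κ = μ.prod (privatized P κ h₀) := by
  have : privatized P κ = Kernel.const H (privatized P κ h₀) := by
    ext h S hS
    rw [Kernel.const_apply, privatized_apply h hS, privatized_apply h₀ hS]
    simp only [hκ _ h h₀]
  rw [viewLaw, this, Measure.compProd_const, Kernel.const_apply]

lemma abs_integral_le_of_abs_le {Ω : Type} [MeasurableSpace Ω] (m : Measure Ω)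
    [IsProbabilityMeasure m] {g : Ω → ℝ} {B : ℝ} (hg : ∀ x, |g x| ≤ B) : |∫ x, g x ∂m| ≤ B := by
  have := norm_integral_le_of_norm_le_const (μ := m) (f := g) (C := B)
    (Filter.Eventually.of_forall hg)
  simpa using this

lemma integrable_of_abs_le {Ω : Type} [MeasurableSpace Ω] {m : Measure Ω} [IsFiniteMeasure m]
    {g : Ω → ℝ} {B : ℝ} (hgm : Measurable g) (hg : ∀ x, |g x| ≤ B) : Integrable g m :=
  Integrable.of_bound hgm.aestronglyMeasurable B (Filter.Eventually.of_forall hg)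

namespace Mechanism

variable {𝒳 : Type} [MeasurableSpace 𝒳] {n₁ m : ℕ} (M : Mechanism 𝒳 n₁ m)

/-- The views of the first `t` rounds. -/
abbrev History (t : ℕ) : Type := (Fin t → M.Z) × (Fin t → M.W)

/-- The history before the last round, and the view of the first sample in the last round. -/
def lastView {t : ℕ} (v : M.History (t + 1)) : M.History t × M.Z :=
  ((fun i => v.1 i.castSucc, fun i => v.2 i.castSucc), v.1 (Fin.last t))

lemma measurable_lastView {t : ℕ} : Measurable (M.lastView (t := t)) := by
  unfold lastView; fun_prop

@[simp] lemma lastView_extend {t : ℕ} (h : M.History t) (z : M.Z) (w : M.W) :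
    M.lastView (M.extend (h, (z, w))) = (h, z) := by
  simp [lastView, extend]

lemma pairedLaw_map_lastView (PX PY : Measure 𝒳) [IsProbabilityMeasure PX] [IsProbabilityMeasure PY]
    (t : ℕ) (ht : t + 1 ≤ n₁) :
    (M.pairedLaw PX PY (t + 1) ht).map M.lastView =
      viewLaw (M.pairedLaw PX PY t (Nat.le_of_succ_le ht)) PX (M.roundX t ht) := by
  refine Measure.ext_of_lintegral _ fun F hF => ?_
  rw [lintegral_map hF M.measurable_lastView,
    lintegral_pairedLaw_succ M PX PY t ht (F := fun v => F (M.lastView v))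
      (hF.comp M.measurable_lastView), viewLaw, Measure.lintegral_compProd hF]
  simp

/-- A family of posterior distributions of the data of the first sample given the views, one for
each round. -/
abbrev Posteriors : Type := ∀ t, t < n₁ → Kernel (M.History t × M.Z) 𝒳

variable {M} (π : M.Posteriors)

/-- The product of the posterior means of `1 + g`. -/
def likelihoodRatio (g : 𝒳 → ℝ) : ∀ t, t ≤ n₁ → M.History t → ℝ
  | 0, _, _ => 1
  | t + 1, ht, v => likelihoodRatio g t (Nat.le_of_succ_le ht) (M.lastView v).1 *
      (1 + ∫ x, g x ∂(π t ht (M.lastView v)))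

variable {P : Measure 𝒳} [IsProbabilityMeasure P] [hmk : ∀ t ht, IsMarkovKernel (π t ht)]
  {g : 𝒳 → ℝ}

omit hmk in
lemma measurable_likelihoodRatio (hg : Measurable g) (t : ℕ) (ht : t ≤ n₁) :
    Measurable (likelihoodRatio π g t ht) := by
  induction t with
  | zero => exact measurable_const
  | succ t ih =>
    exact ((ih _).comp (measurable_fst.comp M.measurable_lastView)).mul
      (measurable_const.add
        (hg.stronglyMeasurable.integral_kernel.measurable.comp M.measurable_lastView))

/-- Crude two-sided bounds; they keep every product and logarithm of likelihood ratios bounded,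
hence integrable. -/
lemma likelihoodRatio_mem (hg2 : ∀ x, |g x| ≤ 1 / 2) (t : ℕ) (ht : t ≤ n₁) (v : M.History t) :
    (1 / 2 : ℝ) ^ t ≤ likelihoodRatio π g t ht v ∧ likelihoodRatio π g t ht v ≤ (3 / 2) ^ t := by
  induction t with
  | zero => simp [likelihoodRatio]
  | succ t ih =>
    obtain ⟨h1, h2⟩ := ih (Nat.le_of_succ_le ht) (M.lastView v).1
    have h3 := abs_le.1 (abs_integral_le_of_abs_le (π t ht (M.lastView v)) hg2)
    have h0 : (0 : ℝ) < (1 / 2) ^ t := by positivity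
    rw [likelihoodRatio, pow_succ, pow_succ]
    constructor
    · exact mul_le_mul h1 (by linarith) (by norm_num) (by linarith)
    · exact mul_le_mul h2 (by linarith) (by linarith) (by positivity)

lemma likelihoodRatio_pos (hg2 : ∀ x, |g x| ≤ 1 / 2) (t : ℕ) (ht : t ≤ n₁) (v : M.History t) :
    0 < likelihoodRatio π g t ht v :=
  lt_of_lt_of_le (by positivity) (likelihoodRatio_mem π hg2 t ht v).1

lemma abs_likelihoodRatio_le (hg2 : ∀ x, |g x| ≤ 1 / 2) (t : ℕ) (ht : t ≤ n₁) (v : M.History t) :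
    |likelihoodRatio π g t ht v| ≤ (3 / 2) ^ t := by
  rw [abs_of_pos (likelihoodRatio_pos π hg2 t ht v)]
  exact (likelihoodRatio_mem π hg2 t ht v).2

lemma lintegral_one_add {Ω : Type} [MeasurableSpace Ω] (m : Measure Ω) [IsProbabilityMeasure m]
    {g : Ω → ℝ} (hg : Measurable g) (hg2 : ∀ x, |g x| ≤ 1 / 2) :
    ∫⁻ x, ENNReal.ofReal (1 + g x) ∂m = ENNReal.ofReal (1 + ∫ x, g x ∂m) := by
  have hi := integrable_of_abs_le (m := m) hg hg2
  have hi1 : Integrable (fun x => 1 + g x) m := (integrable_const 1).add hi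
  rw [← ofReal_integral_eq_lintegral_ofReal hi1
    (Filter.Eventually.of_forall fun x => by
      have := abs_le.1 (hg2 x); show (0 : ℝ) ≤ 1 + g x; linarith),
    integral_add (integrable_const _) hi]
  simp

lemma isProbabilityMeasure_withDensity (hg : Measurable g) (hg2 : ∀ x, |g x| ≤ 1 / 2)
    (hg0 : ∫ x, g x ∂P = 0) :
    IsProbabilityMeasure (P.withDensity fun x => ENNReal.ofReal (1 + g x)) :=
  ⟨by rw [withDensity_apply _ MeasurableSet.univ, Measure.restrict_univ,
    lintegral_one_add P hg hg2, hg0]; simp⟩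

/-- Induction over the rounds: the new view of the first sample has density 1 + E(g(X) | view,
history), while the new view of the second sample has the same channel and the same data law in both
experiments. -/
lemma pairedLaw_eq_withDensity
    (hπ : ∀ t ht, IsPosterior (M.pairedLaw P P t ht.le) P (M.roundX t ht) (π t ht))
    (hg : Measurable g) (hg2 : ∀ x, |g x| ≤ 1 / 2) (hg0 : ∫ x, g x ∂P = 0) (t : ℕ) (ht : t ≤ n₁) :
    M.pairedLaw (P.withDensity fun x => ENNReal.ofReal (1 + g x)) P t ht =
      (M.pairedLaw P P t ht).withDensity fun v => ENNReal.ofReal (likelihoodRatio π g t ht v) := by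
  have := isProbabilityMeasure_withDensity hg hg2 hg0
  have hfm : Measurable fun x => ENNReal.ofReal (1 + g x) :=
    (measurable_const.add hg).ennreal_ofReal
  induction t with
  | zero => simp [likelihoodRatio, pairedLaw]
  | succ t ih =>
    have ht' := Nat.le_of_succ_le ht
    refine Measure.ext_of_lintegral _ fun F hF => ?_
    have hΛ := (measurable_likelihoodRatio π hg t ht').ennreal_ofReal
    have hΛ' := (measurable_likelihoodRatio π hg (t + 1) ht).ennreal_ofReal
    have hG : Measurable fun q : M.History t × M.Z =>
        ∫⁻ w, F (M.extend (q.1, (q.2, w))) ∂(privatized P (M.roundY t ht) q.1) :=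
      Measurable.lintegral_kernel_prod_right'
        (κ := (privatized P (M.roundY t ht)).comap Prod.fst measurable_fst)
        (f := fun y : (M.History t × M.Z) × M.W => F (M.extend (y.1.1, (y.1.2, y.2))))
        (hF.comp (M.measurable_extend.comp (by fun_prop)))
    have hΛG : Measurable fun q : M.History t × M.Z =>
        ENNReal.ofReal (likelihoodRatio π g t ht' q.1) *
          ∫⁻ w, F (M.extend (q.1, (q.2, w))) ∂(privatized P (M.roundY t ht) q.1) :=
      (hΛ.comp measurable_fst).mul hG
    rw [lintegral_pairedLaw_succ _ _ _ _ _ hF, ih ht',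
      lintegral_withDensity_eq_lintegral_mul _ hΛ hG.lintegral_kernel_prod_right',
      lintegral_withDensity_eq_lintegral_mul _ hΛ' hF,
      lintegral_pairedLaw_succ _ _ _ _ _ (hΛ'.mul hF)]
    calc _ = ∫⁻ q, ENNReal.ofReal (likelihoodRatio π g t ht' q.1) *
          ∫⁻ w, F (M.extend (q.1, (q.2, w))) ∂(privatized P (M.roundY t ht) q.1)
          ∂(viewLaw (M.pairedLaw P P t ht')
            (P.withDensity fun x => ENNReal.ofReal (1 + g x)) (M.roundX t ht)) := by
          rw [viewLaw, Measure.lintegral_compProd hΛG]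
          refine lintegral_congr fun h => ?_
          exact (lintegral_const_mul _ (hG.comp measurable_prodMk_left)).symm
      _ = _ := by
          rw [(hπ t ht).viewLaw_withDensity hfm,
            lintegral_withDensity_eq_lintegral_mul _ hfm.lintegral_kernel hΛG, viewLaw,
            Measure.lintegral_compProd (hfm.lintegral_kernel.mul hΛG)]
          refine lintegral_congr fun h => lintegral_congr fun z => ?_
          have hFw : Measurable fun w => F (M.extend (h, (z, w))) :=
            hF.comp (M.measurable_extend.comp (by fun_prop))
          simp only [Pi.mul_apply, likelihoodRatio, lastView_extend]
          rw [lintegral_one_add _ hg hg2, lintegral_const_mul _ hFw,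
            ENNReal.ofReal_mul (likelihoodRatio_pos π hg2 t ht' h).le]
          ring

/-- The tower property: the posterior mean of a centred function averages to its prior mean. -/
lemma integral_posterior_eq_zero
    {t : ℕ} {ht : t < n₁} (hπ : IsPosterior (M.pairedLaw P P t ht.le) P (M.roundX t ht) (π t ht))
    (hg : Measurable g) (hg2 : ∀ x, |g x| ≤ 1 / 2) (hg0 : ∫ x, g x ∂P = 0) :
    ∫ q, ∫ x, g x ∂(π t ht q) ∂(viewLaw (M.pairedLaw P P t ht.le) P (M.roundX t ht)) = 0 := by
  have hi : Integrable (fun y : (M.History t × M.Z) × 𝒳 => g y.2)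
      (jointLaw (M.pairedLaw P P t ht.le) P (M.roundX t ht)) :=
    integrable_of_abs_le (hg.comp measurable_snd) fun y => hg2 y.2
  have h1 : ∫ y, g y.2 ∂(jointLaw (M.pairedLaw P P t ht.le) P (M.roundX t ht)) = 0 := by
    have := integral_map (μ := jointLaw (M.pairedLaw P P t ht.le) P (M.roundX t ht))
      measurable_snd.aemeasurable (f := g) hg.aestronglyMeasurable
    rw [← this, ← hg0]
    congr 1
    exact snd_jointLaw _ _ _
  rw [show jointLaw _ _ _ = _ from hπ] at hi h1
  rwa [Measure.integral_compProd hi] at h1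

lemma log_one_add_ge {r : ℝ} (hr : |r| ≤ 1 / 2) : r - 2 * r ^ 2 ≤ Real.log (1 + r) := by
  obtain ⟨h1, h2⟩ := abs_le.1 hr
  have h0 : 0 < 1 + r := by linarith
  refine le_trans ?_ (Real.one_sub_inv_le_log_of_pos h0)
  have : 1 - (1 + r)⁻¹ = r / (1 + r) := by field_simp; ring
  rw [this, le_div_iff₀ h0]
  nlinarith [mul_nonneg (sq_nonneg r) (show 0 ≤ 2 * r + 1 by linarith)]

/-- Lower bound on the expected log-likelihood ratio. -/
lemma integral_log_likelihoodRatio_ge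
    (hπ : ∀ t ht, IsPosterior (M.pairedLaw P P t ht.le) P (M.roundX t ht) (π t ht))
    (hg : Measurable g) (hg2 : ∀ x, |g x| ≤ 1 / 2) (hg0 : ∫ x, g x ∂P = 0) {e : ℕ → ℝ}
    (he : ∀ t ht, ∫ q, (∫ x, g x ∂(π t ht q)) ^ 2
      ∂(viewLaw (M.pairedLaw P P t ht.le) P (M.roundX t ht)) ≤ e t) (t : ℕ) (ht : t ≤ n₁) :
    -(2 * ∑ i ∈ Finset.range t, e i) ≤
      ∫ v, Real.log (likelihoodRatio π g t ht v) ∂(M.pairedLaw P P t ht) := by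
  induction t with
  | zero => simp [likelihoodRatio]
  | succ t ih =>
    have ht' := Nat.le_of_succ_le ht
    set ν := viewLaw (M.pairedLaw P P t ht') P (M.roundX t ht) with hν
    have hrm : Measurable fun q => ∫ x, g x ∂(π t ht q) :=
      hg.stronglyMeasurable.integral_kernel.measurable
    have hr2 : ∀ q, |∫ x, g x ∂(π t ht q)| ≤ 1 / 2 := fun q =>
      abs_integral_le_of_abs_le (π t ht q) hg2
    have hΛm := measurable_likelihoodRatio π hg t ht'
    have hlogb : ∀ v, |Real.log (likelihoodRatio π g t ht' v)| ≤ t := fun v => by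
      obtain ⟨h1, h2⟩ := likelihoodRatio_mem π hg2 t ht' v
      have h1' := Real.log_le_log (by positivity) h1
      have h2' := Real.log_le_log (likelihoodRatio_pos π hg2 t ht' v) h2
      rw [Real.log_pow] at h1' h2'
      have a : -1 ≤ Real.log (1 / 2) := by
        rw [one_div, Real.log_inv]; linarith [Real.log_two_lt_d9]
      have b : Real.log (3 / 2) ≤ 1 := by
        linarith [Real.log_le_sub_one_of_pos (show (0 : ℝ) < 3 / 2 by norm_num)]
      have ht0 : (0 : ℝ) ≤ t := t.cast_nonneg
      rw [abs_le]
      constructor <;> nlinarith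
    have hi1 : Integrable (fun q : M.History t × M.Z =>
        Real.log (likelihoodRatio π g t ht' q.1)) ν :=
      integrable_of_abs_le (hΛm.log.comp measurable_fst) fun q => hlogb q.1
    have hlb : ∀ q, |Real.log (1 + ∫ x, g x ∂(π t ht q))| ≤ 1 := fun q => by
      have h1 := abs_le.1 (hr2 q)
      have h2 := log_one_add_ge (hr2 q)
      have h3 := Real.log_le_sub_one_of_pos (show 0 < 1 + ∫ x, g x ∂(π t ht q) by linarith)
      rw [abs_le]
      constructor
      · nlinarith
      · linarith
    have hi2 : Integrable (fun q => Real.log (1 + ∫ x, g x ∂(π t ht q))) ν :=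
      integrable_of_abs_le (measurable_const.add hrm).log hlb
    have hi3 : Integrable (fun q => ∫ x, g x ∂(π t ht q)) ν := integrable_of_abs_le hrm hr2
    have hi4 : Integrable (fun q => (∫ x, g x ∂(π t ht q)) ^ 2) ν :=
      integrable_of_abs_le (B := 1) (hrm.pow_const 2) fun q => by
        rw [abs_pow]; exact pow_le_one₀ (abs_nonneg _) ((hr2 q).trans (by norm_num))
    have e0 : ∫ v, Real.log (likelihoodRatio π g (t + 1) ht v) ∂(M.pairedLaw P P (t + 1) ht) =
        ∫ q, (Real.log (likelihoodRatio π g t ht' q.1) +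
          Real.log (1 + ∫ x, g x ∂(π t ht q))) ∂ν := by
      rw [hν, ← pairedLaw_map_lastView, integral_map M.measurable_lastView.aemeasurable]
      · refine integral_congr_ae (Filter.Eventually.of_forall fun v => ?_)
        have h1 := abs_le.1 (hr2 (M.lastView v))
        simp only [likelihoodRatio]
        rw [Real.log_mul (likelihoodRatio_pos π hg2 t ht' _).ne' (by linarith)]
      · exact ((hΛm.log.comp measurable_fst).add
          (measurable_const.add hrm).log).aestronglyMeasurable
    have e1 : ∫ q, Real.log (likelihoodRatio π g t ht' q.1) ∂ν =
        ∫ v, Real.log (likelihoodRatio π g t ht' v) ∂(M.pairedLaw P P t ht') := by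
      have := integral_map (μ := ν) measurable_fst.aemeasurable
        (f := fun v => Real.log (likelihoodRatio π g t ht' v)) hΛm.log.aestronglyMeasurable
      rw [← this]
      congr 1
      exact Measure.fst_compProd _ _
    -- In log(1 + r) ≥ r − 2r² the linear term integrates to 0, so only the quadratic information is
    -- left.
    have e2 : -(2 * e t) ≤ ∫ q, Real.log (1 + ∫ x, g x ∂(π t ht q)) ∂ν := by
      have h1 : ∫ q, (∫ x, g x ∂(π t ht q) - 2 * (∫ x, g x ∂(π t ht q)) ^ 2) ∂ν ≤
          ∫ q, Real.log (1 + ∫ x, g x ∂(π t ht q)) ∂ν :=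
        integral_mono (hi3.sub (hi4.const_mul 2)) hi2 fun q => log_one_add_ge (hr2 q)
      rw [integral_sub hi3 (hi4.const_mul 2), integral_const_mul, integral_posterior_eq_zero π (hπ t ht) hg hg2 hg0] at h1
      linarith [he t ht]
    rw [e0, integral_add hi1 hi2, e1, Finset.sum_range_succ]
    linarith [ih ht']

/-- Upper bound on the correlation of two likelihood ratios of a non-interactive mechanism. -/
lemma integral_likelihoodRatio_mul_le (hM : M.IsNonInteractive)
    (π₀ : ∀ t, t < n₁ → Kernel M.Z 𝒳) [∀ t ht, IsMarkovKernel (π₀ t ht)]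
    (hπ : ∀ t ht, IsPosterior (M.pairedLaw P P t ht.le) P (M.roundX t ht)
      ((π₀ t ht).comap Prod.snd measurable_snd))
    {g' : 𝒳 → ℝ} (hg : Measurable g) (hg2 : ∀ x, |g x| ≤ 1 / 2) (hg0 : ∫ x, g x ∂P = 0)
    (hg' : Measurable g') (hg2' : ∀ x, |g' x| ≤ 1 / 2) (hg0' : ∫ x, g' x ∂P = 0) {e : ℕ → ℝ}
    (he : ∀ t ht, ∫ q, (∫ x, g x ∂(π₀ t ht q.2)) * (∫ x, g' x ∂(π₀ t ht q.2))
      ∂(viewLaw (M.pairedLaw P P t ht.le) P (M.roundX t ht)) ≤ e t) (t : ℕ) (ht : t ≤ n₁) :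
    ∫ v, likelihoodRatio (fun t ht => (π₀ t ht).comap Prod.snd measurable_snd) g t ht v *
        likelihoodRatio (fun t ht => (π₀ t ht).comap Prod.snd measurable_snd) g' t ht v
      ∂(M.pairedLaw P P t ht) ≤ Real.exp (∑ i ∈ Finset.range t, e i) := by
  set π : M.Posteriors := fun t ht => (π₀ t ht).comap Prod.snd measurable_snd with hπdef
  have hmk : ∀ t ht, IsMarkovKernel (π t ht) := fun t ht => by rw [hπdef]; infer_instance
  induction t with
  | zero => simp [likelihoodRatio]
  | succ t ih =>
    have ht' := Nat.le_of_succ_le ht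
    obtain ⟨h₀⟩ : Nonempty (M.History t) := (M.pairedLaw P P t ht').nonempty_of_neZero
    set ν := viewLaw (M.pairedLaw P P t ht') P (M.roundX t ht) with hν
    have hνp : ν = (M.pairedLaw P P t ht').prod (privatized P (M.roundX t ht) h₀) :=
      viewLaw_eq_prod _ _ (κ := M.roundX t ht) (hM.1 ⟨t, ht⟩) h₀
    set r : M.Z → ℝ := fun z => ∫ x, g x ∂(π₀ t ht z) with hr
    set r' : M.Z → ℝ := fun z => ∫ x, g' x ∂(π₀ t ht z) with hr'
    have hrm : Measurable r := hg.stronglyMeasurable.integral_kernel.measurable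
    have hrm' : Measurable r' := hg'.stronglyMeasurable.integral_kernel.measurable
    have hrb : ∀ z, |r z| ≤ 1 / 2 := fun z => abs_integral_le_of_abs_le (π₀ t ht z) hg2
    have hrb' : ∀ z, |r' z| ≤ 1 / 2 := fun z => abs_integral_le_of_abs_le (π₀ t ht z) hg2'
    have hΛm := measurable_likelihoodRatio π hg t ht'
    have hΛm' := measurable_likelihoodRatio π hg' t ht'
    -- Without interaction the new view is independent of the past, so the correlation factorizes
    -- over the rounds.
    have e0 : ∫ v, likelihoodRatio π g (t + 1) ht v * likelihoodRatio π g' (t + 1) ht v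
          ∂(M.pairedLaw P P (t + 1) ht) =
        (∫ v, likelihoodRatio π g t ht' v * likelihoodRatio π g' t ht' v ∂(M.pairedLaw P P t ht')) *
          ∫ z, (1 + r z) * (1 + r' z) ∂(privatized P (M.roundX t ht) h₀) := by
      rw [← integral_prod_mul, ← hνp, hν, ← pairedLaw_map_lastView,
        integral_map M.measurable_lastView.aemeasurable]
      · refine integral_congr_ae (Filter.Eventually.of_forall fun v => ?_)
        simp only [likelihoodRatio, hπdef, hr, hr', Kernel.comap_apply]
        ring
      · exact (((hΛm.comp measurable_fst).mul (hΛm'.comp measurable_fst)).mul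
          ((measurable_const.add (hrm.comp measurable_snd)).mul
            (measurable_const.add (hrm'.comp measurable_snd)))).aestronglyMeasurable
    have hsnd : ∀ {G : M.Z → ℝ}, Measurable G →
        ∫ q, G q.2 ∂ν = ∫ z, G z ∂(privatized P (M.roundX t ht) h₀) := fun {G} hG => by
      have := integral_map (μ := ν) measurable_snd.aemeasurable (f := G) hG.aestronglyMeasurable
      rw [← this, hνp]
      congr 1
      exact Measure.snd_prod
    have hi1 : Integrable r (privatized P (M.roundX t ht) h₀) := integrable_of_abs_le hrm hrb
    have hi2 : Integrable r' (privatized P (M.roundX t ht) h₀) := integrable_of_abs_le hrm' hrb'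
    have hi3 : Integrable (fun z => r z * r' z) (privatized P (M.roundX t ht) h₀) :=
      integrable_of_abs_le (B := 1) (hrm.mul hrm') fun z => by
        rw [abs_mul]; nlinarith [hrb z, hrb' z, abs_nonneg (r z), abs_nonneg (r' z)]
    -- The linear terms are centred; only the cross moment survives.
    have e1 : ∫ z, (1 + r z) * (1 + r' z) ∂(privatized P (M.roundX t ht) h₀) =
        1 + ∫ q, r q.2 * r' q.2 ∂ν := by
      have : ∀ z, (1 + r z) * (1 + r' z) = 1 + r z + r' z + r z * r' z := fun z => by ring
      simp only [this]
      have z1 := integral_posterior_eq_zero π (hπ t ht) hg hg2 hg0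
      have z2 := integral_posterior_eq_zero π (hπ t ht) hg' hg2' hg0'
      have z1' : ∫ z, r z ∂(privatized P (M.roundX t ht) h₀) = 0 := by
        rw [← hsnd hrm]; exact z1
      have z2' : ∫ z, r' z ∂(privatized P (M.roundX t ht) h₀) = 0 := by
        rw [← hsnd hrm']; exact z2
      have j1 : Integrable (fun z => 1 + r z) (privatized P (M.roundX t ht) h₀) :=
        (integrable_const 1).add hi1
      have j2 : Integrable (fun z => 1 + r z + r' z) (privatized P (M.roundX t ht) h₀) :=
        j1.add hi2
      rw [integral_add j2 hi3, integral_add j1 hi2, integral_add (integrable_const 1) hi1,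
        z1', z2', hsnd (G := fun z => r z * r' z) (hrm.mul hrm')]
      simp
    have hI0 : 0 ≤ ∫ v, likelihoodRatio π g t ht' v * likelihoodRatio π g' t ht' v
        ∂(M.pairedLaw P P t ht') := integral_nonneg fun v =>
      (mul_pos (likelihoodRatio_pos π hg2 t ht' v) (likelihoodRatio_pos π hg2' t ht' v)).le
    rw [e0, e1, Finset.sum_range_succ, Real.exp_add]
    refine (mul_le_mul_of_nonneg_left (b := 1 + ∫ q, r q.2 * r' q.2 ∂ν) (c := Real.exp (e t)) ?_
      hI0).trans (mul_le_mul_of_nonneg_right (ih ht') (Real.exp_pos _).le)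
    linarith [Real.add_one_le_exp (e t), he t ht]

end Mechanism

end LDPTwoSample

end

noncomputable section

namespace LDPTwoSample

/-! ### Tests cannot separate the null hypothesis from all the alternatives -/

/-- Bound on `|1 - x|` by the integrands of the Kullback–Leibler divergence and of the mass. -/
lemma abs_one_sub_le_log {x : ℝ} (hx : 0 < x) :
    |1 - x| ≤ 8 * (x - 1 - Real.log x) + (1 + x) / 16 := by
  have hs := Real.sqrt_pos.2 hx
  have hxs : x = √x * √x := (Real.mul_self_sqrt hx.le).symm
  have hlog : Real.log x ≤ 2 * (√x - 1) := by
    rw [show Real.log x = 2 * Real.log √x by rw [Real.log_sqrt hx.le]; ring]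
    linarith [Real.log_le_sub_one_of_pos hs]
  set y := √x
  -- With y = √x, the squared Hellinger integrand is below that of the divergence. The claim follows
  -- from |1 − x| = |1 − y|(1 + y) ≤ 8(1 − y)² + (1 + y)²/32 and (1 + y)² ≤ 2(1 + x).
  have h1 : (y - 1) ^ 2 ≤ x - 1 - Real.log x := by rw [hxs] at hlog ⊢; nlinarith
  rw [abs_le]
  constructor <;>
    nlinarith [sq_nonneg ((y - 1) - (1 + y) / 16), sq_nonneg ((1 - y) - (1 + y) / 16),
      sq_nonneg (1 - y)]

namespace Mechanism

variable {𝒳 : Type} [MeasurableSpace 𝒳] {n₁ m : ℕ} {M : Mechanism 𝒳 n₁ m}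
  {P : Measure 𝒳} [IsProbabilityMeasure P]

/-- As the law of the second sample is held fixed, everything after the paired rounds is one fixed
channel. The acceptance probability is the mean of one function of the paired views, for all laws of
the first sample at once. -/
lemma exists_acceptance (M : Mechanism 𝒳 n₁ m) (P : Measure 𝒳) [IsProbabilityMeasure P]
    {φ : M.Views → Bool} (hφ : Measurable φ) :
    ∃ G : M.History n₁ → ℝ, Measurable G ∧ (∀ v, 0 ≤ G v) ∧ (∀ v, G v ≤ 1) ∧
      ∀ (PX : Measure 𝒳) [IsProbabilityMeasure PX],
        M.law PX P {v | φ v = false} = ∫⁻ v, ENNReal.ofReal (G v) ∂(M.pairedLaw PX P n₁ le_rfl) := by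
  have hS : MeasurableSet {v | φ v = false} := hφ (measurableSet_singleton false)
  obtain ⟨G, hG, hG1, h⟩ := M.exists_lintegral_extendedLaw_eq P m le_rfl
    (F := {v | φ v = false}.indicator 1) (measurable_one.indicator hS)
    (fun v => Set.indicator_le_self' (fun _ _ => zero_le) v)
  have htop : ∀ v, G v ≠ ⊤ := fun v => ne_top_of_le_ne_top ENNReal.one_ne_top (hG1 v)
  refine ⟨fun v => (G v).toReal, hG.ennreal_toReal, fun v => ENNReal.toReal_nonneg, fun v => ?_,
    fun PX _ => ?_⟩
  · exact ENNReal.toReal_le_of_le_ofReal zero_le_one (by simpa using hG1 v)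
  · have := h PX
    rw [lintegral_indicator_one hS] at this
    simp only [ENNReal.ofReal_toReal (htop _)]
    exact this

variable (π : M.Posteriors) [hmk : ∀ t ht, IsMarkovKernel (π t ht)] {g : 𝒳 → ℝ}

lemma integrable_likelihoodRatio (hg : Measurable g) (hg2 : ∀ x, |g x| ≤ 1 / 2) (t : ℕ)
    (ht : t ≤ n₁) : Integrable (likelihoodRatio π g t ht) (M.pairedLaw P P t ht) :=
  integrable_of_abs_le (measurable_likelihoodRatio π hg t ht) (abs_likelihoodRatio_le π hg2 t ht)

lemma lintegral_eq_integral_likelihoodRatio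
    (hπ : ∀ t ht, IsPosterior (M.pairedLaw P P t ht.le) P (M.roundX t ht) (π t ht))
    (hg : Measurable g) (hg2 : ∀ x, |g x| ≤ 1 / 2) (hg0 : ∫ x, g x ∂P = 0)
    {G : M.History n₁ → ℝ} (hG : Measurable G) (hG0 : ∀ v, 0 ≤ G v) (hG1 : ∀ v, G v ≤ 1) :
    ∫⁻ v, ENNReal.ofReal (G v)
        ∂(M.pairedLaw (P.withDensity fun x => ENNReal.ofReal (1 + g x)) P n₁ le_rfl) =
      ENNReal.ofReal
        (∫ v, G v * likelihoodRatio π g n₁ le_rfl v ∂(M.pairedLaw P P n₁ le_rfl)) := by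
  have hΛ := (measurable_likelihoodRatio π hg n₁ le_rfl).ennreal_ofReal
  rw [pairedLaw_eq_withDensity π hπ hg hg2 hg0,
    lintegral_withDensity_eq_lintegral_mul _ hΛ hG.ennreal_ofReal,
    ofReal_integral_eq_lintegral_ofReal]
  · refine lintegral_congr fun v => ?_
    rw [Pi.mul_apply, ENNReal.ofReal_mul (hG0 v), mul_comm]
  · refine (integrable_likelihoodRatio π hg hg2 n₁ le_rfl).bdd_mul (c := 1)
      hG.aestronglyMeasurable (Filter.Eventually.of_forall fun v => ?_)
    rw [Real.norm_eq_abs, abs_of_nonneg (hG0 v)]; exact hG1 v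
  · exact Filter.Eventually.of_forall fun v =>
      mul_nonneg (hG0 v) (likelihoodRatio_pos π hg2 n₁ le_rfl v).le

lemma integral_likelihoodRatio
    (hπ : ∀ t ht, IsPosterior (M.pairedLaw P P t ht.le) P (M.roundX t ht) (π t ht))
    (hg : Measurable g) (hg2 : ∀ x, |g x| ≤ 1 / 2) (hg0 : ∫ x, g x ∂P = 0) :
    ∫ v, likelihoodRatio π g n₁ le_rfl v ∂(M.pairedLaw P P n₁ le_rfl) = 1 := by
  have := isProbabilityMeasure_withDensity hg hg2 hg0
  have h := lintegral_eq_integral_likelihoodRatio π hπ hg hg2 hg0 (G := fun _ => 1)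
    measurable_const (fun _ => zero_le_one) (fun _ => le_rfl)
  simp only [ENNReal.ofReal_one, lintegral_const, measure_univ, mul_one, one_mul] at h
  have h2 := congrArg ENNReal.toReal h
  rw [ENNReal.toReal_one, ENNReal.toReal_ofReal (integral_nonneg fun v =>
      (likelihoodRatio_pos π hg2 n₁ le_rfl v).le)] at h2
  exact h2.symm

lemma integral_mul_sub_le {Ω : Type} [MeasurableSpace Ω] {μ : Measure Ω} [IsProbabilityMeasure μ]
    {G Λ : Ω → ℝ} (hG : Measurable G) (hG0 : ∀ v, 0 ≤ G v) (hG1 : ∀ v, G v ≤ 1)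
    (hΛ : Integrable Λ μ) :
    ∫ v, G v ∂μ - ∫ v, G v * Λ v ∂μ ≤ ∫ v, |1 - Λ v| ∂μ := by
  have hb : ∀ v, |G v| ≤ 1 := fun v => by rw [abs_of_nonneg (hG0 v)]; exact hG1 v
  have h1 : Integrable (fun v => G v * Λ v) μ :=
    hΛ.bdd_mul (c := 1) hG.aestronglyMeasurable (Filter.Eventually.of_forall hb)
  have h2 : Integrable G μ := integrable_of_abs_le hG hb
  have h3 : Integrable (fun v => |1 - Λ v|) μ := ((integrable_const 1).sub hΛ).abs
  rw [← integral_sub h2 h1]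
  refine integral_mono (h2.sub h1) h3 fun v => ?_
  calc G v - G v * Λ v = G v * (1 - Λ v) := by ring
    _ ≤ |G v * (1 - Λ v)| := le_abs_self _
    _ = |G v| * |1 - Λ v| := abs_mul _ _
    _ ≤ 1 * |1 - Λ v| := mul_le_mul_of_nonneg_right (hb v) (abs_nonneg _)
    _ = _ := one_mul _

variable {Θ : Type} {𝒢 : Finset Θ} {f : Θ → 𝒳 → ℝ}

/-- If some average of the alternatives is hard to tell from the null hypothesis, so is one of
them. -/
lemma exists_law_ge_of_integral_le
    (hπ : ∀ t ht, IsPosterior (M.pairedLaw P P t ht.le) P (M.roundX t ht) (π t ht))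
    (hne : 𝒢.Nonempty) (hf : ∀ θ ∈ 𝒢, Measurable (f θ)) (hf2 : ∀ θ ∈ 𝒢, ∀ x, |f θ x| ≤ 1 / 2)
    (hf0 : ∀ θ ∈ 𝒢, ∫ x, f θ x ∂P = 0)
    (h : ∫ v, |1 - (𝒢.card : ℝ)⁻¹ * ∑ θ ∈ 𝒢, likelihoodRatio π (f θ) n₁ le_rfl v|
      ∂(M.pairedLaw P P n₁ le_rfl) ≤ 1 / 4) {φ : M.Views → Bool} (hφ : Measurable φ) :
    ∃ θ ∈ 𝒢, M.law P P {v | φ v = false} ≤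
      M.law (P.withDensity fun x => ENNReal.ofReal (1 + f θ x)) P {v | φ v = false} +
        ENNReal.ofReal (1 / 4) := by
  obtain ⟨G, hG, hG0, hG1, hlaw⟩ := exists_acceptance M P hφ
  set μ := M.pairedLaw P P n₁ le_rfl with hμ
  have hc : (0 : ℝ) < 𝒢.card := by exact_mod_cast hne.card_pos
  have hΛi : ∀ θ ∈ 𝒢, Integrable (likelihoodRatio π (f θ) n₁ le_rfl) μ := fun θ hθ =>
    integrable_likelihoodRatio π (hf θ hθ) (hf2 θ hθ) n₁ le_rfl
  have hb : ∀ v, |G v| ≤ 1 := fun v => by rw [abs_of_nonneg (hG0 v)]; exact hG1 v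
  have hGΛ : ∀ θ ∈ 𝒢, Integrable (fun v => G v * likelihoodRatio π (f θ) n₁ le_rfl v) μ :=
    fun θ hθ => (hΛi θ hθ).bdd_mul (c := 1) hG.aestronglyMeasurable
      (Filter.Eventually.of_forall hb)
  have hbar : Integrable
      (fun v => (𝒢.card : ℝ)⁻¹ * ∑ θ ∈ 𝒢, likelihoodRatio π (f θ) n₁ le_rfl v) μ :=
    (integrable_finsetSum _ hΛi).const_mul _
  have key := integral_mul_sub_le hG hG0 hG1 hbar
  have e1 : ∫ v, G v * ((𝒢.card : ℝ)⁻¹ * ∑ θ ∈ 𝒢, likelihoodRatio π (f θ) n₁ le_rfl v) ∂μ =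
      (𝒢.card : ℝ)⁻¹ * ∑ θ ∈ 𝒢, ∫ v, G v * likelihoodRatio π (f θ) n₁ le_rfl v ∂μ := by
    rw [← integral_finsetSum _ hGΛ, ← integral_const_mul]
    refine integral_congr_ae (Filter.Eventually.of_forall fun v => ?_)
    simp only []
    rw [mul_left_comm, Finset.mul_sum]
  rw [e1] at key
  have hsum : ∑ θ ∈ 𝒢, (∫ v, G v ∂μ - 1 / 4) ≤
      ∑ θ ∈ 𝒢, ∫ v, G v * likelihoodRatio π (f θ) n₁ le_rfl v ∂μ := by
    rw [Finset.sum_const, nsmul_eq_mul]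
    have h1 : ∫ v, G v ∂μ - 1 / 4 ≤
        (𝒢.card : ℝ)⁻¹ * ∑ θ ∈ 𝒢, ∫ v, G v * likelihoodRatio π (f θ) n₁ le_rfl v ∂μ := by
      linarith
    rwa [le_inv_mul_iff₀ hc] at h1
  -- An average over `𝒢` is attained or exceeded by some member.
  obtain ⟨θ, hθ, hle⟩ := Finset.exists_le_of_sum_le hne hsum
  refine ⟨θ, hθ, ?_⟩
  have := isProbabilityMeasure_withDensity (hf θ hθ) (hf2 θ hθ) (hf0 θ hθ)
  rw [hlaw P, hlaw _, lintegral_eq_integral_likelihoodRatio π hπ (hf θ hθ) (hf2 θ hθ) (hf0 θ hθ)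
    hG hG0 hG1, ← ofReal_integral_eq_lintegral_ofReal (integrable_of_abs_le hG hb)
    (Filter.Eventually.of_forall hG0), ← ENNReal.ofReal_add _ (by norm_num)]
  · exact ENNReal.ofReal_le_ofReal (by linarith)
  · exact integral_nonneg fun v => mul_nonneg (hG0 v)
      (likelihoodRatio_pos π (hf2 θ hθ) n₁ le_rfl v).le

/-- Indistinguishability from a bound on the average information per round. -/
lemma exists_law_ge_of_information
    (hπ : ∀ t ht, IsPosterior (M.pairedLaw P P t ht.le) P (M.roundX t ht) (π t ht))
    (hne : 𝒢.Nonempty) (hf : ∀ θ ∈ 𝒢, Measurable (f θ)) (hf2 : ∀ θ ∈ 𝒢, ∀ x, |f θ x| ≤ 1 / 2)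
    (hf0 : ∀ θ ∈ 𝒢, ∫ x, f θ x ∂P = 0) {δ : ℝ}
    (hδ : ∀ t ht, ∑ θ ∈ 𝒢, ∫ q, (∫ x, f θ x ∂(π t ht q)) ^ 2
      ∂(viewLaw (M.pairedLaw P P t ht.le) P (M.roundX t ht)) ≤ 𝒢.card * δ)
    (hn : n₁ * δ ≤ 1 / 128) {φ : M.Views → Bool} (hφ : Measurable φ) :
    ∃ θ ∈ 𝒢, M.law P P {v | φ v = false} ≤
      M.law (P.withDensity fun x => ENNReal.ofReal (1 + f θ x)) P {v | φ v = false} +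
        ENNReal.ofReal (1 / 4) := by
  set e : Θ → ℕ → ℝ := fun θ t => if ht : t < n₁ then ∫ q, (∫ x, f θ x ∂(π t ht q)) ^ 2
      ∂(viewLaw (M.pairedLaw P P t ht.le) P (M.roundX t ht)) else 0 with he
  have hsum : ∑ θ ∈ 𝒢, ∑ t ∈ Finset.range n₁, e θ t ≤ ∑ θ ∈ 𝒢, (1 / 128 : ℝ) := by
    rw [Finset.sum_comm, Finset.sum_const, nsmul_eq_mul]
    calc ∑ t ∈ Finset.range n₁, ∑ θ ∈ 𝒢, e θ t ≤ ∑ t ∈ Finset.range n₁, 𝒢.card * δ := by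
          refine Finset.sum_le_sum fun t ht => ?_
          have ht' := Finset.mem_range.1 ht
          simp only [he, dif_pos ht']
          exact hδ t ht'
      _ = 𝒢.card * (n₁ * δ) := by rw [Finset.sum_const, Finset.card_range, nsmul_eq_mul]; ring
      _ ≤ _ := by gcongr
  -- Some θ has total information at most its average over `𝒢`; the mixture is not needed, since a
  -- single alternative is already close to the null.
  obtain ⟨θ, hθ, hle⟩ := Finset.exists_le_of_sum_le hne hsum
  have hlog := integral_log_likelihoodRatio_ge π hπ (hf θ hθ) (hf2 θ hθ) (hf0 θ hθ) (e := e θ)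
    (fun t ht => by simp only [he, dif_pos ht]; exact le_rfl) n₁ le_rfl
  set μ := M.pairedLaw P P n₁ le_rfl with hμ
  set Λ := likelihoodRatio π (f θ) n₁ le_rfl with hΛ
  have hΛi : Integrable Λ μ := integrable_likelihoodRatio π (hf θ hθ) (hf2 θ hθ) n₁ le_rfl
  have hΛ1 : ∫ v, Λ v ∂μ = 1 := integral_likelihoodRatio π hπ (hf θ hθ) (hf2 θ hθ) (hf0 θ hθ)
  have hΛpos : ∀ v, 0 < Λ v := likelihoodRatio_pos π (hf2 θ hθ) n₁ le_rfl
  have hlogi : Integrable (fun v => Real.log (Λ v)) μ := by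
    refine integrable_of_abs_le (B := n₁)
      (measurable_likelihoodRatio π (hf θ hθ) n₁ le_rfl).log fun v => ?_
    obtain ⟨h1, h2⟩ := likelihoodRatio_mem π (hf2 θ hθ) n₁ le_rfl v
    have h1' := Real.log_le_log (by positivity) h1
    have h2' := Real.log_le_log (hΛpos v) h2
    rw [Real.log_pow] at h1' h2'
    have a : -1 ≤ Real.log (1 / 2) := by
      rw [one_div, Real.log_inv]; linarith [Real.log_two_lt_d9]
    have b : Real.log (3 / 2) ≤ 1 := by
      linarith [Real.log_le_sub_one_of_pos (show (0 : ℝ) < 3 / 2 by norm_num)]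
    have ht0 : (0 : ℝ) ≤ n₁ := n₁.cast_nonneg
    rw [abs_le]
    constructor <;> nlinarith
  -- The divergence is at most 2/128, so `abs_one_sub_le_log` gives 8·(1/64) + 2/16 = 1/4.
  have htv : ∫ v, |1 - Λ v| ∂μ ≤ 1 / 4 := by
    have hi1 : Integrable (fun v => 8 * (Λ v - 1 - Real.log (Λ v))) μ :=
      ((hΛi.sub (integrable_const 1)).sub hlogi).const_mul _
    have hi2 : Integrable (fun v => (1 + Λ v) / 16) μ :=
      ((integrable_const 1).add hΛi).div_const _
    calc ∫ v, |1 - Λ v| ∂μ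
        ≤ ∫ v, (8 * (Λ v - 1 - Real.log (Λ v)) + (1 + Λ v) / 16) ∂μ :=
          integral_mono ((integrable_const 1).sub hΛi).abs (hi1.add hi2)
            fun v => abs_one_sub_le_log (hΛpos v)
      _ = 8 * (-∫ v, Real.log (Λ v) ∂μ) + 1 / 8 := by
          rw [integral_add hi1 hi2, integral_const_mul,
            integral_sub (f := fun v => Λ v - 1) (hΛi.sub (integrable_const 1)) hlogi,
            integral_sub hΛi (integrable_const 1), integral_div,
            integral_add (integrable_const 1) hΛi, hΛ1]
          simp
          ring
      _ ≤ 1 / 4 := by linarith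
  obtain ⟨θ', hθ', h⟩ := exists_law_ge_of_integral_le (𝒢 := {θ}) (f := f) π hπ (by simp)
    (by simpa using hf θ hθ) (by simpa using hf2 θ hθ) (by simpa using hf0 θ hθ)
    (by simpa using htv) hφ
  rw [Finset.mem_singleton] at hθ'
  exact ⟨θ, hθ, hθ' ▸ h⟩

/-- Indistinguishability from a bound on the correlations of the likelihood ratios. -/
lemma exists_law_ge_of_correlation
    (hπ : ∀ t ht, IsPosterior (M.pairedLaw P P t ht.le) P (M.roundX t ht) (π t ht))
    (hne : 𝒢.Nonempty) (hf : ∀ θ ∈ 𝒢, Measurable (f θ)) (hf2 : ∀ θ ∈ 𝒢, ∀ x, |f θ x| ≤ 1 / 2)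
    (hf0 : ∀ θ ∈ 𝒢, ∫ x, f θ x ∂P = 0)
    (hcorr : ∑ θ ∈ 𝒢, ∑ θ' ∈ 𝒢, ∫ v, likelihoodRatio π (f θ) n₁ le_rfl v *
      likelihoodRatio π (f θ') n₁ le_rfl v ∂(M.pairedLaw P P n₁ le_rfl) ≤
        (𝒢.card : ℝ) ^ 2 * (1 + 1 / 16)) {φ : M.Views → Bool} (hφ : Measurable φ) :
    ∃ θ ∈ 𝒢, M.law P P {v | φ v = false} ≤
      M.law (P.withDensity fun x => ENNReal.ofReal (1 + f θ x)) P {v | φ v = false} +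
        ENNReal.ofReal (1 / 4) := by
  refine exists_law_ge_of_integral_le π hπ hne hf hf2 hf0 ?_ hφ
  set μ := M.pairedLaw P P n₁ le_rfl with hμ
  set Λ : Θ → M.History n₁ → ℝ := fun θ => likelihoodRatio π (f θ) n₁ le_rfl with hΛ
  have hc : (0 : ℝ) < 𝒢.card := by exact_mod_cast hne.card_pos
  have hΛi : ∀ θ ∈ 𝒢, Integrable (Λ θ) μ := fun θ hθ =>
    integrable_likelihoodRatio π (hf θ hθ) (hf2 θ hθ) n₁ le_rfl
  have hΛΛ : ∀ θ ∈ 𝒢, ∀ θ' ∈ 𝒢, Integrable (fun v => Λ θ v * Λ θ' v) μ := fun θ hθ θ' hθ' =>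
    (hΛi θ' hθ').bdd_mul (c := (3 / 2) ^ n₁)
      (measurable_likelihoodRatio π (hf θ hθ) n₁ le_rfl).aestronglyMeasurable
      (Filter.Eventually.of_forall (abs_likelihoodRatio_le π (hf2 θ hθ) n₁ le_rfl))
  have hΛ1 : ∀ θ ∈ 𝒢, ∫ v, Λ θ v ∂μ = 1 := fun θ hθ =>
    integral_likelihoodRatio π hπ (hf θ hθ) (hf2 θ hθ) (hf0 θ hθ)
  set a : ℝ := (𝒢.card : ℝ)⁻¹ with ha
  have hbar : Integrable (fun v => a * ∑ θ ∈ 𝒢, Λ θ v) μ :=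
    (integrable_finsetSum _ hΛi).const_mul _
  have hbar2 : Integrable (fun v => a ^ 2 * ∑ θ ∈ 𝒢, ∑ θ' ∈ 𝒢, Λ θ v * Λ θ' v) μ :=
    (integrable_finsetSum _ fun θ hθ => integrable_finsetSum _ fun θ' hθ' =>
      hΛΛ θ hθ θ' hθ').const_mul _
  have hsq : ∀ v, (1 - a * ∑ θ ∈ 𝒢, Λ θ v) ^ 2 =
      1 - 2 * (a * ∑ θ ∈ 𝒢, Λ θ v) + a ^ 2 * ∑ θ ∈ 𝒢, ∑ θ' ∈ 𝒢, Λ θ v * Λ θ' v := fun v => by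
    rw [← Finset.sum_mul_sum]; ring
  have j1 : Integrable (fun v => 1 - 2 * (a * ∑ θ ∈ 𝒢, Λ θ v)) μ :=
    (integrable_const 1).sub (hbar.const_mul 2)
  have j2 : Integrable (fun v => (1 - a * ∑ θ ∈ 𝒢, Λ θ v) ^ 2) μ := by
    simp only [hsq]; exact j1.add hbar2
  -- Each likelihood ratio has mean 1, so E(1 − Λ̄)² = EΛ̄² − 1 ≤ 1/16 for the average Λ̄, and the
  -- L₁ distance is at most 1/4.
  have h1 := sq_integral_abs_le (F := fun v => 1 - a * ∑ θ ∈ 𝒢, Λ θ v)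
    ((integrable_const 1).sub hbar) j2
  have h2 : ∫ v, (1 - a * ∑ θ ∈ 𝒢, Λ θ v) ^ 2 ∂μ ≤ 1 / 16 := by
    simp only [hsq]
    rw [integral_add j1 hbar2, integral_sub (integrable_const 1) (hbar.const_mul 2),
      integral_const_mul, integral_const_mul, integral_const_mul, integral_finsetSum _ hΛi,
      Finset.sum_congr rfl hΛ1, integral_finsetSum _ fun θ hθ => integrable_finsetSum _
        fun θ' hθ' => hΛΛ θ hθ θ' hθ',
      Finset.sum_congr rfl fun θ hθ => integral_finsetSum _ (hΛΛ θ hθ)]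
    have h3 : a ^ 2 * ∑ θ ∈ 𝒢, ∑ θ' ∈ 𝒢, ∫ v, Λ θ v * Λ θ' v ∂μ ≤ 1 + 1 / 16 := by
      rw [ha, inv_pow, inv_mul_le_iff₀ (by positivity)]; exact hcorr
    have h4 : a * ∑ _θ ∈ 𝒢, (1 : ℝ) = 1 := by
      rw [Finset.sum_const, nsmul_eq_mul, mul_one, ha, inv_mul_cancel₀ hc.ne']
    rw [h4]
    simp
    linarith
  have h5 := h1.trans h2
  have h6 : 0 ≤ ∫ v, |1 - a * ∑ θ ∈ 𝒢, Λ θ v| ∂μ := integral_nonneg fun v => abs_nonneg _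
  exact abs_le_of_sq_le_sq' (by linarith) (by norm_num) |>.2

end Mechanism

end LDPTwoSample

end

noncomputable section

namespace LDPTwoSample

/-! ### Random signs -/

section Signs

variable {ι : Type} [Fintype ι] [DecidableEq ι]

/-- Independent signs: the sum factorizes into hyperbolic cosines, and cosh c ≤ e^{c²/2}. -/
lemma sum_exp_bitSign_le (c : ι → ℝ) :
    ∑ θ : ι → Bool, Real.exp (∑ k, bitSign (θ k) * c k) ≤
      2 ^ Fintype.card ι * Real.exp ((∑ k, c k ^ 2) / 2) := by
  have h1 : ∑ θ : ι → Bool, Real.exp (∑ k, bitSign (θ k) * c k) =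
      ∏ k, ∑ b : Bool, Real.exp (bitSign b * c k) := by
    rw [Finset.prod_univ_sum, Fintype.piFinset_univ]
    exact Finset.sum_congr rfl fun θ _ => Real.exp_sum _ _
  have h2 : ∀ k, ∑ b : Bool, Real.exp (bitSign b * c k) = 2 * Real.cosh (c k) := fun k => by
    rw [Real.cosh_eq]; simp [bitSign]; ring
  simp only [h1, h2]
  rw [Finset.prod_mul_distrib, Finset.prod_const, Finset.card_univ, Finset.sum_div, Real.exp_sum]
  gcongr with k _
  exact Real.cosh_le_exp_half_sq _

/-- Hoeffding's inequality for random signs. -/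
lemma card_lt_abs_sum_le (c : ι → ℝ) {S u : ℝ} (hS : 0 < S) (hc : ∑ k, c k ^ 2 ≤ S) (hu : 0 ≤ u) :
    ((Finset.univ.filter fun θ : ι → Bool => u * √S < |∑ k, bitSign (θ k) * c k|).card : ℝ) ≤
      2 ^ Fintype.card ι * (2 * Real.exp (-(u ^ 2 / 2))) := by
  set A := Finset.univ.filter fun θ : ι → Bool => u * √S < |∑ k, bitSign (θ k) * c k|
  set X : (ι → Bool) → ℝ := fun θ => ∑ k, bitSign (θ k) * c k with hX
  have hsS := Real.sqrt_pos.2 hS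
  set lam := u / √S with hlam
  have hlam0 : 0 ≤ lam := div_nonneg hu hsS.le
  have hmul : ∀ (t : ℝ) θ, t * X θ = ∑ k, bitSign (θ k) * (t * c k) := fun t θ => by
    rw [hX, Finset.mul_sum]; exact Finset.sum_congr rfl fun k _ => by ring
  have hbound : ∀ t : ℝ, t ^ 2 = lam ^ 2 → ∑ θ, Real.exp (t * X θ) ≤
      2 ^ Fintype.card ι * Real.exp (u ^ 2 / 2) := fun t ht => by
    simp only [hmul]
    refine (sum_exp_bitSign_le _).trans ?_
    gcongr
    calc ∑ k, (t * c k) ^ 2 = lam ^ 2 * ∑ k, c k ^ 2 := by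
          rw [← ht, Finset.mul_sum]; exact Finset.sum_congr rfl fun k _ => by ring
      _ ≤ lam ^ 2 * S := by gcongr
      _ = u ^ 2 := by rw [hlam, div_pow, Real.sq_sqrt hS.le]; field_simp
  have h1 : (A.card : ℝ) * Real.exp (u ^ 2) ≤
      2 * (2 ^ Fintype.card ι * Real.exp (u ^ 2 / 2)) := by
    calc (A.card : ℝ) * Real.exp (u ^ 2) = ∑ θ ∈ A, Real.exp (u ^ 2) := by
          rw [Finset.sum_const, nsmul_eq_mul]
      _ ≤ ∑ θ ∈ A, (Real.exp (lam * X θ) + Real.exp (-lam * X θ)) := by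
          refine Finset.sum_le_sum fun θ hθ => ?_
          have hθ' : u * √S < |X θ| := (Finset.mem_filter.1 hθ).2
          have h2 : u ^ 2 ≤ lam * |X θ| := by
            have := mul_le_mul_of_nonneg_left hθ'.le hlam0
            have e : lam * (u * √S) = u ^ 2 := by rw [hlam]; field_simp
            linarith
          refine (Real.exp_le_exp.2 h2).trans ?_
          rcases abs_cases (X θ) with ⟨h, _⟩ | ⟨h, _⟩
          · rw [h]; linarith [Real.exp_pos (-lam * X θ)]
          · rw [h, mul_neg, ← neg_mul]; linarith [Real.exp_pos (lam * X θ)]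
      _ ≤ ∑ θ, (Real.exp (lam * X θ) + Real.exp (-lam * X θ)) :=
          Finset.sum_le_sum_of_subset_of_nonneg (Finset.subset_univ _) fun θ _ _ => by positivity
      _ ≤ _ := by
          rw [Finset.sum_add_distrib]
          linarith [hbound lam rfl, hbound (-lam) (by ring)]
  have h3 : Real.exp (-(u ^ 2 / 2)) = Real.exp (u ^ 2 / 2) / Real.exp (u ^ 2) := by
    rw [← Real.exp_sub]; congr 1; ring
  rw [h3, ← mul_div_assoc, ← mul_div_assoc, le_div_iff₀ (Real.exp_pos _)]
  linarith

/-- For k ≠ j, flipping the k-th sign is an involution that reverses the summand. -/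
lemma sum_bitSign_mul (k j : ι) :
    ∑ θ : ι → Bool, bitSign (θ k) * bitSign (θ j) = if k = j then 2 ^ Fintype.card ι else 0 := by
  have hsq : ∀ b, bitSign b * bitSign b = 1 := by intro b; cases b <;> simp [bitSign]
  have hnot : ∀ b, bitSign (!b) = -bitSign b := by intro b; cases b <;> simp [bitSign]
  split_ifs with h
  · subst h; simp [hsq]
  · have hinv : Function.Involutive fun θ : ι → Bool => Function.update θ k (!θ k) := fun θ => by
      simp
    have := Equiv.sum_comp hinv.toPerm fun θ : ι → Bool => bitSign (θ k) * bitSign (θ j)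
    simp only [Function.Involutive.coe_toPerm, Function.update_self,
      Function.update_of_ne (Ne.symm h), hnot, neg_mul, Finset.sum_neg_distrib] at this
    linarith

lemma sum_sq_sum_bitSign (b : ι → ℝ) :
    ∑ θ : ι → Bool, (∑ k, bitSign (θ k) * b k) ^ 2 = 2 ^ Fintype.card ι * ∑ k, b k ^ 2 := by
  have : ∀ θ : ι → Bool, (∑ k, bitSign (θ k) * b k) ^ 2 =
      ∑ k, ∑ j, bitSign (θ k) * bitSign (θ j) * (b k * b j) := fun θ => by
    rw [pow_two, Finset.sum_mul_sum]
    exact Finset.sum_congr rfl fun k _ => Finset.sum_congr rfl fun j _ => by ring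
  simp only [this]
  rw [Finset.sum_comm, Finset.mul_sum]
  refine Finset.sum_congr rfl fun k _ => ?_
  rw [Finset.sum_comm]
  simp only [← Finset.sum_mul, sum_bitSign_mul]
  simp [pow_two]

end Signs

/-- Bessel's inequality for an orthonormal family of vectors. -/
lemma sum_sq_inner_le {ι κ : Type} [Fintype ι] [DecidableEq ι] [Fintype κ] (V : ι → κ → ℝ)
    (hV : ∀ k k', ∑ l, V k l * V k' l = if k = k' then 1 else 0) (w : κ → ℝ) :
    ∑ k, (∑ l, V k l * w l) ^ 2 ≤ ∑ l, w l ^ 2 := by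
  set c : ι → ℝ := fun k => ∑ l, V k l * w l with hc
  have h0 : 0 ≤ ∑ l, (w l - ∑ k, c k * V k l) ^ 2 := Finset.sum_nonneg fun l _ => sq_nonneg _
  have e1 : ∑ l, w l * ∑ k, c k * V k l = ∑ k, c k ^ 2 := by
    simp only [Finset.mul_sum]
    rw [Finset.sum_comm]
    refine Finset.sum_congr rfl fun k _ => ?_
    rw [pow_two, hc, Finset.mul_sum]
    exact Finset.sum_congr rfl fun l _ => by ring
  have e2 : ∑ l, (∑ k, c k * V k l) ^ 2 = ∑ k, c k ^ 2 := by
    have : ∀ l, (∑ k, c k * V k l) ^ 2 = ∑ k, ∑ j, c k * c j * (V k l * V j l) := fun l => by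
      rw [pow_two, Finset.sum_mul_sum]
      exact Finset.sum_congr rfl fun k _ => Finset.sum_congr rfl fun j _ => by ring
    simp only [this]
    rw [Finset.sum_comm]
    refine Finset.sum_congr rfl fun k _ => ?_
    rw [Finset.sum_comm]
    simp only [← Finset.mul_sum, hV]
    simp [pow_two]
  have : ∑ l, (w l - ∑ k, c k * V k l) ^ 2 = ∑ l, w l ^ 2 - 2 * ∑ l, w l * ∑ k, c k * V k l +
      ∑ l, (∑ k, c k * V k l) ^ 2 := by
    rw [Finset.mul_sum, ← Finset.sum_sub_distrib, ← Finset.sum_add_distrib]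
    exact Finset.sum_congr rfl fun l _ => by ring
  rw [this, e1, e2] at h0
  linarith

/-! ### Random perturbations of the uniform density -/

variable {d : ℕ}

/-- The multi-indices of `{1,…,L}^d`. -/
def freq {L : ℕ} (l : Fin d → Fin L) : Fin d → ℕ := fun j => l j + 1

lemma freq_injective {L : ℕ} : Function.Injective (freq (d := d) (L := L)) := fun l l' h =>
  funext fun j => Fin.ext (by have := congrFun h j; simpa [freq] using this)

lemma freq_ne_zero (hd : 1 ≤ d) {L : ℕ} (l : Fin d → Fin L) : freq l ≠ 0 := fun h => by
  have := congrFun h ⟨0, hd⟩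
  simp [freq] at this

lemma indexNorm_freq_le {L : ℕ} (l : Fin d → Fin L) : indexNorm (freq l) ≤ √d * L := by
  unfold indexNorm
  rw [show (√d * L : ℝ) = √(d * L ^ 2) by
    rw [Real.sqrt_mul (by positivity), Real.sqrt_sq (by positivity)]]
  refine Real.sqrt_le_sqrt ?_
  calc ∑ j, ((freq l j : ℕ) : ℝ) ^ 2 ≤ ∑ _j : Fin d, (L : ℝ) ^ 2 := by
        gcongr with j
        have : freq l j ≤ L := (l j).2
        exact_mod_cast this
    _ = _ := by simp

section Perturbation

variable {L : ℕ} {ι : Type} [Fintype ι] [DecidableEq ι] (V : ι → (Fin d → Fin L) → ℝ) (γ : ℝ)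

/-- The `k`-th element of the rotated basis. -/
def rotated (k : ι) (x : Cube d) : ℝ := ∑ l, V k l * trigProd (freq l) x

/-- The perturbation with signs `θ`. -/
def perturb (θ : ι → Bool) (x : Cube d) : ℝ := γ * ∑ k, bitSign (θ k) * rotated V k x

/-- The Fourier coefficients of the perturbation with signs `θ`. -/
def perturbCoeff (θ : ι → Bool) (l : Fin d → Fin L) : ℝ := γ * ∑ k, bitSign (θ k) * V k l

-- The two forms of a perturbation: in the rotated basis its coefficients are independent signs, and
-- in the trigonometric basis it can be measured in Sobolev norm and controlled on a grid.
omit [DecidableEq ι] in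
lemma perturb_eq (θ : ι → Bool) (x : Cube d) :
    perturb V γ θ x = ∑ l, perturbCoeff V γ θ l * trigProd (freq l) x := by
  unfold perturb perturbCoeff rotated
  simp only [Finset.mul_sum, Finset.sum_mul]
  rw [Finset.sum_comm]
  exact Finset.sum_congr rfl fun l _ => Finset.sum_congr rfl fun k _ => by ring

omit [Fintype ι] [DecidableEq ι] in
lemma continuous_rotated (k : ι) : Continuous (rotated V k) :=
  continuous_finsetSum _ fun _ _ => continuous_const.mul (continuous_trigProd _)

omit [DecidableEq ι] in
lemma continuous_perturb (θ : ι → Bool) : Continuous (perturb V γ θ) :=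
  continuous_const.mul (continuous_finsetSum _ fun k _ =>
    continuous_const.mul (continuous_rotated V k))

omit [Fintype ι] [DecidableEq ι] in
lemma integral_rotated (hd : 1 ≤ d) (k : ι) : ∫ x, rotated V k x = 0 := by
  unfold rotated
  rw [integral_finsetSum _ fun l _ => (integrable_of_continuous (continuous_trigProd (freq l))).const_mul _]
  simp [integral_const_mul, integral_trigProd _ (freq_ne_zero hd _)]

omit [DecidableEq ι] in
lemma integral_perturb (hd : 1 ≤ d) (θ : ι → Bool) : ∫ x, perturb V γ θ x = 0 := by
  unfold perturb
  rw [integral_const_mul, integral_finsetSum _ fun k _ =>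
    (integrable_of_continuous (continuous_rotated V k)).const_mul _]
  simp [integral_const_mul, integral_rotated V hd]

variable {V} (hV : ∀ k k', ∑ l, V k l * V k' l = if k = k' then 1 else 0)
include hV

omit [Fintype ι] in
lemma integral_rotated_mul (k k' : ι) :
    ∫ x, rotated V k x * rotated V k' x = if k = k' then 1 else 0 := by
  unfold rotated
  rw [integral_sum_trigProd_sq Finset.univ freq freq_injective.injOn, hV]

/-- Orthonormality of the rows makes the L₂ size the same for all sign vectors, so nothing about it
has to be proved for a random one. -/
lemma sum_sq_perturbCoeff (θ : ι → Bool) :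
    ∑ l, perturbCoeff V γ θ l ^ 2 = γ ^ 2 * Fintype.card ι := by
  have hsq : ∀ b, bitSign b * bitSign b = 1 := by intro b; cases b <;> simp [bitSign]
  have : ∀ l, perturbCoeff V γ θ l ^ 2 =
      γ ^ 2 * ∑ k, ∑ j, bitSign (θ k) * bitSign (θ j) * (V k l * V j l) := fun l => by
    unfold perturbCoeff
    rw [mul_pow, pow_two (∑ k, _), Finset.sum_mul_sum]
    congr 1
    exact Finset.sum_congr rfl fun k _ => Finset.sum_congr rfl fun j _ => by ring
  simp only [this, ← Finset.mul_sum]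
  congr 1
  rw [Finset.sum_comm]
  have : ∀ k, ∑ l, ∑ j, bitSign (θ k) * bitSign (θ j) * (V k l * V j l) = 1 := fun k => by
    rw [Finset.sum_comm]
    simp only [← Finset.mul_sum, hV]
    simp [hsq]
  simp [this]

lemma integral_perturb_sq (θ : ι → Bool) :
    ∫ x, perturb V γ θ x ^ 2 = γ ^ 2 * Fintype.card ι := by
  simp only [perturb_eq]
  simp_rw [pow_two (∑ l, _)]
  rw [integral_sum_trigProd_sq Finset.univ freq freq_injective.injOn, ← sum_sq_perturbCoeff γ hV θ]
  exact Finset.sum_congr rfl fun l _ => (pow_two _).symm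

/-- Most perturbations are uniformly small. -/
lemma exists_signs (hd : 1 ≤ d) (hL : 1 ≤ L) (hγ : 0 < γ) (hcard : Fintype.card ι ≤ L ^ d) :
    ∃ 𝒢 : Finset (ι → Bool), (0.99 : ℝ) * 2 ^ Fintype.card ι ≤ 𝒢.card ∧
      ∀ θ ∈ 𝒢, ∀ x, |perturb V γ θ x| ≤
        3 * (6 + 8 * d ^ 2 + d * (d + 1)) * √2 ^ d * (γ * √(L ^ d)) * (1 + Real.log L) := by
  set N : ℝ := (L : ℝ) ^ d with hN
  have hL1 : (1 : ℝ) ≤ L := by exact_mod_cast hL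
  have hd1 : (1 : ℝ) ≤ d := by exact_mod_cast hd
  have hN1 : 1 ≤ N := one_le_pow₀ hL1
  have hlog : 0 ≤ Real.log L := Real.log_nonneg hL1
  -- Makes the factor 7Ld/m of the grid lemma equal to 1/N.
  set m : ℕ := 7 * L * d * L ^ d with hm
  have hm0 : 0 < m := by rw [hm]; positivity
  -- At least 6 plus the logarithm of the number (m + 1)^d of grid points. A deviation of 2Y
  -- standard units fails for a share at most 2e^{-Y} of the signs, and the union bound leaves
  -- 2e^{-6} ≤ 0.01.
  set Y : ℝ := (6 + 8 * d ^ 2 + d * (d + 1)) * (1 + Real.log L) with hY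
  have hYge : 6 ≤ Y := by
    rw [hY]; nlinarith [sq_nonneg (d : ℝ), mul_nonneg (show (0:ℝ) ≤ d by positivity) hlog]
  -- By Bessel's inequality, the rotated functions at a point have a sum of squares no larger than
  -- that of the trigonometric ones, at most N·2^d.
  set S : ℝ := γ ^ 2 * (N * 2 ^ d) with hS
  have hS0 : 0 < S := by positivity
  set bad : (Fin d → Fin (m + 1)) → Finset (ι → Bool) := fun κ =>
    Finset.univ.filter fun θ => 2 * Y * √S <
      |∑ k, bitSign (θ k) * (γ * rotated V k (gridCube d m κ))| with hbad
  have hbadc : ∀ κ, ((bad κ).card : ℝ) ≤ 2 ^ Fintype.card ι * (2 * Real.exp (-Y)) := fun κ => by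
    refine (card_lt_abs_sum_le _ hS0 ?_ (by positivity)).trans ?_
    · simp only [mul_pow, ← Finset.mul_sum]
      rw [hS]
      gcongr
      refine (sum_sq_inner_le V hV _).trans ?_
      calc ∑ l : Fin d → Fin L, trigProd (freq l) (gridCube d m κ) ^ 2
          ≤ ∑ _l : Fin d → Fin L, (2 : ℝ) ^ d := Finset.sum_le_sum fun l _ => trigProd_sq_le _ _
        _ = N * 2 ^ d := by simp [hN]
    · gcongr
      nlinarith
  set B := Finset.univ.biUnion bad with hB
  have hgrid : ((m : ℝ) + 1) ^ d * (2 * Real.exp (-Y)) ≤ 0.01 := by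
    have hm1 : (m : ℝ) + 1 ≤ 8 * d * L ^ (d + 1) := by
      have : (m : ℝ) = 7 * (d * L ^ (d + 1)) := by rw [hm]; push_cast; ring
      have h1 : (1 : ℝ) ≤ d * L ^ (d + 1) := one_le_mul_of_one_le_of_one_le hd1 (one_le_pow₀ hL1)
      rw [this]; linarith
    have h1 : ((m : ℝ) + 1) ^ d ≤ Real.exp (Y - 6) := by
      calc ((m : ℝ) + 1) ^ d ≤ (8 * d * L ^ (d + 1)) ^ d := by gcongr
        _ = Real.exp (d * (Real.log (8 * d) + (d + 1) * Real.log L)) := by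
            rw [← Nat.cast_succ, ← Real.log_pow, ← Real.log_mul (by positivity) (by positivity),
              ← Real.log_pow, Real.exp_log (by positivity)]
        _ ≤ _ := by
            rw [Real.exp_le_exp]
            have h2 : Real.log (8 * d) ≤ 8 * d := Real.log_le_self (by positivity)
            have h3 : d * Real.log (8 * d) ≤ d * (8 * d) := by gcongr
            rw [hY]
            nlinarith [mul_nonneg (show (0 : ℝ) ≤ 6 + 8 * d ^ 2 by positivity) hlog]
    have h6 : Real.exp (-6) ≤ 0.005 := by
      have : Real.exp (-6) = (Real.exp 1 ^ 6)⁻¹ := by rw [← Real.exp_nat_mul, ← Real.exp_neg]; norm_num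
      rw [this, inv_le_comm₀ (by positivity) (by norm_num)]
      calc ((0.005 : ℝ))⁻¹ ≤ 2.7 ^ 6 := by norm_num
        _ ≤ _ := by gcongr; linarith [Real.exp_one_gt_d9]
    calc ((m : ℝ) + 1) ^ d * (2 * Real.exp (-Y)) ≤ Real.exp (Y - 6) * (2 * Real.exp (-Y)) := by gcongr
      _ = 2 * Real.exp (-6) := by
          rw [mul_left_comm, ← Real.exp_add]; congr 2; ring
      _ ≤ 0.01 := by linarith
  have hBc : (B.card : ℝ) ≤ 0.01 * 2 ^ Fintype.card ι := by
    calc (B.card : ℝ) ≤ ∑ κ, ((bad κ).card : ℝ) := by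
          exact_mod_cast Finset.card_biUnion_le
      _ ≤ ∑ _κ : Fin d → Fin (m + 1), (2 ^ Fintype.card ι * (2 * Real.exp (-Y)) : ℝ) :=
          Finset.sum_le_sum fun κ _ => hbadc κ
      _ = ((m : ℝ) + 1) ^ d * (2 * Real.exp (-Y)) * 2 ^ Fintype.card ι := by
          simp; ring
      _ ≤ _ := by gcongr
  refine ⟨Bᶜ, ?_, fun θ hθ x => ?_⟩
  · have : (B.card : ℝ) + (Bᶜ.card : ℝ) = 2 ^ Fintype.card ι := by
      have := Finset.card_add_card_compl B
      rw [Fintype.card_fun, Fintype.card_bool] at this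
      exact_mod_cast this
    linarith
  · have hgood : ∀ κ, |∑ l, perturbCoeff V γ θ l * trigProd (freq l) (gridCube d m κ)| ≤
        2 * Y * √S := fun κ => by
      rw [← perturb_eq]
      by_contra hcon
      push Not at hcon
      refine Finset.mem_compl.1 hθ (Finset.mem_biUnion.2 ⟨κ, Finset.mem_univ _, ?_⟩)
      refine Finset.mem_filter.2 ⟨Finset.mem_univ _, ?_⟩
      have : ∑ k, bitSign (θ k) * (γ * rotated V k (gridCube d m κ)) =
          perturb V γ θ (gridCube d m κ) := by
        unfold perturb
        rw [Finset.mul_sum]; exact Finset.sum_congr rfl fun k _ => by ring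
      rwa [this]
    have h1 := abs_sum_trigProd_le_of_grid (freq (d := d) (L := L)) L m hm0 (fun l j => (l j).2)
      (perturbCoeff V γ θ) _ hgood x
    rw [perturb_eq]
    refine h1.trans ?_
    have hsum : ∑ l, |perturbCoeff V γ θ l| ≤ γ * N := by
      refine abs_le_of_sq_le_sq' (b := γ * N) ?_ (by positivity) |>.2
      calc (∑ l, |perturbCoeff V γ θ l|) ^ 2
          ≤ (Finset.univ : Finset (Fin d → Fin L)).card * ∑ l, |perturbCoeff V γ θ l| ^ 2 :=
            sq_sum_le_card_mul_sum_sq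
        _ = N * (γ ^ 2 * Fintype.card ι) := by
            simp only [sq_abs, sum_sq_perturbCoeff γ hV]; simp [hN]
        _ ≤ N * (γ ^ 2 * N) := by
            gcongr
            rw [hN]; exact_mod_cast hcard
        _ = (γ * N) ^ 2 := by ring
    have hsqS : √S = γ * √N * √2 ^ d := by
      rw [hS, Real.sqrt_mul (by positivity), Real.sqrt_sq hγ.le, Real.sqrt_mul (by positivity),
        Real.sqrt_eq_rpow (2 ^ d), ← Real.rpow_natCast, ← Real.rpow_mul (by norm_num),
        mul_comm (d : ℝ), Real.rpow_mul (by norm_num), ← Real.sqrt_eq_rpow, Real.rpow_natCast]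
      ring
    have hstep : (7 * L * d / m : ℝ) = 1 / N := by
      rw [hm]; push_cast
      have : (L : ℝ) ≠ 0 := by positivity
      have : (d : ℝ) ≠ 0 := by positivity
      rw [hN]; field_simp
    have hsqN : 1 ≤ √N := Real.one_le_sqrt.2 hN1
    rw [hsqS, hstep]
    calc 2 * Y * (γ * √N * √2 ^ d) + √2 ^ d * (1 / N) * ∑ l, |perturbCoeff V γ θ l|
        ≤ 2 * Y * (γ * √N * √2 ^ d) + √2 ^ d * (1 / N) * (γ * N) := by gcongr
      _ = 2 * Y * (γ * √N * √2 ^ d) + √2 ^ d * γ * 1 := by field_simp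
      _ ≤ 2 * Y * (γ * √N * √2 ^ d) + √2 ^ d * γ * (√N * Y) := by
          gcongr
          nlinarith
      _ = _ := by rw [hY]; ring

end Perturbation

end LDPTwoSample

end

noncomputable section

namespace LDPTwoSample

/-! ### Lower bounds on the separation radius -/

variable {d : ℕ}

lemma densityMeasure_one : densityMeasure (fun _ : Cube d => (1 : ℝ)) = volume := by
  simp [densityMeasure]

/-- Against the uniform pair a level-α test accepts with probability at least 1 − α, hence with
probability at least 3/4 − α under the nearby alternative. The risk is then at least 3/4 > α + β.
The alternative may depend on the mechanism and on the test. -/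
lemma le_separationRadius {inter : Bool} {s r ε α β p ρ₀ : ℝ} {n₁ n₂ : ℕ} (hs : 0 < s)
    (hr : 0 ≤ r) (hp2 : p ≤ 2) (hε0 : 0 < ε) (hε : ε ≤ 1) (hα : 0 < α) (hβ : 0 < β)
    (hαβ : α + β ≤ 1 / 2)
    (h : ∀ M ∈ mechanisms inter d n₁ n₂ ε, ∀ φ : M.Views → Bool, Measurable φ →
      ∃ f : Cube d → ℝ, (f, fun _ => 1) ∈ altPairs s r d p ρ₀ ∧
        M.law volume volume {v | φ v = false} ≤
          M.law (densityMeasure f) volume {v | φ v = false} + ENNReal.ofReal (1 / 4)) :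
    ρ₀ ≤ separationRadius inter s r d n₁ n₂ ε α β p := by
  refine le_csInf ⟨2 * r + 1, by positivity,
    minimaxRisk_le_of_large hs hr hp2 hε0 hε hα (by linarith) hβ.le (by linarith)⟩ ?_
  rintro ρ ⟨_, hrisk⟩
  by_contra! hlt
  have hge : ENNReal.ofReal (3 / 4 - α) ≤ ⨅ M ∈ mechanisms inter d n₁ n₂ ε,
      ⨅ φ ∈ levelTests s r M α, ⨆ f ∈ altPairs s r d p ρ,
        M.law (densityMeasure f.1) (densityMeasure f.2) {v | φ v = false} := by
    refine le_iInf₂ fun M hM => le_iInf₂ fun φ hφ => ?_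
    obtain ⟨f, hf, hle⟩ := h M hM φ hφ.1
    have hf' : (f, fun _ => 1) ∈ altPairs s r d p ρ :=
      ⟨hf.1, hf.2.1, (ENNReal.ofReal_le_ofReal hlt.le).trans hf.2.2⟩
    refine le_trans ?_ (le_iSup₂ (f := fun (f : (Cube d → ℝ) × (Cube d → ℝ))
      (_ : f ∈ altPairs s r d p ρ) =>
        M.law (densityMeasure f.1) (densityMeasure f.2) {v | φ v = false}) _ hf')
    rw [densityMeasure_one]
    have h1 := one_mem_sobolevDensities (d := d) (r := r) hs
    have hnull : M.law volume volume {v | φ v = true} ≤ ENNReal.ofReal α := by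
      have := (le_iSup₂ (f := fun (f : (Cube d → ℝ) × (Cube d → ℝ))
        (_ : f ∈ nullPairs s r d) =>
          M.law (densityMeasure f.1) (densityMeasure f.2) {v | φ v = true})
        (fun _ => 1, fun _ => 1) ⟨h1, h1, Filter.EventuallyEq.rfl⟩).trans hφ.2
      simpa only [densityMeasure_one] using this
    have hprob : IsProbabilityMeasure (M.law (volume : Measure (Cube d)) volume) := by
      unfold Mechanism.law; infer_instance
    have hcompl : {v | φ v = false} = {v | φ v = true}ᶜ := by
      ext v; simp
    have hfalse : ENNReal.ofReal (1 - α) ≤ M.law volume volume {v | φ v = false} := by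
      have htrue : MeasurableSet {v | φ v = true} := hφ.1 (measurableSet_singleton true)
      rw [hcompl, prob_compl_eq_one_sub htrue,
        ENNReal.ofReal_sub _ hα.le, ENNReal.ofReal_one]
      exact tsub_le_tsub_left hnull _
    have h2 := hfalse.trans hle
    rw [show (1 : ℝ) - α = (3 / 4 - α) + 1 / 4 by ring,
      ENNReal.ofReal_add (by linarith) (by norm_num)] at h2
    exact (ENNReal.add_le_add_iff_right ENNReal.ofReal_ne_top).1 h2
  rw [minimaxRisk] at hrisk
  have h3 := (add_le_add_right hge (ENNReal.ofReal α)).trans hrisk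
  rw [← ENNReal.ofReal_add hα.le (by linarith),
    ENNReal.ofReal_le_ofReal_iff (by linarith)] at h3
  linarith

/-- The constant in the uniform bound on the perturbations. -/
def supConst (d : ℕ) : ℝ := 3 * (6 + 8 * d ^ 2 + d * (d + 1)) * √2 ^ d

lemma supConst_pos (d : ℕ) : 0 < supConst d := by unfold supConst; positivity

/-- The logarithm in the sup bound is absorbed by L^{-s} for every s > 0, so one amplitude keeps the
perturbations below 1/2 at all resolutions. -/
lemma rpow_neg_mul_log_le {s : ℝ} (hs : 0 < s) {L : ℕ} (hL : 1 ≤ L) :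
    (L : ℝ) ^ (-s) * (1 + Real.log L) ≤ 1 + 1 / s := by
  have hL1 : (1 : ℝ) ≤ L := by exact_mod_cast hL
  have hL0 : (0 : ℝ) < L := by linarith
  have h1 : (L : ℝ) ^ (-s) ≤ 1 := Real.rpow_le_one_of_one_le_of_nonpos hL1 (by linarith)
  have h2 := Real.log_le_rpow_div hL0.le hs
  have h3 : (L : ℝ) ^ (-s) * Real.log L ≤ 1 / s := by
    calc (L : ℝ) ^ (-s) * Real.log L ≤ (L : ℝ) ^ (-s) * ((L : ℝ) ^ s / s) := by gcongr
      _ = 1 / s := by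
        rw [← mul_div_assoc, ← Real.rpow_add hL0, neg_add_cancel, Real.rpow_zero]
  linarith

lemma amplitude_sq {L : ℕ} {γ c₀ s : ℝ} (hL : 1 ≤ L)
    (hγ : γ * √(L ^ d) = c₀ * (L : ℝ) ^ (-s)) :
    γ ^ 2 * (L : ℝ) ^ d = c₀ ^ 2 * (L : ℝ) ^ (-(2 * s)) := by
  have hL0 : (0 : ℝ) < L := by exact_mod_cast hL
  have := congrArg (· ^ 2) hγ
  simp only [mul_pow, Real.sq_sqrt (show (0 : ℝ) ≤ (L : ℝ) ^ d by positivity)] at this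
  rw [this, ← Real.rpow_natCast ((L : ℝ) ^ (-s)), ← Real.rpow_mul hL0.le]
  congr 2
  push_cast; ring

section Alternative

variable {L : ℕ} {ι : Type} [Fintype ι] [DecidableEq ι] {V : ι → (Fin d → Fin L) → ℝ} {γ : ℝ}
  {s r c₀ : ℝ}

omit [DecidableEq ι] in
lemma perturb_le_half (hs : 0 < s) (hL : 1 ≤ L) (hγ : γ * √(L ^ d) = c₀ * (L : ℝ) ^ (-s))
    (hc₀ : 0 < c₀) (hc₁ : supConst d * c₀ * (1 + 1 / s) ≤ 1 / 2) {θ : ι → Bool}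
    (hθ : ∀ x, |perturb V γ θ x| ≤ supConst d * (γ * √(L ^ d)) * (1 + Real.log L)) (x : Cube d) :
    |perturb V γ θ x| ≤ 1 / 2 := by
  refine (hθ x).trans (le_trans ?_ hc₁)
  rw [hγ]
  calc supConst d * (c₀ * (L : ℝ) ^ (-s)) * (1 + Real.log L)
      = supConst d * c₀ * ((L : ℝ) ^ (-s) * (1 + Real.log L)) := by ring
    _ ≤ _ := mul_le_mul_of_nonneg_left (rpow_neg_mul_log_le hs hL)
        (mul_pos (supConst_pos d) hc₀).le

/-- The separation comes from ‖h‖₂² ≤ ‖h‖_∞‖h‖₁, where ‖h‖₂² = γ²·card ι ≥ γ²L^d/2 and the sup norm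
carries the factor 1 + log L. The L₁ norm is below every L_p norm with p ≥ 1 on the cube. -/
lemma perturb_mem_altPairs (hV : ∀ k k', ∑ l, V k l * V k' l = if k = k' then 1 else 0)
    (hd : 1 ≤ d) (hs : 0 < s) (hL : 1 ≤ L)
    (hγ : γ * √(L ^ d) = c₀ * (L : ℝ) ^ (-s)) (hc₀ : 0 < c₀)
    (hc₁ : supConst d * c₀ * (1 + 1 / s) ≤ 1 / 2) (hc₂ : (d : ℝ) ^ s * c₀ ^ 2 ≤ r ^ 2)
    (hcard : Fintype.card ι ≤ L ^ d) (hcard' : (L : ℝ) ^ d / 2 ≤ Fintype.card ι) {θ : ι → Bool}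
    (hθ : ∀ x, |perturb V γ θ x| ≤ supConst d * (γ * √(L ^ d)) * (1 + Real.log L)) {p ρ : ℝ}
    (hp : 1 ≤ p) (hρ : ρ ≤ c₀ * (L : ℝ) ^ (-s) / (2 * supConst d * (1 + Real.log L))) :
    ((fun x => 1 + perturb V γ θ x), fun _ => 1) ∈ altPairs s r d p ρ := by
  have hL1 : (1 : ℝ) ≤ L := by exact_mod_cast hL
  have hL0 : (0 : ℝ) < L := by linarith
  have hlog : 0 ≤ Real.log L := Real.log_nonneg hL1
  have hhalf := perturb_le_half hs hL hγ hc₀ hc₁ hθ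
  have hN0 : (0 : ℝ) < (L : ℝ) ^ d := by positivity
  have hsq := amplitude_sq hL hγ
  have hcont := continuous_perturb V γ θ
  refine ⟨?_, one_mem_sobolevDensities hs, ?_⟩
  · have := perturbation_mem (s := s) (r := r) (freq (d := d) (L := L)) freq_injective
      (freq_ne_zero hd) (√d * L) indexNorm_freq_le hs (perturbCoeff V γ θ) ?_ ?_
    · simpa only [perturb_eq] using this
    · rw [sum_sq_perturbCoeff γ hV]
      calc (√d * L) ^ (2 * s) * (γ ^ 2 * Fintype.card ι)
          ≤ (√d * L) ^ (2 * s) * (γ ^ 2 * (L : ℝ) ^ d) := by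
            gcongr; exact_mod_cast hcard
        _ = (d : ℝ) ^ s * c₀ ^ 2 * ((L : ℝ) ^ (2 * s) * (L : ℝ) ^ (-(2 * s))) := by
            rw [hsq, Real.mul_rpow (by positivity) hL0.le, Real.sqrt_eq_rpow,
              ← Real.rpow_mul (by positivity)]
            rw [show 1 / 2 * (2 * s) = s by ring]
            ring
        _ = (d : ℝ) ^ s * c₀ ^ 2 := by
            rw [← Real.rpow_add hL0, add_neg_cancel, Real.rpow_zero, mul_one]
        _ ≤ r ^ 2 := hc₂
    · intro x
      rw [← perturb_eq]
      linarith [hhalf x]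
  · set b := supConst d * (γ * √(L ^ d)) * (1 + Real.log L) with hb
    have hb0 : 0 < b := by
      rw [hb, hγ]
      have := supConst_pos d
      positivity
    have hint : Integrable (perturb V γ θ) := integrable_of_continuous hcont
    have h2 : γ ^ 2 * Fintype.card ι ≤ b * ∫ x, |perturb V γ θ x| := by
      rw [← integral_perturb_sq γ hV θ, ← integral_const_mul]
      refine integral_mono (integrable_of_continuous (hcont.pow 2)) (hint.abs.const_mul _)
        fun x => ?_
      calc perturb V γ θ x ^ 2 = |perturb V γ θ x| * |perturb V γ θ x| := by
            rw [← sq_abs, pow_two]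
        _ ≤ b * |perturb V γ θ x| := mul_le_mul_of_nonneg_right (hθ x) (abs_nonneg _)
    have h3 : ρ ≤ ∫ x, |perturb V γ θ x| := by
      refine hρ.trans ?_
      have h4 : γ ^ 2 * ((L : ℝ) ^ d / 2) ≤ γ ^ 2 * Fintype.card ι := by gcongr
      have h5 : c₀ * (L : ℝ) ^ (-s) / (2 * supConst d * (1 + Real.log L)) =
          γ ^ 2 * ((L : ℝ) ^ d / 2) / b := by
        have e : γ ^ 2 * ((L : ℝ) ^ d / 2) = (c₀ * (L : ℝ) ^ (-s)) * (c₀ * (L : ℝ) ^ (-s)) / 2 := by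
          have : γ ^ 2 * (L : ℝ) ^ d = (c₀ * (L : ℝ) ^ (-s)) * (c₀ * (L : ℝ) ^ (-s)) := by
            rw [← hγ]
            calc γ ^ 2 * (L : ℝ) ^ d = γ ^ 2 * (√(L ^ d) * √(L ^ d)) := by
                  rw [Real.mul_self_sqrt hN0.le]
              _ = _ := by ring
          rw [← mul_div_assoc, this]
        have := supConst_pos d
        have hx : 0 < c₀ * (L : ℝ) ^ (-s) := by positivity
        have hl1 : 0 < 1 + Real.log L := by linarith
        rw [e, hb, hγ]
        field_simp
      rw [h5, div_le_iff₀ hb0]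
      linarith
    have hfun : ((fun x => 1 + perturb V γ θ x) - fun _ => 1) = perturb V γ θ := by
      funext x; simp
    show _ ≤ eLpNorm ((fun x => 1 + perturb V γ θ x) - fun _ => 1) _ _
    rw [hfun]
    refine le_trans ?_ (eLpNorm_le_eLpNorm_of_exponent_le (p := 1) ?_ hcont.aestronglyMeasurable)
    · rw [eLpNorm_one_eq_lintegral_enorm, ← ofReal_integral_norm_eq_lintegral_enorm hint]
      exact ENNReal.ofReal_le_ofReal h3
    · rw [← ENNReal.ofReal_one]; exact ENNReal.ofReal_le_ofReal hp

end Alternative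

lemma sinh_sq_le {ε : ℝ} (h0 : 0 ≤ ε) (h1 : ε ≤ 1) : Real.sinh ε ^ 2 ≤ 9 / 4 * ε ^ 2 := by
  have h2 := Real.abs_exp_sub_one_sub_id_le (x := ε) (by rw [abs_of_nonneg h0]; exact h1)
  have h3 := (abs_le.1 h2).2
  have h4 := Real.add_one_le_exp (-ε)
  have h5 : Real.sinh ε ≤ 3 / 2 * ε := by rw [Real.sinh_eq]; nlinarith
  have h6 : 0 ≤ Real.sinh ε := Real.sinh_nonneg_iff.2 h0
  calc Real.sinh ε ^ 2 ≤ (3 / 2 * ε) ^ 2 := by gcongr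
    _ = _ := by ring

/-- The resolution of the perturbations. -/
lemma exists_lower_resolution {s κ E : ℝ} (hs : 0 < s) (hκ : 0 < κ) (hκ1 : κ ≤ 1) (hE : 4 ≤ E) :
    ∃ L : ℕ, 1 ≤ L ∧ E ^ κ ≤ L ∧ ∀ c B : ℝ, 0 < c → 0 < B →
      c * 2 ^ (-s) / (6 * B) * (Real.log E)⁻¹ * (1 / E) ^ (s * κ) ≤
        c * (L : ℝ) ^ (-s) / (2 * B * (1 + Real.log L)) := by
  have hE0 : 0 < E := by linarith
  have hE1 : 1 ≤ E ^ κ := Real.one_le_rpow (by linarith) hκ.le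
  refine ⟨⌈E ^ κ⌉₊, Nat.one_le_ceil_iff.2 (by linarith), Nat.le_ceil _, fun c B hc hB => ?_⟩
  set L := ⌈E ^ κ⌉₊
  have hL2 : (L : ℝ) ≤ 2 * E ^ κ := by
    linarith [Nat.ceil_lt_add_one (show 0 ≤ E ^ κ by positivity)]
  have hL1 : (1 : ℝ) ≤ L := hE1.trans (Nat.le_ceil _)
  have hlog4 : 1.38 ≤ Real.log E := by
    have := Real.log_le_log (by norm_num) hE
    rw [show (4 : ℝ) = 2 ^ 2 by norm_num, Real.log_pow] at this
    push_cast at this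
    linarith [Real.log_two_gt_d9]
  have hlogL : 1 + Real.log L ≤ 3 * Real.log E := by
    have h1 := Real.log_le_log (by linarith) hL2
    rw [Real.log_mul (by norm_num) (by positivity), Real.log_rpow hE0] at h1
    have h2 : κ * Real.log E ≤ 1 * Real.log E := by gcongr
    linarith [Real.log_two_lt_d9]
  have hLs : 2 ^ (-s) * (1 / E) ^ (s * κ) ≤ (L : ℝ) ^ (-s) := by
    calc 2 ^ (-s) * (1 / E) ^ (s * κ) = (2 * E ^ κ) ^ (-s) := by
          rw [Real.mul_rpow (by norm_num) (by positivity), ← Real.rpow_mul hE0.le, one_div,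
            Real.inv_rpow hE0.le, ← Real.rpow_neg hE0.le]
          congr 2; ring
      _ ≤ _ := Real.rpow_le_rpow_of_nonpos (by linarith) hL2 (by linarith)
  have hlog0 : 0 ≤ Real.log L := Real.log_nonneg hL1
  calc c * 2 ^ (-s) / (6 * B) * (Real.log E)⁻¹ * (1 / E) ^ (s * κ)
      = c * (2 ^ (-s) * (1 / E) ^ (s * κ)) / (2 * B * (3 * Real.log E)) := by
        have : Real.log E ≠ 0 := by linarith
        field_simp; ring
    _ ≤ c * (L : ℝ) ^ (-s) / (2 * B * (3 * Real.log E)) := by gcongr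
    _ ≤ _ := by gcongr

end LDPTwoSample

end

noncomputable section

namespace LDPTwoSample

/-! ### Information of private views on random perturbations, and the interactive lower bound. -/

variable {d : ℕ}

section Information

variable {L : ℕ} {ι : Type} [Fintype ι] (V : ι → (Fin d → Fin L) → ℝ) (γ : ℝ)

lemma exists_abs_rotated_le : ∃ B, ∀ k x, |rotated V k x| ≤ B := by
  refine ⟨∑ k, ∑ l, |V k l| * √2 ^ d, fun k x => ?_⟩
  calc |rotated V k x| ≤ ∑ l, |V k l| * √2 ^ d := by
        refine (Finset.abs_sum_le_sum_abs _ _).trans (Finset.sum_le_sum fun l _ => ?_)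
        rw [abs_mul]
        exact mul_le_mul_of_nonneg_left (abs_trigProd_le _ _) (abs_nonneg _)
    _ ≤ _ := Finset.single_le_sum (f := fun k => ∑ l, |V k l| * √2 ^ d)
        (fun k _ => Finset.sum_nonneg fun l _ => by positivity) (Finset.mem_univ k)

lemma integrable_rotated (m : Measure (Cube d)) [IsProbabilityMeasure m] (k : ι) :
    Integrable (rotated V k) m := by
  obtain ⟨B, hB⟩ := exists_abs_rotated_le V
  exact integrable_of_abs_le (continuous_rotated V k).measurable (hB k)

lemma integral_perturb_eq (m : Measure (Cube d)) [IsProbabilityMeasure m] (θ : ι → Bool) :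
    ∫ x, perturb V γ θ x ∂m = γ * ∑ k, bitSign (θ k) * ∫ x, rotated V k x ∂m := by
  unfold perturb
  rw [integral_const_mul, integral_finsetSum _ fun k _ => (integrable_rotated V m k).const_mul _]
  simp only [integral_const_mul]

variable {H Z : Type} [MeasurableSpace H] [MeasurableSpace Z] {μ : Measure H}
  [IsProbabilityMeasure μ] {κ : Kernel (Cube d × H) Z} [IsMarkovKernel κ]
  (π : Kernel (H × Z) (Cube d)) [IsMarkovKernel π]

lemma integrable_posterior_mul (ν : Measure (H × Z)) [IsProbabilityMeasure ν] (k k' : ι) :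
    Integrable (fun q => (∫ x, rotated V k x ∂(π q)) * ∫ x, rotated V k' x ∂(π q)) ν := by
  obtain ⟨B, hB⟩ := exists_abs_rotated_le V
  have hm : ∀ k, Measurable fun q => ∫ x, rotated V k x ∂(π q) := fun k =>
    (continuous_rotated V k).measurable.stronglyMeasurable.integral_kernel.measurable
  have hb : ∀ k q, |∫ x, rotated V k x ∂(π q)| ≤ B := fun k q =>
    abs_integral_le_of_abs_le _ (hB k)
  refine integrable_of_abs_le (B := B * B) ((hm k).mul (hm k')) fun q => ?_
  rw [abs_mul]
  exact mul_le_mul (hb k q) (hb k' q) (abs_nonneg _) ((abs_nonneg _).trans (hb k q))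

variable [DecidableEq ι] {V π} (hV : ∀ k k', ∑ l, V k l * V k' l = if k = k' then 1 else 0)
  {ε : ℝ}
include hV

lemma sum_integral_rotated_sq_le (hd : 1 ≤ d) (hπ : IsPosterior μ volume κ π)
    (hκ : IsPrivateKernel ε κ) (hε : 0 ≤ ε) :
    ∑ k, ∫ q, (∫ x, rotated V k x ∂(π q)) ^ 2 ∂(viewLaw μ volume κ) ≤ Real.sinh ε ^ 2 := by
  obtain ⟨B, hB⟩ := exists_abs_rotated_le V
  exact hπ.sum_integral_sq_le hκ hε (fun k => (continuous_rotated V k).measurable) hB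
    (integral_rotated V hd) (integral_rotated_mul hV)

/-- Averaging over all signs removes the cross terms and leaves γ² times the information on the
whole system, which privacy bounds by sinh²ε whatever its dimension. Without the average, a view
could be tuned to one perturbation and learn a multiple of γ²N. -/
lemma sum_integral_perturb_sq_le (hd : 1 ≤ d) (hπ : IsPosterior μ volume κ π)
    (hκ : IsPrivateKernel ε κ) (hε : 0 ≤ ε) :
    ∑ θ : ι → Bool, ∫ q, (∫ x, perturb V γ θ x ∂(π q)) ^ 2 ∂(viewLaw μ volume κ) ≤
      γ ^ 2 * 2 ^ Fintype.card ι * Real.sinh ε ^ 2 := by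
  have hi : ∀ θ ∈ (Finset.univ : Finset (ι → Bool)),
      Integrable (fun q => (∫ x, perturb V γ θ x ∂(π q)) ^ 2) (viewLaw μ volume κ) := fun θ _ => by
    have : ∀ q, (∫ x, perturb V γ θ x ∂(π q)) ^ 2 = ∑ k, ∑ k', γ ^ 2 * (bitSign (θ k) *
        bitSign (θ k')) * ((∫ x, rotated V k x ∂(π q)) * ∫ x, rotated V k' x ∂(π q)) := fun q => by
      rw [integral_perturb_eq, mul_pow, pow_two (∑ k, _), Finset.sum_mul_sum, Finset.mul_sum]
      refine Finset.sum_congr rfl fun k _ => ?_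
      rw [Finset.mul_sum]
      exact Finset.sum_congr rfl fun k' _ => by ring
    simp only [this]
    exact integrable_finsetSum _ fun k _ => integrable_finsetSum _ fun k' _ =>
      (integrable_posterior_mul V π _ k k').const_mul _
  rw [← integral_finsetSum _ hi]
  have : ∀ q, ∑ θ : ι → Bool, (∫ x, perturb V γ θ x ∂(π q)) ^ 2 =
      γ ^ 2 * 2 ^ Fintype.card ι * ∑ k, (∫ x, rotated V k x ∂(π q)) ^ 2 := fun q => by
    simp only [integral_perturb_eq, mul_pow, ← Finset.mul_sum, sum_sq_sum_bitSign]
    ring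
  simp only [this]
  rw [integral_const_mul, integral_finsetSum _ fun k _ => by
    simpa only [pow_two] using integrable_posterior_mul V π _ k k]
  exact mul_le_mul_of_nonneg_left (sum_integral_rotated_sq_le hV hd hπ hκ hε) (by positivity)

end Information

/-- With γ√N = c₀L^{-s} and L^{2s+d} ≥ n₁ε², the average information over all rounds is of order
γ²n₁ε² ≤ c₀². No rotation is required, so the trigonometric functions themselves are perturbed. -/
lemma le_radiusI {s r c₀ p ε α β : ℝ} {n₁ n₂ : ℕ} (hd : 1 ≤ d) (hs : 0 < s) (hr : 0 < r)
    (hc₀ : 0 < c₀) (hc : c₀ ≤ 1 / 20) (hc₁ : supConst d * c₀ * (1 + 1 / s) ≤ 1 / 2)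
    (hc₂ : (d : ℝ) ^ s * c₀ ^ 2 ≤ r ^ 2) (hp : 1 ≤ p) (hp2 : p ≤ 2) (hε0 : 0 < ε) (hε : ε ≤ 1)
    (hα : 0 < α) (hβ : 0 < β) (hαβ : α + β ≤ 1 / 2) (hE : 4 ≤ n₁ * ε ^ 2) :
    c₀ * 2 ^ (-s) / (6 * supConst d) * (Real.log (n₁ * ε ^ 2))⁻¹ *
      (1 / (n₁ * ε ^ 2)) ^ (2 * s / (4 * s + 2 * d)) ≤ radiusI s r d n₁ n₂ ε α β p := by
  have hd1 : (1 : ℝ) ≤ d := by exact_mod_cast hd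
  have hκ : 0 < 1 / (2 * s + d) := by positivity
  obtain ⟨L, hL, hEL, hρ⟩ := exists_lower_resolution hs hκ
    (by rw [div_le_one (by positivity)]; linarith) hE
  have hexp : 2 * s / (4 * s + 2 * d) = s * (1 / (2 * s + d)) := by
    field_simp; ring
  rw [hexp]
  have hL0 : (0 : ℝ) < L := by exact_mod_cast hL
  have hE0 : (0 : ℝ) < n₁ * ε ^ 2 := by linarith
  set γ : ℝ := c₀ * (L : ℝ) ^ (-s) / √(L ^ d) with hγdef
  have hsN : 0 < √((L : ℝ) ^ d) := Real.sqrt_pos.2 (by positivity)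
  have hγ : γ * √(L ^ d) = c₀ * (L : ℝ) ^ (-s) := by rw [hγdef]; field_simp
  have hγ0 : 0 < γ := by positivity
  have hγE : γ ^ 2 * (n₁ * ε ^ 2) ≤ c₀ ^ 2 := by
    have h1 : n₁ * ε ^ 2 ≤ (L : ℝ) ^ (2 * s + d) := by
      have := Real.rpow_le_rpow (by positivity) hEL (show 0 ≤ 2 * s + d by positivity)
      rwa [← Real.rpow_mul hE0.le, one_div, inv_mul_cancel₀ (by positivity), Real.rpow_one] at this
    have h2 := amplitude_sq hL hγ
    have hN0 : (0 : ℝ) < (L : ℝ) ^ d := by positivity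
    refine le_of_mul_le_mul_right ?_ hN0
    calc γ ^ 2 * (n₁ * ε ^ 2) * (L : ℝ) ^ d = γ ^ 2 * (L : ℝ) ^ d * (n₁ * ε ^ 2) := by ring
      _ = c₀ ^ 2 * (L : ℝ) ^ (-(2 * s)) * (n₁ * ε ^ 2) := by rw [h2]
      _ ≤ c₀ ^ 2 * (L : ℝ) ^ (-(2 * s)) * (L : ℝ) ^ (2 * s + d) := by gcongr
      _ = c₀ ^ 2 * (L : ℝ) ^ d := by
          rw [mul_assoc, ← Real.rpow_add hL0, neg_add_cancel_left, Real.rpow_natCast]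
  refine le_separationRadius hs hr.le hp2 hε0 hε hα hβ hαβ fun M hM φ hφ => ?_
  choose π hmk hπ using fun t (ht : t < n₁) =>
    exists_isPosterior (M.pairedLaw volume volume t ht.le) volume (M.roundX t ht)
  set V : (Fin d → Fin L) → (Fin d → Fin L) → ℝ := fun k l => if k = l then 1 else 0 with hVdef
  have hV : ∀ k k', ∑ l, V k l * V k' l = if k = k' then 1 else 0 := fun k k' => by
    simp [hVdef]
  have hcard : Fintype.card (Fin d → Fin L) = L ^ d := by simp
  obtain ⟨𝒢, h𝒢, hsup⟩ := exists_signs γ hV hd hL hγ0 hcard.le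
  have h𝒢0 : (0 : ℝ) < 𝒢.card := lt_of_lt_of_le (by positivity) h𝒢
  have hhalf : ∀ θ ∈ 𝒢, ∀ x, |perturb V γ θ x| ≤ 1 / 2 := fun θ hθ =>
    perturb_le_half hs hL hγ hc₀ hc₁ (hsup θ hθ)
  obtain ⟨θ, hθ, hle⟩ := Mechanism.exists_law_ge_of_information (f := perturb V γ)
    (δ := 3 * γ ^ 2 * ε ^ 2) π hπ (Finset.card_pos.1 (by exact_mod_cast h𝒢0))
    (fun θ _ => (continuous_perturb V γ θ).measurable) hhalf
    (fun θ _ => integral_perturb V γ hd θ) (fun t ht => by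
      have h1 := sum_integral_perturb_sq_le γ hV hd (hπ t ht) (hM.1.1 ⟨t, ht⟩) hε0.le
      calc _ ≤ ∑ θ : (Fin d → Fin L) → Bool, ∫ q, (∫ x, perturb V γ θ x ∂(π t ht q)) ^ 2
            ∂(viewLaw (M.pairedLaw volume volume t ht.le) volume (M.roundX t ht)) :=
            Finset.sum_le_sum_of_subset_of_nonneg (Finset.subset_univ _) fun θ _ _ =>
              integral_nonneg fun q => sq_nonneg _
        _ ≤ γ ^ 2 * 2 ^ Fintype.card (Fin d → Fin L) * Real.sinh ε ^ 2 := h1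
        _ ≤ γ ^ 2 * (𝒢.card / 0.99) * (9 / 4 * ε ^ 2) := by
            gcongr
            · rw [le_div_iff₀ (by norm_num)]; linarith
            · exact sinh_sq_le hε0.le hε
        _ = 𝒢.card * (9 / 4 / 0.99 * (γ ^ 2 * ε ^ 2)) := by ring
        _ ≤ 𝒢.card * (3 * (γ ^ 2 * ε ^ 2)) := by
            gcongr
            norm_num
        _ = _ := by ring) (by
      -- Here c₀ ≤ 1/20 is used: 3c₀² ≤ 3/400 < 1/128.
      have : n₁ * (3 * γ ^ 2 * ε ^ 2) = 3 * (γ ^ 2 * (n₁ * ε ^ 2)) := by ring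
      rw [this]
      nlinarith) hφ
  refine ⟨fun x => 1 + perturb V γ θ x, ?_, hle⟩
  refine perturb_mem_altPairs hV hd hs hL hγ hc₀ hc₁ hc₂ hcard.le ?_ (hsup θ hθ) hp
    (hρ c₀ (supConst d) hc₀ (supConst_pos d))
  rw [hcard]
  push_cast
  have : (0 : ℝ) < (L : ℝ) ^ d := by positivity
  linarith

end LDPTwoSample

end

noncomputable section

namespace LDPTwoSample

/-! ### The non-interactive lower bound, with perturbations along weakly informed eigenvectors. -/

variable {d : ℕ}

/-- A symmetric matrix is diagonal in some orthonormal basis. -/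
lemma exists_orthonormal_diagonal {κ : Type} [Fintype κ] [DecidableEq κ] (A : κ → κ → ℝ)
    (hA : ∀ l l', A l l' = A l' l) :
    ∃ V : κ → κ → ℝ, (∀ k k', ∑ l, V k l * V k' l = if k = k' then 1 else 0) ∧
      ∀ k k', k ≠ k' → ∑ l, ∑ l', V k l * V k' l' * A l l' = 0 := by
  have hH : (Matrix.of A).IsHermitian := by
    ext l l'; simp [hA l l']
  have hV : ∀ k k', ∑ l, hH.eigenvectorBasis k l * hH.eigenvectorBasis k' l =
      if k = k' then 1 else 0 := fun k k' => by
    have := orthonormal_iff_ite.1 hH.eigenvectorBasis.orthonormal k' k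
    rw [PiLp.inner_apply] at this
    simp only [RCLike.inner_apply, conj_trivial] at this
    rw [this]; simp only [eq_comm]
  refine ⟨fun k l => hH.eigenvectorBasis k l, hV, fun k k' hk => ?_⟩
  have h1 : ∀ l, ∑ l', hH.eigenvectorBasis k' l' * A l l' =
      hH.eigenvalues k' * hH.eigenvectorBasis k' l := fun l => by
    have := congrFun (hH.mulVec_eigenvectorBasis k') l
    simp only [Matrix.mulVec, dotProduct, Matrix.of_apply, Pi.smul_apply, smul_eq_mul] at this
    rw [← this]
    exact Finset.sum_congr rfl fun l' _ => mul_comm _ _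
  have h2 : ∀ l, ∑ l', hH.eigenvectorBasis k l * hH.eigenvectorBasis k' l' * A l l' =
      hH.eigenvalues k' * (hH.eigenvectorBasis k l * hH.eigenvectorBasis k' l) := fun l => by
    simp only [mul_assoc, ← Finset.mul_sum, h1]
    ring
  simp only [h2, ← Finset.mul_sum, hV, if_neg hk, mul_zero]

/-- At least half of a family of nonnegative numbers are at most twice their mean. -/
lemma half_le_card_filter {κ : Type} [Fintype κ] (lam : κ → ℝ) (h0 : ∀ k, 0 ≤ lam k)
    {T : ℝ} (hT : 0 < T) (hsum : ∑ k, lam k ≤ T) :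
    (Fintype.card κ : ℝ) / 2 ≤
      (Finset.univ.filter fun k => lam k * Fintype.card κ ≤ 2 * T).card := by
  classical
  set K := Finset.univ.filter fun k => lam k * Fintype.card κ ≤ 2 * T
  have hc : (K.card : ℝ) + (Kᶜ.card : ℝ) = Fintype.card κ := by
    exact_mod_cast Finset.card_add_card_compl K
  have h1 : (Kᶜ.card : ℝ) * (2 * T) ≤ T * Fintype.card κ := by
    calc (Kᶜ.card : ℝ) * (2 * T) = ∑ k ∈ Kᶜ, 2 * T := by rw [Finset.sum_const, nsmul_eq_mul]
      _ ≤ ∑ k ∈ Kᶜ, lam k * Fintype.card κ := Finset.sum_le_sum fun k hk => by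
          have := Finset.mem_compl.1 hk
          simp only [K, Finset.mem_filter, Finset.mem_univ, true_and, not_le] at this
          exact this.le
      _ ≤ ∑ k, lam k * Fintype.card κ :=
          Finset.sum_le_sum_of_subset_of_nonneg (Finset.subset_univ _) fun k _ _ =>
            mul_nonneg (h0 k) (Nat.cast_nonneg _)
      _ = (∑ k, lam k) * Fintype.card κ := by rw [Finset.sum_mul]
      _ ≤ _ := by gcongr
  have h2 : (Kᶜ.card : ℝ) * 2 ≤ Fintype.card κ := by
    refine le_of_mul_le_mul_right ?_ hT
    linarith
  linarith

/-- For fixed θ the inner sum may be enlarged to all sign vectors, its terms being positive, and is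
then an exponential moment of independent signs with coefficients ±a_k. -/
lemma sum_sum_exp_bitSign_le {ι : Type} [Fintype ι] [DecidableEq ι] (𝒢 : Finset (ι → Bool))
    (a : ι → ℝ) {η : ℝ} (hη : (∑ k, a k ^ 2) / 2 ≤ η) :
    ∑ θ ∈ 𝒢, ∑ θ' ∈ 𝒢, Real.exp (∑ k, bitSign (θ k) * bitSign (θ' k) * a k) ≤
      𝒢.card * (2 ^ Fintype.card ι * Real.exp η) := by
  have hsq : ∀ b, bitSign b ^ 2 = 1 := by intro b; cases b <;> simp [bitSign]
  have h : ∀ θ ∈ 𝒢, ∑ θ' ∈ 𝒢, Real.exp (∑ k, bitSign (θ k) * bitSign (θ' k) * a k) ≤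
      2 ^ Fintype.card ι * Real.exp η := by
    intro θ _
    have h1 := sum_exp_bitSign_le fun k => bitSign (θ k) * a k
    have e1 : ∀ k, (bitSign (θ k) * a k) ^ 2 = a k ^ 2 := fun k => by rw [mul_pow, hsq, one_mul]
    have e2 : ∀ (θ' : ι → Bool) k, bitSign (θ' k) * (bitSign (θ k) * a k) =
        bitSign (θ k) * bitSign (θ' k) * a k := fun θ' k => by ring
    simp only [e1, e2] at h1
    refine (Finset.sum_le_sum_of_subset_of_nonneg (Finset.subset_univ 𝒢) fun θ' _ _ =>
      (Real.exp_pos _).le).trans (h1.trans ?_)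
    exact mul_le_mul_of_nonneg_left (Real.exp_le_exp.2 hη) (by positivity)
  refine (Finset.sum_le_sum h).trans (le_of_eq ?_)
  rw [Finset.sum_const, nsmul_eq_mul]

/-- The mechanism is fixed before the perturbations are chosen, and so are its posteriors. The
perturbations can therefore be aligned with the directions about which the views of all rounds
together reveal little. -/
lemma le_radiusNI {s r c₀ p ε α β : ℝ} {n₁ n₂ : ℕ} (hd : 1 ≤ d) (hs : 0 < s) (hr : 0 < r)
    (hc₀ : 0 < c₀) (hc : c₀ ≤ 1 / 20) (hc₁ : supConst d * c₀ * (1 + 1 / s) ≤ 1 / 2)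
    (hc₂ : (d : ℝ) ^ s * c₀ ^ 2 ≤ r ^ 2) (hp : 1 ≤ p) (hp2 : p ≤ 2) (hε0 : 0 < ε) (hε : ε ≤ 1)
    (hα : 0 < α) (hβ : 0 < β) (hαβ : α + β ≤ 1 / 2) (hE : 4 ≤ n₁ * ε ^ 2) :
    c₀ * 2 ^ (-s) / (6 * supConst d) * (Real.log (n₁ * ε ^ 2))⁻¹ *
      (1 / (n₁ * ε ^ 2)) ^ (2 * s / (4 * s + 3 * d)) ≤ radiusNI s r d n₁ n₂ ε α β p := by
  have hd1 : (1 : ℝ) ≤ d := by exact_mod_cast hd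
  have hκ : 0 < 2 / (4 * s + 3 * d) := by positivity
  obtain ⟨L, hL, hEL, hρ⟩ := exists_lower_resolution hs hκ
    (by rw [div_le_one (by positivity)]; linarith) hE
  have hexp : 2 * s / (4 * s + 3 * d) = s * (2 / (4 * s + 3 * d)) := by ring
  rw [hexp]
  have hL0 : (0 : ℝ) < L := by exact_mod_cast hL
  have hE0 : (0 : ℝ) < n₁ * ε ^ 2 := by linarith
  set E : ℝ := n₁ * ε ^ 2 with hEdef
  set γ : ℝ := c₀ * (L : ℝ) ^ (-s) / √(L ^ d) with hγdef
  have hsN : 0 < √((L : ℝ) ^ d) := Real.sqrt_pos.2 (by positivity)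
  have hγ : γ * √(L ^ d) = c₀ * (L : ℝ) ^ (-s) := by rw [hγdef]; field_simp
  have hγ0 : 0 < γ := by positivity
  set N : ℝ := (L : ℝ) ^ d with hNdef
  have hN0 : 0 < N := by positivity
  -- The size of the χ² exponent: γ²N = c₀²L^{-2s}, and L^{4s+3d} ≥ E² by the choice of the
  -- resolution.
  have hγE : γ ^ 4 * E ^ 2 ≤ c₀ ^ 4 * N := by
    have h1 : E ^ 2 ≤ (L : ℝ) ^ (4 * s + 3 * d) := by
      have := Real.rpow_le_rpow (by positivity) hEL (show 0 ≤ 4 * s + 3 * d by positivity)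
      rwa [← Real.rpow_mul hE0.le, div_mul_cancel₀ _ (by positivity), Real.rpow_two] at this
    have h2 : γ ^ 2 * N = c₀ ^ 2 * (L : ℝ) ^ (-(2 * s)) := amplitude_sq hL hγ
    refine le_of_mul_le_mul_right ?_ (show 0 < N ^ 2 by positivity)
    calc γ ^ 4 * E ^ 2 * N ^ 2 = (γ ^ 2 * N) ^ 2 * E ^ 2 := by ring
      _ = c₀ ^ 4 * (L : ℝ) ^ (-(4 * s)) * E ^ 2 := by
          rw [h2, mul_pow, ← Real.rpow_natCast ((L : ℝ) ^ (-(2 * s))), ← Real.rpow_mul hL0.le]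
          rw [show -(2 * s) * ((2 : ℕ) : ℝ) = -(4 * s) by push_cast; ring]
          ring
      _ ≤ c₀ ^ 4 * (L : ℝ) ^ (-(4 * s)) * (L : ℝ) ^ (4 * s + 3 * d) := by gcongr
      _ = c₀ ^ 4 * N * N ^ 2 := by
          rw [mul_assoc, ← Real.rpow_add hL0, neg_add_cancel_left, hNdef,
            show (3 * d : ℝ) = ((3 * d : ℕ) : ℝ) by push_cast; ring, Real.rpow_natCast]
          ring
  refine le_separationRadius hs hr.le hp2 hε0 hε hα hβ hαβ fun M hM φ hφ => ?_
  have hNI := hM.2 rfl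
  have hne : ∀ t, t < n₁ → Nonempty (M.History t) := fun t ht =>
    (M.pairedLaw volume volume t ht.le).nonempty_of_neZero
  choose π₀ hmk hπ using fun t (ht : t < n₁) =>
    have := hne t ht
    exists_isPosterior_of_ignoresHistory (volume : Measure (Cube d)) (M.roundX t ht)
      (hNI.1 ⟨t, ht⟩)
  set π : M.Posteriors := fun t ht => (π₀ t ht).comap Prod.snd measurable_snd with hπdef
  have hmk' : ∀ t ht, IsMarkovKernel (π t ht) := fun t ht => by rw [hπdef]; infer_instance
  have hpost : ∀ t ht, IsPosterior (M.pairedLaw volume volume t ht.le) volume (M.roundX t ht)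
    (π t ht) := fun t ht => hπ t ht _
  set ν : ∀ i : Fin n₁, Measure (M.History i × M.Z) := fun i =>
    viewLaw (M.pairedLaw volume volume i i.2.le) volume (M.roundX i i.2) with hν
  set V₁ : (Fin d → Fin L) → (Fin d → Fin L) → ℝ := fun k l => if k = l then 1 else 0 with hV₁
  have hrot₁ : ∀ l, rotated V₁ l = trigProd (freq l) := fun l => by
    funext x; simp [rotated, hV₁]
  -- The total information matrix: second moments of the posterior means of the trigonometric
  -- functions, summed over the rounds. In its eigenbasis the total cross information of two
  -- different directions vanishes, though that of a single round need not.
  obtain ⟨V, hV, hdiag⟩ := exists_orthonormal_diagonal (fun l l' => ∑ i, ∫ q,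
    (∫ x, rotated V₁ l x ∂(π i i.2 q)) * (∫ x, rotated V₁ l' x ∂(π i i.2 q)) ∂(ν i))
    (fun l l' => Finset.sum_congr rfl fun i _ => by simp only [mul_comm])
  have hrot : ∀ (m : Measure (Cube d)) [IsProbabilityMeasure m] k,
      ∫ x, rotated V k x ∂m = ∑ l, V k l * ∫ x, rotated V₁ l x ∂m := fun m _ k => by
    have : ∀ x, rotated V k x = ∑ l, V k l * rotated V₁ l x := fun x => by
      simp only [hrot₁]; rfl
    simp only [this]
    rw [integral_finsetSum _ fun l _ => (integrable_rotated V₁ m l).const_mul _]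
    simp only [integral_const_mul]
  set lam : (Fin d → Fin L) → ℝ := fun k =>
    ∑ i, ∫ q, (∫ x, rotated V k x ∂(π i i.2 q)) ^ 2 ∂(ν i) with hlam
  have hoff : ∀ k k', k ≠ k' → ∑ i, ∫ q, (∫ x, rotated V k x ∂(π i i.2 q)) *
      (∫ x, rotated V k' x ∂(π i i.2 q)) ∂(ν i) = 0 := fun k k' hk => by
    rw [← hdiag k k' hk]
    have h1 : ∀ i : Fin n₁, ∫ q, (∫ x, rotated V k x ∂(π i i.2 q)) *
        (∫ x, rotated V k' x ∂(π i i.2 q)) ∂(ν i) = ∑ l, ∑ l', V k l * V k' l' *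
          ∫ q, (∫ x, rotated V₁ l x ∂(π i i.2 q)) * (∫ x, rotated V₁ l' x ∂(π i i.2 q)) ∂(ν i) :=
      fun i => by
        have : ∀ q, (∫ x, rotated V k x ∂(π i i.2 q)) * (∫ x, rotated V k' x ∂(π i i.2 q)) =
            ∑ l, ∑ l', V k l * V k' l' * ((∫ x, rotated V₁ l x ∂(π i i.2 q)) *
              (∫ x, rotated V₁ l' x ∂(π i i.2 q))) := fun q => by
          rw [hrot, hrot, Finset.sum_mul_sum]
          exact Finset.sum_congr rfl fun l _ => Finset.sum_congr rfl fun l' _ => by ring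
        simp only [this]
        rw [integral_finsetSum _ fun l _ => integrable_finsetSum _ fun l' _ =>
          (integrable_posterior_mul V₁ (π i i.2) _ l l').const_mul _]
        refine Finset.sum_congr rfl fun l _ => ?_
        rw [integral_finsetSum _ fun l' _ =>
          (integrable_posterior_mul V₁ (π i i.2) _ l l').const_mul _]
        simp only [integral_const_mul]
    simp only [h1, Finset.mul_sum]
    rw [Finset.sum_comm]
    exact Finset.sum_congr rfl fun l _ => Finset.sum_comm
  have hlam0 : ∀ k, 0 ≤ lam k := fun k =>
    Finset.sum_nonneg fun i _ => integral_nonneg fun q => sq_nonneg _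
  have hlamsum : ∑ k, lam k ≤ 9 / 4 * E := by
    rw [hlam, Finset.sum_comm]
    calc _ ≤ ∑ _i : Fin n₁, 9 / 4 * ε ^ 2 := Finset.sum_le_sum fun i _ =>
          (sum_integral_rotated_sq_le hV hd (hpost i i.2) (hM.1.1 i) hε0.le).trans
            (sinh_sq_le hε0.le hε)
      _ = _ := by simp [hEdef]; ring
  have hcardN : (Fintype.card (Fin d → Fin L) : ℝ) = N := by simp [hNdef]
  -- The trace is at most 9E/4, so at least half of the eigenvalues are at most 9E/(2N). Dropping
  -- the others costs only a constant in the L₂ size of the perturbation.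
  set K := Finset.univ.filter fun k => lam k * Fintype.card (Fin d → Fin L) ≤ 2 * (9 / 4 * E)
    with hK
  have hKcard : N / 2 ≤ K.card := by
    rw [← hcardN]; exact half_le_card_filter lam hlam0 (by positivity) hlamsum
  have hKle : K.card ≤ L ^ d := by
    have := Finset.card_le_univ K
    simpa using this
  set W : {k // k ∈ K} → (Fin d → Fin L) → ℝ := fun k => V k.1 with hW
  have hWo : ∀ k k', ∑ l, W k l * W k' l = if k = k' then 1 else 0 := fun k k' => by
    rw [hW]; simp only [hV, Subtype.ext_iff]
  have hcard : Fintype.card {k // k ∈ K} = K.card := Fintype.card_coe K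
  obtain ⟨𝒢, h𝒢, hsup⟩ := exists_signs γ hWo hd hL hγ0 (hcard.le.trans hKle)
  have h𝒢0 : (0 : ℝ) < 𝒢.card := lt_of_lt_of_le (by positivity) h𝒢
  have hhalf : ∀ θ ∈ 𝒢, ∀ x, |perturb W γ θ x| ≤ 1 / 2 := fun θ hθ =>
    perturb_le_half hs hL hγ hc₀ hc₁ (hsup θ hθ)
  set e : ({k // k ∈ K} → Bool) → ({k // k ∈ K} → Bool) → ℕ → ℝ := fun θ θ' t =>
    if ht : t < n₁ then ∫ q, (∫ x, perturb W γ θ x ∂(π₀ t ht q.2)) *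
      (∫ x, perturb W γ θ' x ∂(π₀ t ht q.2)) ∂(ν ⟨t, ht⟩) else 0 with he
  have hcorr : ∀ θ ∈ 𝒢, ∀ θ' ∈ 𝒢, ∫ v, Mechanism.likelihoodRatio π (perturb W γ θ) n₁ le_rfl v *
      Mechanism.likelihoodRatio π (perturb W γ θ') n₁ le_rfl v
        ∂(M.pairedLaw volume volume n₁ le_rfl) ≤
      Real.exp (∑ t ∈ Finset.range n₁, e θ θ' t) := fun θ hθ θ' hθ' =>
    Mechanism.integral_likelihoodRatio_mul_le hNI π₀ hpost
      (continuous_perturb W γ θ).measurable (hhalf θ hθ) (integral_perturb W γ hd θ)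
      (continuous_perturb W γ θ').measurable (hhalf θ' hθ') (integral_perturb W γ hd θ')
      (fun t ht => by simp only [he, dif_pos ht]; exact le_rfl) n₁ le_rfl
  -- By diagonality, the exponent of the correlation of two likelihood ratios is a linear form in
  -- the products of their signs.
  have hesum : ∀ θ θ', ∑ t ∈ Finset.range n₁, e θ θ' t =
      ∑ k : {k // k ∈ K}, bitSign (θ k) * bitSign (θ' k) * (γ ^ 2 * lam k.1) := fun θ θ' => by
    rw [Finset.sum_range]
    have h1 : ∀ i : Fin n₁, e θ θ' i = ∑ k : {k // k ∈ K}, ∑ k' : {k // k ∈ K},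
        bitSign (θ k) * bitSign (θ' k') * γ ^ 2 * ∫ q, (∫ x, rotated V k.1 x ∂(π i i.2 q)) *
          (∫ x, rotated V k'.1 x ∂(π i i.2 q)) ∂(ν i) := fun i => by
      have : ∀ q, (∫ x, perturb W γ θ x ∂(π i i.2 q)) * (∫ x, perturb W γ θ' x ∂(π i i.2 q)) =
          ∑ k : {k // k ∈ K}, ∑ k' : {k // k ∈ K}, bitSign (θ k) * bitSign (θ' k') * γ ^ 2 *
            ((∫ x, rotated V k.1 x ∂(π i i.2 q)) * (∫ x, rotated V k'.1 x ∂(π i i.2 q))) :=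
        fun q => by
          rw [integral_perturb_eq, integral_perturb_eq, mul_mul_mul_comm, Finset.sum_mul_sum,
            Finset.mul_sum]
          refine Finset.sum_congr rfl fun k _ => ?_
          rw [Finset.mul_sum]
          refine Finset.sum_congr rfl fun k' _ => ?_
          show γ * γ * (bitSign (θ k) * (∫ x, rotated V k.1 x ∂(π i i.2 q)) *
            (bitSign (θ' k') * (∫ x, rotated V k'.1 x ∂(π i i.2 q)))) = _
          ring
      simp only [he, dif_pos i.2]
      show ∫ q, (∫ x, perturb W γ θ x ∂(π i i.2 q)) * (∫ x, perturb W γ θ' x ∂(π i i.2 q))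
        ∂(ν i) = _
      simp only [this]
      rw [integral_finsetSum _ fun k _ => integrable_finsetSum _ fun k' _ =>
        (integrable_posterior_mul V (π i i.2) _ k.1 k'.1).const_mul _]
      refine Finset.sum_congr rfl fun k _ => ?_
      rw [integral_finsetSum _ fun k' _ =>
        (integrable_posterior_mul V (π i i.2) _ k.1 k'.1).const_mul _]
      simp only [integral_const_mul]
    simp only [h1]
    rw [Finset.sum_comm]
    refine Finset.sum_congr rfl fun k _ => ?_
    rw [Finset.sum_comm]
    simp only [← Finset.mul_sum]
    rw [Finset.sum_eq_single k]
    · rw [mul_assoc _ (γ ^ 2)]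
      simp only [hlam, pow_two (∫ x, _ ∂_)]
    · intro k' _ hk'
      rw [hoff k.1 k'.1 (fun h => hk' (Subtype.ext h).symm), mul_zero]
    · intro h; exact absurd (Finset.mem_univ k) h
  have hη : (∑ k : {k // k ∈ K}, (γ ^ 2 * lam k.1) ^ 2) / 2 ≤ 1 / 100 := by
    have h1 : ∀ k : {k // k ∈ K}, (γ ^ 2 * lam k.1) ^ 2 ≤ γ ^ 4 * (9 / 2 * E / N) ^ 2 := fun k => by
      have h2 : lam k.1 ≤ 9 / 2 * E / N := by
        have := (Finset.mem_filter.1 k.2).2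
        rw [hcardN] at this
        rw [le_div_iff₀ hN0]; linarith
      have h3 := pow_le_pow_left₀ (hlam0 k.1) h2 2
      calc (γ ^ 2 * lam k.1) ^ 2 = γ ^ 4 * lam k.1 ^ 2 := by ring
        _ ≤ _ := by gcongr
    have h4 : ∑ k : {k // k ∈ K}, (γ ^ 2 * lam k.1) ^ 2 ≤ 81 / 4 * c₀ ^ 4 := by
      calc ∑ k : {k // k ∈ K}, (γ ^ 2 * lam k.1) ^ 2
          ≤ ∑ _k : {k // k ∈ K}, γ ^ 4 * (9 / 2 * E / N) ^ 2 := Finset.sum_le_sum fun k _ => h1 k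
        _ = K.card * (γ ^ 4 * (9 / 2 * E / N) ^ 2) := by
            rw [Finset.sum_const, nsmul_eq_mul, Finset.card_univ, hcard]
        _ ≤ N * (γ ^ 4 * (9 / 2 * E / N) ^ 2) := by
            gcongr
            rw [hNdef]; exact_mod_cast hKle
        _ = 81 / 4 * (γ ^ 4 * E ^ 2) / N := by field_simp; ring
        _ ≤ 81 / 4 * (c₀ ^ 4 * N) / N := by gcongr
        _ = _ := by field_simp
    have h5 : c₀ ^ 4 ≤ (1 / 20) ^ 4 := by gcongr
    linarith
  -- The correlation bound loses 100/99 here and 1/0.99 because `𝒢` omits up to one percent of the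
  -- signs; the product stays below 1 + 1/16.
  have hexp1 : Real.exp (1 / 100) ≤ 100 / 99 := by
    have := Real.add_one_le_exp (-(1 / 100) : ℝ)
    rw [Real.exp_neg, le_inv_comm₀ (by norm_num) (Real.exp_pos _)] at this
    refine this.trans (by norm_num)
  obtain ⟨θ, hθ, hle⟩ := Mechanism.exists_law_ge_of_correlation (f := perturb W γ) π hpost
    (Finset.card_pos.1 (by exact_mod_cast h𝒢0))
    (fun θ _ => (continuous_perturb W γ θ).measurable) hhalf
    (fun θ _ => integral_perturb W γ hd θ) (by
      calc _ ≤ ∑ θ ∈ 𝒢, ∑ θ' ∈ 𝒢, Real.exp (∑ k : {k // k ∈ K},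
            bitSign (θ k) * bitSign (θ' k) * (γ ^ 2 * lam k.1)) :=
            Finset.sum_le_sum fun θ hθ => Finset.sum_le_sum fun θ' hθ' => by
              rw [← hesum]; exact hcorr θ hθ θ' hθ'
        _ ≤ 𝒢.card * (2 ^ Fintype.card {k // k ∈ K} * Real.exp (1 / 100)) :=
            sum_sum_exp_bitSign_le 𝒢 _ hη
        _ ≤ 𝒢.card * (𝒢.card / 0.99 * (100 / 99)) := by
            gcongr
            rw [le_div_iff₀ (by norm_num)]; linarith
        _ = (𝒢.card : ℝ) ^ 2 * (1 / 0.99 * (100 / 99)) := by ring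
        _ ≤ _ := by gcongr; norm_num) hφ
  refine ⟨fun x => 1 + perturb W γ θ x, ?_, hle⟩
  refine perturb_mem_altPairs hWo hd hs hL hγ hc₀ hc₁ hc₂ (hcard.le.trans hKle) ?_ (hsup θ hθ) hp
    (hρ c₀ (supConst d) hc₀ (supConst_pos d))
  rw [hcard]
  exact hKcard

/-- One amplitude meets three demands: indistinguishability, perturbations below 1/2, and membership
in the Sobolev ball, where the frequencies have norm up to √d·L. -/
lemma exists_amplitude {s r : ℝ} (hd : 1 ≤ d) (hs : 0 < s) (hr : 0 < r) :
    ∃ c₀ : ℝ, 0 < c₀ ∧ c₀ ≤ 1 / 20 ∧ supConst d * c₀ * (1 + 1 / s) ≤ 1 / 2 ∧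
      (d : ℝ) ^ s * c₀ ^ 2 ≤ r ^ 2 := by
  have hB := supConst_pos d
  have hds : 1 ≤ (d : ℝ) ^ s := Real.one_le_rpow (by exact_mod_cast hd) hs.le
  have hB' : 0 < 2 * (supConst d * (1 + 1 / s)) := by positivity
  set c₀ := min (1 / 20) (min (1 / (2 * (supConst d * (1 + 1 / s)))) (r / (d : ℝ) ^ s)) with hc
  have h0 : 0 < c₀ := by rw [hc]; positivity
  have h1 : c₀ ≤ 1 / (2 * (supConst d * (1 + 1 / s))) :=
    (min_le_right _ _).trans (min_le_left _ _)
  have h2 : c₀ ≤ r / (d : ℝ) ^ s := (min_le_right _ _).trans (min_le_right _ _)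
  refine ⟨c₀, h0, min_le_left _ _, ?_, ?_⟩
  · rw [le_div_iff₀ hB'] at h1
    linarith
  · rw [le_div_iff₀ (by positivity)] at h2
    calc (d : ℝ) ^ s * c₀ ^ 2 ≤ (d : ℝ) ^ s * c₀ ^ 2 * (d : ℝ) ^ s :=
          le_mul_of_one_le_right (by positivity) hds
      _ = (c₀ * (d : ℝ) ^ s) ^ 2 := by ring
      _ ≤ r ^ 2 := by gcongr

end LDPTwoSample

end

/-! ### The separation rates. -/

theorem theorem6 :
    ∃ C : ℝ, 0 < C ∧ ∀ (d : ℕ) (s r : ℝ), 1 ≤ d → 0 < s → 0 < r →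
      ∃ c₁ C₁ c₂ C₂ : ℝ, 0 < c₁ ∧ 0 < C₁ ∧ 0 < c₂ ∧ 0 < C₂ ∧
        ∀ (p : ℝ) (n₁ n₂ : ℕ) (ε α β : ℝ), 1 ≤ p → p ≤ 2 → 1 ≤ n₁ → n₁ ≤ n₂ →
          0 < ε → ε ≤ 1 → 0 < α → 0 < β → α + β ≤ 1 / 2 →
          C * Real.log (1 / (α * β)) ≤ n₁ * ε ^ 2 →
          (c₁ * (Real.log (n₁ * ε ^ 2))⁻¹ * (1 / (n₁ * ε ^ 2)) ^ (2 * s / (4 * s + 3 * d))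
              ≤ LDPTwoSample.radiusNI s r d n₁ n₂ ε α β p ∧
            LDPTwoSample.radiusNI s r d n₁ n₂ ε α β p
              ≤ C₁ * (Real.log (1 / (α * β)) ^ 2 / (n₁ * ε ^ 2)) ^ (2 * s / (4 * s + 3 * d))) ∧
          (c₂ * (Real.log (n₁ * ε ^ 2))⁻¹ * (1 / (n₁ * ε ^ 2)) ^ (2 * s / (4 * s + 2 * d))
              ≤ LDPTwoSample.radiusI s r d n₁ n₂ ε α β p ∧
            LDPTwoSample.radiusI s r d n₁ n₂ ε α β p
              ≤ C₂ * ((Real.log (n₂ / β) * Real.log (1 / (α * β))) ^ 2 / (n₁ * ε ^ 2))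
                ^ (2 * s / (4 * s + 2 * d))) := by
  -- As log(1/(αβ)) > 2.7, the constant 2 ensures n₁ε² ≥ 4, which the lower bounds need; the upper
  -- bounds hold without it.
  refine ⟨2, by norm_num, fun d s r hd hs hr => ?_⟩
  obtain ⟨c₀, hc₀, hc, hc₁, hc₂⟩ := LDPTwoSample.exists_amplitude hd hs hr
  have hB := LDPTwoSample.supConst_pos d
  refine ⟨c₀ * 2 ^ (-s) / (6 * LDPTwoSample.supConst d), √(4 * r ^ 2 * 4 ^ s + 64 * 2 ^ d * 800),
    c₀ * 2 ^ (-s) / (6 * LDPTwoSample.supConst d),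
    √(4 * r ^ 2 * 4 ^ s + 64 * 2 ^ d * (768 + 24 * (10 + 40 * d ^ 2))), by positivity,
    by positivity, by positivity, by positivity,
    fun p n₁ n₂ ε α β hp hp2 hn hn12 hε0 hε hα hβ hαβ hE => ?_⟩
  have hE4 : 4 ≤ n₁ * ε ^ 2 := by linarith [(LDPTwoSample.log_bounds hα hβ hαβ).1]
  exact ⟨⟨LDPTwoSample.le_radiusNI hd hs hr hc₀ hc hc₁ hc₂ hp hp2 hε0 hε hα hβ hαβ hE4,
      LDPTwoSample.radiusNI_le hd hs hr hp2 hε0 hε hα hβ hαβ hn⟩,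
    LDPTwoSample.le_radiusI hd hs hr hc₀ hc hc₁ hc₂ hp hp2 hε0 hε hα hβ hαβ hE4,
      LDPTwoSample.radiusI_le hd hs hr hp2 hε0 hε hα hβ hαβ hn hn12⟩
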